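/- **Setup.** Let $\Bbbk$ be a commutative ring. For $r\ge 0$ let $\mathrm{AH}_r$ be the degenerate affine Hecke algebra: the $\Bbbk$-algebra generated by commuting elements $x_1,\dots,x_r$ and by basic transpositions $s_1,\dots,s_{r-1}$ satisfying the Coxeter relations of the symmetric group $S_r$, subject to $s_ix_i=x_{i+1}s_i+1$, $x_is_i=s_ix_{i+1}+1$, and $x_is_j=s_jx_i$ for $i\ne j,j+1$. For a composition $\lambda=(\lambda_1,\dots,\lambda_n)$ of $r$ (zero parts allowed) let $S_\lambda=S_{\lambda_1}\times\cdots\times S_{\lambda_n}\subseteq S_r$, let $M(\lambda)$ be the right permutation $\Bbbk S_r$-module induced from the trivial $\Bbbk S_\lambda$-module, and let $m_\lambda$ be its canonical generator, so that $m_\lambda w=m_\lambda$ for $w\in S_\lambda$. The degenerate affine Schur category $\mathbf{ASchur}$ has all compositions as objects, and $$\operatorname{Hom}(\mu,\lambda)=\operatorname{Hom}_{\mathrm{AH}_r}\big(M(\mu)\otimes_{\Bbbk S_r}\mathrm{AH}_r,\;M(\lambda)\otimes_{\Bbbk S_r}\mathrm{AH}_r\big)\quad\text{if } |\lambda|=|\mu|=r,$$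 and $\operatorname{Hom}(\mu,\lambda)=0$ if $|\lambda|\ne|\mu|$, with the usual composition $\circ$ of maps. The tensor product $*$ is concatenation of compositions on objects; on morphisms it is induced by the induction product: if $f(m_\mu\otimes1)=m_\lambda\otimes p$ with $p\in\mathrm{AH}_a$ and $f'(m_{\mu'}\otimes1)=m_{\lambda'}\otimes p'$ with $p'\in\mathrm{AH}_b$, then $f*f'$ sends $m_{\mu\mu'}\otimes1$ to $m_{\lambda\lambda'}\otimes(p\otimes p')$, where $\mathrm{AH}_a\otimes\mathrm{AH}_b$ is identified with a subalgebra of $\mathrm{AH}_{a+b}$ in the usual way. Write $1_r$ for the identity of the object $(r)$. For $a,b,r\ge0$ consider the following morphisms. * The merge $\mathrm{me}_{a,b}:(a,b)\to(a+b)$, $\;m_{(a,b)}\otimes1\mapsto m_{(a+b)}\otimes1$. * The split $\mathrm{sp}_{a,b}:(a+b)\to(a,b)$, $\;m_{(a+b)}\otimes1\mapsto\sum_y m_{(a,b)}\otimes y$, where $y$ runs over representatives of the cosets $(S_a\times S_b)\backslash S_{a+b}$. * The thick crossing $X_{a,b}:(a,b)\to(b,a)$, $\;m_{(a,b)}\otimes1\mapsto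 m_{(b,a)}\otimes d$, where $d\in S_{a+b}$ is given by $d(i)=i+b$ for $1\le i\le a$ and $d(a+j)=j$ for $1\le j\le b$. * For a symmetric polynomial $f\in\Bbbk[x_1,\dots,x_r]^{S_r}$, the pin labelled $f$, which is the endomorphism of $(r)$ with $m_{(r)}\otimes1\mapsto m_{(r)}\otimes f$. Let $\mathbf{ASchur}[u]$ be the category with the same objects and with morphism spaces $\operatorname{Hom}(\mu,\lambda)[u]$, with $\circ$ and $*$ extended $u$-bilinearly. Let $P_r(u)\in\operatorname{End}((r))[u]$ be the pin labelled $(u-x_1)(u-x_2)\cdots(u-x_r)$, that is, the sum over $n$ of $u^n$ times the pin labelled by the coefficient of $u^n$ in this product (so $P_0(u)$ is the identity). For $a,b\ge0$ and $0\le s\le\min(a,b)$ put $$\Delta_s=\mathrm{sp}_{s,a-s}*\mathrm{sp}_{b-s,s}:(a,b)\to(s,a-s,b-s,s),$$ $$C_s=1_s*X_{a-s,b-s}*1_s:(s,a-s,b-s,s)\to(s,b-s,a-s,s),$$ $$\nabla_s=\mathrm{me}_{s,b-s}*\mathrm{me}_{a-s,s}:(s,b-s,a-s,s)\to(b,a).$$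 **Theorem 5.1 (bingley).** For every commutative ring $\Bbbk$ and all $a,b\ge0$, the following equations hold in $\mathbf{ASchur}[u]$: 1. $\displaystyle X_{a,b}\circ\big(P_a(u)*1_b\big)=\sum_{s=0}^{\min(a,b)}(-1)^s\,s!\;\nabla_s\circ\big(1_s*1_{b-s}*P_{a-s}(u)*1_s\big)\circ C_s\circ\Delta_s$; 2. $\displaystyle \big(P_b(u)*1_a\big)\circ X_{a,b}=\sum_{s=0}^{\min(a,b)}(-1)^s\,s!\;\nabla_s\circ C_s\circ\big(1_s*1_{a-s}*P_{b-s}(u)*1_s\big)\circ\Delta_s$; 3. $\displaystyle X_{a,b}\circ\big(1_a*P_b(u)\big)=\sum_{s=0}^{\min(a,b)}s!\;\nabla_s\circ\big(1_s*P_{b-s}(u)*1_{a-s}*1_s\big)\circ C_s\circ\Delta_s$; 4. $\displaystyle \big(1_b*P_a(u)\big)\circ X_{a,b}=\sum_{s=0}^{\min(a,b)}s!\;\nabla_s\circ C_s\circ\big(1_s*P_{a-s}(u)*1_{b-s}*1_s\big)\circ\Delta_s$. -/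

import Mathlib

open CategoryTheory

universe u

namespace AffineSchur

/-- The basic transposition `s_i = (i  i+1)` of `{0, …, r-1}`. -/
def adj (r i : ℕ) (h : i + 1 < r) : Equiv.Perm (Fin r) :=
  Equiv.swap ⟨i, Nat.lt_of_succ_lt h⟩ ⟨i + 1, h⟩

/-- The defining relations of the degenerate affine Hecke algebra, on the generators `x_j`
(`Sum.inl j`) and `w ∈ S_r` (`Sum.inr w`): the elements `w` multiply as in the symmetric group,
the `x_j` commute, and `s_i x_i = x_{i+1} s_i + 1`, `x_i s_i = s_i x_{i+1} + 1`,
`x_j s_i = s_i x_j` for `j ≠ i, i+1`. -/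
inductive DAHARel (k : Type u) [CommRing k] (r : ℕ) :
    FreeAlgebra k (Fin r ⊕ Equiv.Perm (Fin r)) →
      FreeAlgebra k (Fin r ⊕ Equiv.Perm (Fin r)) → Prop
  | one : DAHARel k r (FreeAlgebra.ι k (Sum.inr 1)) 1
  | mul (v w : Equiv.Perm (Fin r)) :
      DAHARel k r (FreeAlgebra.ι k (Sum.inr (v * w)))
        (FreeAlgebra.ι k (Sum.inr v) * FreeAlgebra.ι k (Sum.inr w))
  | comm (i j : Fin r) :
      DAHARel k r (FreeAlgebra.ι k (Sum.inl i) * FreeAlgebra.ι k (Sum.inl j))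
        (FreeAlgebra.ι k (Sum.inl j) * FreeAlgebra.ι k (Sum.inl i))
  | adj_x (i : ℕ) (h : i + 1 < r) :
      DAHARel k r
        (FreeAlgebra.ι k (Sum.inr (adj r i h)) *
          FreeAlgebra.ι k (Sum.inl ⟨i, Nat.lt_of_succ_lt h⟩))
        (FreeAlgebra.ι k (Sum.inl ⟨i + 1, h⟩) * FreeAlgebra.ι k (Sum.inr (adj r i h)) + 1)
  | x_adj (i : ℕ) (h : i + 1 < r) :
      DAHARel k r
        (FreeAlgebra.ι k (Sum.inl ⟨i, Nat.lt_of_succ_lt h⟩) *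
          FreeAlgebra.ι k (Sum.inr (adj r i h)))
        (FreeAlgebra.ι k (Sum.inr (adj r i h)) * FreeAlgebra.ι k (Sum.inl ⟨i + 1, h⟩) + 1)
  | far (i : ℕ) (h : i + 1 < r) (j : Fin r) (h₁ : (j : ℕ) ≠ i) (h₂ : (j : ℕ) ≠ i + 1) :
      DAHARel k r
        (FreeAlgebra.ι k (Sum.inl j) * FreeAlgebra.ι k (Sum.inr (adj r i h)))
        (FreeAlgebra.ι k (Sum.inr (adj r i h)) * FreeAlgebra.ι k (Sum.inl j))

/-- The degenerate affine Hecke algebra `AH_r` over `k`. Its generators are the `x_j` and all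
elements of the symmetric group `S_r`; by the Coxeter presentation of `S_r` this is the same
algebra as the one generated by the `x_j` and the basic transpositions. -/
abbrev DAHA (k : Type u) [CommRing k] (r : ℕ) : Type u := RingQuot (DAHARel k r)

namespace DAHA

variable {k : Type u} [CommRing k] {r : ℕ}

/-- The polynomial generator `x_j` (with `j` counted from `0`). -/
def x (k : Type u) [CommRing k] {r : ℕ} (j : Fin r) : DAHA k r :=
  RingQuot.mkAlgHom k (DAHARel k r) (FreeAlgebra.ι k (Sum.inl j))

/-- A permutation as an element of `AH_r`. -/
def t (k : Type u) [CommRing k] {r : ℕ} (w : Equiv.Perm (Fin r)) : DAHA k r :=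
  RingQuot.mkAlgHom k (DAHARel k r) (FreeAlgebra.ι k (Sum.inr w))

theorem t_one : t k (1 : Equiv.Perm (Fin r)) = 1 := by
  simpa [t, x] using RingQuot.mkAlgHom_rel k (DAHARel.one (k := k) (r := r))

theorem t_mul (v w : Equiv.Perm (Fin r)) : t k (v * w) = t k v * t k w := by
  simpa [t, x] using RingQuot.mkAlgHom_rel k (DAHARel.mul (k := k) (r := r) v w)

theorem x_comm (i j : Fin r) : x k i * x k j = x k j * x k i := by
  simpa [t, x] using RingQuot.mkAlgHom_rel k (DAHARel.comm (k := k) (r := r) i j)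

theorem adj_x (i : ℕ) (h : i + 1 < r) :
    t k (adj r i h) * x k ⟨i, Nat.lt_of_succ_lt h⟩ = x k ⟨i + 1, h⟩ * t k (adj r i h) + 1 := by
  simpa [t, x] using RingQuot.mkAlgHom_rel k (DAHARel.adj_x (k := k) (r := r) i h)

theorem x_adj (i : ℕ) (h : i + 1 < r) :
    x k ⟨i, Nat.lt_of_succ_lt h⟩ * t k (adj r i h) = t k (adj r i h) * x k ⟨i + 1, h⟩ + 1 := by
  simpa [t, x] using RingQuot.mkAlgHom_rel k (DAHARel.x_adj (k := k) (r := r) i h)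

theorem far (i : ℕ) (h : i + 1 < r) (j : Fin r) (h₁ : (j : ℕ) ≠ i) (h₂ : (j : ℕ) ≠ i + 1) :
    x k j * t k (adj r i h) = t k (adj r i h) * x k j := by
  simpa [t, x] using RingQuot.mkAlgHom_rel k (DAHARel.far (k := k) (r := r) i h j h₁ h₂)

/-- An algebra homomorphism out of `AH_r` from images of the generators. -/
def lift {A : Type u} [Ring A] [Algebra k A] (fx : Fin r → A) (ft : Equiv.Perm (Fin r) → A)
    (h1 : ft 1 = 1) (hmul : ∀ v w, ft (v * w) = ft v * ft w)
    (hcomm : ∀ i j, fx i * fx j = fx j * fx i)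
    (hadj : ∀ (i : ℕ) (h : i + 1 < r), ft (adj r i h) * fx ⟨i, Nat.lt_of_succ_lt h⟩ =
      fx ⟨i + 1, h⟩ * ft (adj r i h) + 1)
    (hadj' : ∀ (i : ℕ) (h : i + 1 < r), fx ⟨i, Nat.lt_of_succ_lt h⟩ * ft (adj r i h) =
      ft (adj r i h) * fx ⟨i + 1, h⟩ + 1)
    (hfar : ∀ (i : ℕ) (h : i + 1 < r) (j : Fin r), (j : ℕ) ≠ i → (j : ℕ) ≠ i + 1 →
      fx j * ft (adj r i h) = ft (adj r i h) * fx j) :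
    DAHA k r →ₐ[k] A :=
  RingQuot.liftAlgHom k ⟨FreeAlgebra.lift k (Sum.elim fx ft), by
    intro a b hab
    cases hab <;> simp_all⟩

section
variable {A : Type u} [Ring A] [Algebra k A] {fx : Fin r → A} {ft : Equiv.Perm (Fin r) → A}
    {h1 hmul hcomm hadj hadj' hfar}

theorem lift_x (j : Fin r) :
    lift (k := k) fx ft h1 hmul hcomm hadj hadj' hfar (x k j) = fx j := by
  simp [lift, x]

theorem lift_t (w : Equiv.Perm (Fin r)) :
    lift (k := k) fx ft h1 hmul hcomm hadj hadj' hfar (t k w) = ft w := by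
  simp [lift, t]

end

/-- `AH_r` is generated by the `x_j` and the permutations. -/
theorem mem_of_gens (S : Subalgebra k (DAHA k r)) (hx : ∀ j, x k j ∈ S) (ht : ∀ w, t k w ∈ S)
    (a : DAHA k r) : a ∈ S := by
  obtain ⟨a, rfl⟩ := RingQuot.mkAlgHom_surjective k (DAHARel k r) a
  induction a using FreeAlgebra.induction with
  | grade0 c => rw [AlgHom.commutes]; exact S.algebraMap_mem c
  | grade1 g => rcases g with j | w; exacts [hx j, ht w]
  | mul a b ha hb => rw [map_mul]; exact S.mul_mem ha hb
  | add a b ha hb => rw [map_add]; exact S.add_mem ha hb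

/-- Induction on permutations through multiplication by basic transpositions. -/
theorem perm_induction {p : Equiv.Perm (Fin r) → Prop} (h1 : p 1)
    (hmul : ∀ v w, p v → p w → p (v * w)) (hs : ∀ i h, p (adj r i h)) (w) : p w := by
  cases r with
  | zero => rw [Subsingleton.elim w 1]; exact h1
  | succ n =>
    have hw : w ∈ Submonoid.closure (Set.range fun i : Fin n => Equiv.swap i.castSucc i.succ) := by
      rw [Equiv.Perm.mclosure_swap_castSucc_succ]; trivial
    induction hw using Submonoid.closure_induction with
    | mem y hy =>
      obtain ⟨i, rfl⟩ := hy
      exact hs i (by omega)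
    | one => exact h1
    | mul a b _ _ ha hb => exact hmul a b ha hb

/-- The inclusion of `{0, …, a-1}` into `{0, …, r-1}` as the interval starting at `m`. -/
def shiftEmb (m a r : ℕ) (h : m + a ≤ r) : Fin a ↪ Fin r :=
  ⟨fun i => ⟨m + i, by omega⟩, fun i j hij => by simpa [Fin.ext_iff] using hij⟩

/-- `S_a` as the subgroup of `S_r` permuting `{m, …, m+a-1}`. -/
noncomputable def shiftPerm (m a r : ℕ) (h : m + a ≤ r) :
    Equiv.Perm (Fin a) →* Equiv.Perm (Fin r) :=
  Equiv.Perm.viaEmbeddingHom (shiftEmb m a r h)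

theorem shiftPerm_in (m a r : ℕ) (h : m + a ≤ r) (w : Equiv.Perm (Fin a)) (i : Fin a) :
    shiftPerm m a r h w ⟨m + i, by omega⟩ = ⟨m + w i, by omega⟩ :=
  Equiv.Perm.viaEmbedding_apply w (shiftEmb m a r h) i

theorem shiftPerm_out (m a r : ℕ) (h : m + a ≤ r) (w : Equiv.Perm (Fin a)) (i : Fin r)
    (hi : (i : ℕ) < m ∨ m + a ≤ i) : shiftPerm m a r h w i = i := by
  refine Equiv.Perm.viaEmbedding_apply_of_notMem w (shiftEmb m a r h) i ?_
  rintro ⟨j, rfl⟩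
  change m + (j : ℕ) < m ∨ m + a ≤ m + (j : ℕ) at hi
  omega

theorem shiftPerm_adj (m a r : ℕ) (h : m + a ≤ r) (i : ℕ) (hi : i + 1 < a) :
    shiftPerm m a r h (adj a i hi) = adj r (m + i) (by omega) := by
  have hb : ∀ j : Fin a, m + (j : ℕ) < r := fun j => by omega
  ext j
  by_cases hj : (j : ℕ) < m ∨ m + a ≤ j
  · rw [shiftPerm_out m a r h _ j hj, adj, Equiv.swap_apply_of_ne_of_ne] <;>
      simp only [ne_eq, Fin.ext_iff] <;> omega
  · obtain ⟨j', hj'⟩ : ∃ j' : Fin a, j = ⟨m + j', hb j'⟩ :=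
      ⟨⟨j - m, by omega⟩, by ext; simp; omega⟩
    subst hj'
    rw [shiftPerm_in]
    simp only [adj, Equiv.swap_apply_def, Fin.ext_iff]
    split_ifs <;> simp_all <;> omega

/-- The embedding `AH_a → AH_r` onto the tensor factor in positions `m, …, m+a-1`:
`x_j ↦ x_{m+j}` and `s_i ↦ s_{m+i}`. -/
noncomputable def shift (k : Type u) [CommRing k] (m a r : ℕ) (h : m + a ≤ r) :
    DAHA k a →ₐ[k] DAHA k r :=
  lift (fun j => x k ⟨m + j, by omega⟩) (fun w => t k (shiftPerm m a r h w))
    (by rw [map_one, t_one]) (fun v w => by rw [map_mul, t_mul])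
    (fun i j => x_comm _ _)
    (fun i hi => by rw [shiftPerm_adj]; exact adj_x (m + i) _)
    (fun i hi => by rw [shiftPerm_adj]; exact x_adj (m + i) _)
    (fun i hi j h₁ h₂ => by
      rw [shiftPerm_adj]
      exact far (m + i) _ _ (by simpa using h₁) (by simp; omega))

theorem shift_t (m a r : ℕ) (h : m + a ≤ r) (w : Equiv.Perm (Fin a)) :
    shift k m a r h (t k w) = t k (shiftPerm m a r h w) := lift_t w

theorem shift_x (m a r : ℕ) (h : m + a ≤ r) (j : Fin a) :
    shift k m a r h (x k j) = x k ⟨m + j, by omega⟩ := lift_x j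

/-- Permutations of an interval commute with the `x_j` outside of it. -/
theorem shift_t_x (m a r : ℕ) (h : m + a ≤ r) (w : Equiv.Perm (Fin a)) (j : Fin r)
    (hj : (j : ℕ) < m ∨ m + a ≤ j) :
    x k j * t k (shiftPerm m a r h w) = t k (shiftPerm m a r h w) * x k j := by
  induction w using perm_induction with
  | h1 => simp [t_one]
  | hmul v w hv hw => rw [map_mul, t_mul, ← mul_assoc, hv, mul_assoc, hw, mul_assoc]
  | hs i hi => rw [shiftPerm_adj]; exact far _ _ _ (by omega) (by omega)

theorem shift_commute (a b r : ℕ) (h : a + b = r) (p : DAHA k a) (q : DAHA k b) :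
    shift k 0 a r (by omega) p * shift k a b r (by omega) q =
      shift k a b r (by omega) q * shift k 0 a r (by omega) p := by
  have key : ∀ (w : Equiv.Perm (Fin a)) (v : Equiv.Perm (Fin b)),
      shiftPerm 0 a r (by omega) w * shiftPerm a b r (by omega) v =
        shiftPerm a b r (by omega) v * shiftPerm 0 a r (by omega) w := by
    intro w v
    refine (Equiv.Perm.Disjoint.commute fun j => ?_)
    by_cases hj : (j : ℕ) < a
    · exact Or.inr (shiftPerm_out _ _ _ _ _ _ (Or.inl hj))
    · exact Or.inl (shiftPerm_out _ _ _ _ _ _ (Or.inr (by omega)))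
  have hq : ∀ (p : DAHA k a) (y : DAHA k r),
      (∀ j, y * shift k 0 a r (by omega) (x k j) = shift k 0 a r (by omega) (x k j) * y) →
      (∀ w, y * shift k 0 a r (by omega) (t k w) = shift k 0 a r (by omega) (t k w) * y) →
      y * shift k 0 a r (by omega) p = shift k 0 a r (by omega) p * y := by
    intro p y hx ht
    have := mem_of_gens ((Subalgebra.centralizer k {y}).comap (shift k 0 a r (by omega)))
      (fun j => by simpa [Subalgebra.mem_centralizer_iff] using hx j)
      (fun w => by simpa [Subalgebra.mem_centralizer_iff] using ht w) p
    simpa [Subalgebra.mem_centralizer_iff] using this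
  have := mem_of_gens ((Subalgebra.centralizer k {shift k 0 a r (by omega) p}).comap
      (shift k a b r (by omega)))
      (fun j => by
        simp only [Subalgebra.mem_comap, Subalgebra.mem_centralizer_iff, Set.mem_singleton_iff,
          forall_eq]
        refine (hq p _ (fun i => ?_) (fun w => ?_)).symm
        · rw [shift_x, shift_x]; exact x_comm _ _
        · rw [shift_x, shift_t]; exact shift_t_x _ _ _ _ _ _ (Or.inr (by simp)))
      (fun w => by
        simp only [Subalgebra.mem_comap, Subalgebra.mem_centralizer_iff, Set.mem_singleton_iff,
          forall_eq]
        refine (hq p _ (fun i => ?_) (fun v => ?_)).symm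
        · rw [shift_x, shift_t]; exact (shift_t_x _ _ _ _ _ _ (Or.inl (by simp))).symm
        · rw [shift_t, shift_t, ← t_mul, ← t_mul, key]) q
  simpa [Subalgebra.mem_centralizer_iff] using this

/-- The subalgebra of `AH_r` generated by the commuting elements `x_j`. -/
abbrev polySub (k : Type u) [CommRing k] (r : ℕ) : Subalgebra k (DAHA k r) :=
  Algebra.adjoin k (Set.range (x k))

instance polySub_comm (k : Type u) [CommRing k] (r : ℕ) : IsMulCommutative (polySub k r) :=
  Algebra.isMulCommutative_adjoin k (by rintro _ ⟨i, rfl⟩ _ ⟨j, rfl⟩; exact x_comm i j)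

open scoped IsMulCommutative in
/-- The homomorphism from the polynomial algebra `P_r = k[x_1, …, x_r]` to `AH_r`. -/
noncomputable def poly (k : Type u) [CommRing k] (r : ℕ) :
    MvPolynomial (Fin r) k →ₐ[k] DAHA k r :=
  (polySub k r).val.comp
    (MvPolynomial.aeval fun j => (⟨x k j, Algebra.subset_adjoin ⟨j, rfl⟩⟩ : polySub k r))

open scoped IsMulCommutative in
theorem poly_X (j : Fin r) : poly k r (MvPolynomial.X j) = x k j := by
  simp [poly]

/-- Differences of two distinct variables are not zero divisors. -/
theorem eq_zero_of_X_sub_X_mul {i j : Fin r} (hij : i ≠ j) {g : MvPolynomial (Fin r) k}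
    (h : (MvPolynomial.X i - MvPolynomial.X j) * g = 0) : g = 0 := by
  classical
  let σ : MvPolynomial (Fin r) k →ₐ[k] MvPolynomial (Fin r) k :=
    MvPolynomial.aeval (Function.update MvPolynomial.X i (MvPolynomial.X i + MvPolynomial.X j))
  let τ : MvPolynomial (Fin r) k →ₐ[k] MvPolynomial (Fin r) k :=
    MvPolynomial.aeval (Function.update MvPolynomial.X i (MvPolynomial.X i - MvPolynomial.X j))
  have hτσ : τ.comp σ = AlgHom.id k _ := by
    ext l : 1
    by_cases hl : l = i
    · subst hl; simp [σ, τ, hij.symm]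
    · simp [σ, τ, hl]
  have h1 : MvPolynomial.X i * σ g = 0 := by
    have := congrArg σ h
    simpa [σ, hij.symm] using this
  have h2 : σ g = 0 := by
    ext m
    have := congrArg (MvPolynomial.coeff (Finsupp.single i 1 + m)) h1
    rwa [MvPolynomial.coeff_X_mul] at this
  have := congrArg τ h2
  rw [map_zero] at this
  rw [← this]
  exact (DFunLike.congr_fun hτσ g).symm

/-- `s_i f = s_i(f) s_i + g` where `g` is the quotient of `f - s_i(f)` by `x_i - x_{i+1}`. -/
theorem exists_demazure (i : ℕ) (h : i + 1 < r) (f : MvPolynomial (Fin r) k) :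
    ∃ g : MvPolynomial (Fin r) k,
      (MvPolynomial.X ⟨i, Nat.lt_of_succ_lt h⟩ - MvPolynomial.X ⟨i + 1, h⟩) * g =
        f - MvPolynomial.rename (adj r i h) f ∧
      t k (adj r i h) * poly k r f =
        poly k r (MvPolynomial.rename (adj r i h) f) * t k (adj r i h) + poly k r g := by
  induction f using MvPolynomial.induction_on with
  | C c =>
    refine ⟨0, by simp, ?_⟩
    have : poly k r (MvPolynomial.C c) = algebraMap k _ c := (poly k r).commutes c
    simp [this, Algebra.commutes]
  | add p q hp hq =>
    obtain ⟨a, ha, ha'⟩ := hp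
    obtain ⟨b, hb, hb'⟩ := hq
    refine ⟨a + b, by rw [mul_add, ha, hb, map_add]; ring, ?_⟩
    simp only [map_add, mul_add, add_mul, ha', hb']
    abel
  | mul_X p j hp =>
    obtain ⟨a, ha, ha'⟩ := hp
    by_cases h1 : (j : ℕ) = i
    · obtain rfl : j = ⟨i, Nat.lt_of_succ_lt h⟩ := Fin.ext h1
      refine ⟨a * MvPolynomial.X ⟨i, Nat.lt_of_succ_lt h⟩ +
        MvPolynomial.rename (adj r i h) p, ?_, ?_⟩
      · rw [mul_add, ← mul_assoc, ha]
        simp [adj]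
        ring
      · have e : adj r i h ⟨i, Nat.lt_of_succ_lt h⟩ = ⟨i + 1, h⟩ := Equiv.swap_apply_left _ _
        simp only [map_add, map_mul, MvPolynomial.rename_X, poly_X, e]
        rw [← mul_assoc, ha', add_mul, mul_assoc, adj_x]
        noncomm_ring
    · by_cases h2 : (j : ℕ) = i + 1
      · obtain rfl : j = ⟨i + 1, h⟩ := Fin.ext h2
        refine ⟨a * MvPolynomial.X ⟨i + 1, h⟩ - MvPolynomial.rename (adj r i h) p, ?_, ?_⟩
        · rw [mul_sub, ← mul_assoc, ha]
          simp [adj]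
          ring
        · have e : adj r i h ⟨i + 1, h⟩ = ⟨i, Nat.lt_of_succ_lt h⟩ := Equiv.swap_apply_right _ _
          simp only [map_sub, map_mul, MvPolynomial.rename_X, poly_X, e]
          have := x_adj (k := k) i h
          rw [← mul_assoc, ha', add_mul, mul_assoc, ← sub_eq_iff_eq_add.2 this, mul_sub, mul_one,
            mul_assoc]
          abel
      · refine ⟨a * MvPolynomial.X j, ?_, ?_⟩
        · have e : adj r i h j = j :=
            Equiv.swap_apply_of_ne_of_ne (by simpa [Fin.ext_iff] using h1)
              (by simpa [Fin.ext_iff] using h2)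
          rw [← mul_assoc, ha]
          simp [e]
          ring
        · have e : adj r i h j = j :=
            Equiv.swap_apply_of_ne_of_ne (by simpa [Fin.ext_iff] using h1)
              (by simpa [Fin.ext_iff] using h2)
          simp only [map_mul, MvPolynomial.rename_X, poly_X, e]
          rw [← mul_assoc, ha', add_mul, mul_assoc, ← far i h j h1 h2]
          noncomm_ring

/-- Symmetric polynomials commute with all permutations. -/
theorem t_poly_symm {f : MvPolynomial (Fin r) k} (hf : f.IsSymmetric) (w : Equiv.Perm (Fin r)) :
    t k w * poly k r f = poly k r f * t k w := by
  induction w using perm_induction with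
  | h1 => simp [t_one]
  | hmul v w hv hw => rw [t_mul, mul_assoc, hw, ← mul_assoc, hv, mul_assoc]
  | hs i h =>
    obtain ⟨g, hg, hg'⟩ := exists_demazure (k := k) i h f
    rw [hf (adj r i h)] at hg hg'
    rw [sub_self] at hg
    have hne : (⟨i, Nat.lt_of_succ_lt h⟩ : Fin r) ≠ ⟨i + 1, h⟩ := by simp [Fin.ext_iff]
    rw [eq_zero_of_X_sub_X_mul hne hg, map_zero, add_zero] at hg'
    exact hg'

end DAHA

/-- The index of the part of the composition `l` that contains the position `i` (counted from
`0`); positions beyond `|l|` get the index `ℓ(l)`. -/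
def blockIdx : List ℕ → ℕ → ℕ
  | [], _ => 0
  | a :: l, i => if i < a then 0 else blockIdx l (i - a) + 1

/-- The parabolic subgroup `S_l = S_{l_1} × S_{l_2} × ⋯` of `S_r` for a composition `l` of `r`:
the permutations that preserve each of the consecutive intervals of lengths `l_1, l_2, …`. -/
def young (r : ℕ) (l : List ℕ) : Subgroup (Equiv.Perm (Fin r)) where
  carrier := {w | ∀ i, blockIdx l (w i) = blockIdx l i}
  one_mem' _ := rfl
  mul_mem' {v w} hv hw i := (hv (w i)).trans (hw i)
  inv_mem' {w} hw i := by simpa using (hw (w⁻¹ i)).symm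

theorem mem_young {r : ℕ} {l : List ℕ} {w : Equiv.Perm (Fin r)} :
    w ∈ young r l ↔ ∀ i, blockIdx l (w i) = blockIdx l i := Iff.rfl

open MulOpposite

/-- The right ideal of `AH_r` generated by the elements `w - 1` for `w ∈ S_l`. -/
def indRel (k : Type u) [CommRing k] (r : ℕ) (l : List ℕ) :
    Submodule (DAHA k r)ᵐᵒᵖ (DAHA k r) :=
  Submodule.span _ {a | ∃ w ∈ young r l, a = DAHA.t k w - 1}

/-- For a composition `l` of `r`, the right `AH_r`-module induced from the trivial module of
`k S_l`, i.e. `k ⊗_{k S_l} AH_r = M(l) ⊗_{k S_r} AH_r` with `M(l) = k ⊗_{k S_l} k S_r` the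
permutation module, constructed as the quotient of `AH_r` by the right ideal generated by all
`w - 1`, `w ∈ S_l`. Right modules are modules over the opposite algebra. -/
def IndMod (k : Type u) [CommRing k] (r : ℕ) (l : List ℕ) : Type u :=
  DAHA k r ⧸ indRel k r l

namespace IndMod

variable {k : Type u} [CommRing k] {r : ℕ} {l : List ℕ}

instance : AddCommGroup (IndMod k r l) := inferInstanceAs (AddCommGroup (DAHA k r ⧸ indRel k r l))

instance : Module (DAHA k r)ᵐᵒᵖ (IndMod k r l) :=
  inferInstanceAs (Module (DAHA k r)ᵐᵒᵖ (DAHA k r ⧸ indRel k r l))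

instance : Module k (IndMod k r l) := inferInstanceAs (Module k (DAHA k r ⧸ indRel k r l))

instance : IsScalarTower k (DAHA k r)ᵐᵒᵖ (IndMod k r l) :=
  inferInstanceAs (IsScalarTower k (DAHA k r)ᵐᵒᵖ (DAHA k r ⧸ indRel k r l))

instance : SMulCommClass (DAHA k r)ᵐᵒᵖ k (IndMod k r l) :=
  inferInstanceAs (SMulCommClass (DAHA k r)ᵐᵒᵖ k (DAHA k r ⧸ indRel k r l))

/-- The canonical generator `m_l ⊗ 1`. -/
def gen (k : Type u) [CommRing k] (r : ℕ) (l : List ℕ) : IndMod k r l :=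
  Submodule.Quotient.mk (p := indRel k r l) 1

theorem gen_t {w : Equiv.Perm (Fin r)} (hw : w ∈ young r l) :
    op (DAHA.t k w) • gen k r l = gen k r l := by
  refine (Submodule.Quotient.eq (indRel k r l)).2 ?_
  exact Submodule.subset_span ⟨w, hw, by simp⟩

/-- The homomorphism of right modules sending the generator `m_l ⊗ 1` to a given vector `v` that
is invariant under `S_l`, along a homomorphism `φ` of algebras. -/
def descAlong {a : ℕ} {l' : List ℕ} (φ : DAHA k a →ₐ[k] DAHA k r) (v : IndMod k r l')
    (hv : ∀ w ∈ young a l, op (φ (DAHA.t k w)) • v = v) :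
    IndMod k a l →ₛₗ[φ.toRingHom.op] IndMod k r l' :=
  (indRel k a l).liftQ
    { toFun := fun h => op (φ h) • v
      map_add' := fun g h => by rw [map_add, MulOpposite.op_add, add_smul]
      map_smul' := fun c h => by
        change op (φ (h * c.unop)) • v = op (φ c.unop) • op (φ h) • v
        rw [map_mul, op_mul, mul_smul] }
    (by
      rw [indRel, Submodule.span_le]
      rintro _ ⟨w, hw, rfl⟩
      change op (φ (DAHA.t k w - 1)) • v = 0
      rw [map_sub, map_one, MulOpposite.op_sub, sub_smul, hv w hw, op_one, one_smul, sub_self])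

theorem descAlong_gen {a : ℕ} {l' : List ℕ} (φ : DAHA k a →ₐ[k] DAHA k r) (v : IndMod k r l')
    (hv : ∀ w ∈ young a l, op (φ (DAHA.t k w)) • v = v) :
    descAlong φ v hv (gen k a l) = v := by
  change op (φ 1) • v = v
  rw [map_one, op_one, one_smul]

/-- The homomorphism of right `AH_r`-modules sending the generator `m_l ⊗ 1` to a given vector
that is invariant under `S_l`. -/
def desc {l' : List ℕ} (v : IndMod k r l')
    (hv : ∀ w ∈ young r l, op (DAHA.t k w) • v = v) :
    IndMod k r l →ₗ[(DAHA k r)ᵐᵒᵖ] IndMod k r l' :=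
  (indRel k r l).liftQ
    { toFun := fun h => op h • v
      map_add' := fun g h => by rw [MulOpposite.op_add, add_smul]
      map_smul' := fun c h => by
        change op (h * c.unop) • v = c • op h • v
        rw [op_mul, mul_smul, op_unop] }
    (by
      rw [indRel, Submodule.span_le]
      rintro _ ⟨w, hw, rfl⟩
      change op (DAHA.t k w - 1) • v = 0
      rw [MulOpposite.op_sub, sub_smul, hv w hw, op_one, one_smul, sub_self])

theorem desc_gen {l' : List ℕ} (v : IndMod k r l')
    (hv : ∀ w ∈ young r l, op (DAHA.t k w) • v = v) : desc v hv (gen k r l) = v := by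
  change op (1 : DAHA k r) • v = v
  rw [op_one, one_smul]

end IndMod

/-- The objects of the degenerate affine Schur category over `k`: all compositions, i.e. finite
sequences of natural numbers (zero parts are allowed). -/
structure ASchur (k : Type u) [CommRing k] where
  /-- The underlying composition. -/
  parts : List ℕ

namespace ASchur

variable {k : Type u} [CommRing k]

/-- A composition as an object. -/
abbrev obj (k : Type u) [CommRing k] (l : List ℕ) : ASchur k := ⟨l⟩

/-- The set of `r` with `r = |X|` and `r = |Y|`: it has one element if `|X| = |Y|` and is empty
otherwise. -/
abbrev Deg (X Y : ASchur k) : Type := {r : ℕ // X.parts.sum = r ∧ Y.parts.sum = r}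

/-- Morphisms `X → Y`: if `|X| = |Y| = r`, the homomorphisms of right `AH_r`-modules from
`M(X) ⊗ AH_r` to `M(Y) ⊗ AH_r`; if `|X| ≠ |Y|`, the zero module (functions on the empty set). -/
abbrev HomType (X Y : ASchur k) : Type u :=
  ∀ r : Deg X Y, IndMod k r.1 X.parts →ₗ[(DAHA k r.1)ᵐᵒᵖ] IndMod k r.1 Y.parts

/-- Composition of homomorphisms (zero if the degrees do not match). -/
def compHom {X Y Z : ASchur k} (f : HomType X Y) (g : HomType Y Z) : HomType X Z := fun r =>
  if h : Y.parts.sum = r.1 then (g ⟨r.1, h, r.2.2⟩) ∘ₗ (f ⟨r.1, r.2.1, h⟩) else 0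

theorem compHom_pos {X Y Z : ASchur k} (f : HomType X Y) (g : HomType Y Z) (r : Deg X Z)
    (h : Y.parts.sum = r.1) :
    compHom f g r = (g ⟨r.1, h, r.2.2⟩) ∘ₗ (f ⟨r.1, r.2.1, h⟩) := dif_pos h

theorem compHom_neg {X Y Z : ASchur k} (f : HomType X Y) (g : HomType Y Z) (r : Deg X Z)
    (h : Y.parts.sum ≠ r.1) : compHom f g r = 0 := dif_neg h

/-- The identity homomorphism. -/
def idHom (X : ASchur k) : HomType X X := fun _ => LinearMap.id

theorem idHom_comp {X Y : ASchur k} (f : HomType X Y) : compHom (idHom X) f = f := by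
  funext r
  rw [compHom_pos _ _ _ r.2.1]
  exact LinearMap.comp_id _

theorem comp_idHom {X Y : ASchur k} (f : HomType X Y) : compHom f (idHom Y) = f := by
  funext r
  rw [compHom_pos _ _ _ r.2.2]
  exact LinearMap.id_comp _

theorem compHom_assoc {W X Y Z : ASchur k} (f : HomType W X) (g : HomType X Y)
    (h : HomType Y Z) : compHom (compHom f g) h = compHom f (compHom g h) := by
  funext r
  by_cases h1 : X.parts.sum = r.1
  · by_cases h2 : Y.parts.sum = r.1
    · rw [compHom_pos _ h r h2, compHom_pos f _ r h1, compHom_pos f g _ h1, compHom_pos g h _ h2,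
        LinearMap.comp_assoc]
    · rw [compHom_neg _ h r h2, compHom_pos f _ r h1, compHom_neg g h _ h2, LinearMap.zero_comp]
  · by_cases h2 : Y.parts.sum = r.1
    · rw [compHom_pos _ h r h2, compHom_neg f _ r h1, compHom_neg f g _ h1, LinearMap.comp_zero]
    · rw [compHom_neg _ h r h2, compHom_neg f _ r h1]

theorem add_compHom {X Y Z : ASchur k} (f f' : HomType X Y) (g : HomType Y Z) :
    compHom (f + f') g = compHom f g + compHom f' g := by
  funext r
  rw [Pi.add_apply]
  by_cases h : Y.parts.sum = r.1
  · rw [compHom_pos _ _ _ h, compHom_pos _ _ _ h, compHom_pos _ _ _ h, Pi.add_apply,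
      LinearMap.comp_add]
  · rw [compHom_neg _ _ _ h, compHom_neg _ _ _ h, compHom_neg _ _ _ h, add_zero]

theorem compHom_add {X Y Z : ASchur k} (f : HomType X Y) (g g' : HomType Y Z) :
    compHom f (g + g') = compHom f g + compHom f g' := by
  funext r
  rw [Pi.add_apply]
  by_cases h : Y.parts.sum = r.1
  · rw [compHom_pos _ _ _ h, compHom_pos _ _ _ h, compHom_pos _ _ _ h, Pi.add_apply,
      LinearMap.add_comp]
  · rw [compHom_neg _ _ _ h, compHom_neg _ _ _ h, compHom_neg _ _ _ h, add_zero]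

theorem smul_compHom {X Y Z : ASchur k} (c : k) (f : HomType X Y) (g : HomType Y Z) :
    compHom (c • f) g = c • compHom f g := by
  funext r
  rw [Pi.smul_apply]
  by_cases h : Y.parts.sum = r.1
  · rw [compHom_pos _ _ _ h, compHom_pos _ _ _ h, Pi.smul_apply]
    ext v
    exact LinearMap.map_smul_of_tower _ c _
  · rw [compHom_neg _ _ _ h, compHom_neg _ _ _ h, smul_zero]

theorem compHom_smul {X Y Z : ASchur k} (c : k) (f : HomType X Y) (g : HomType Y Z) :
    compHom f (c • g) = c • compHom f g := by
  funext r
  rw [Pi.smul_apply]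
  by_cases h : Y.parts.sum = r.1
  · rw [compHom_pos _ _ _ h, compHom_pos _ _ _ h, Pi.smul_apply, LinearMap.smul_comp]
  · rw [compHom_neg _ _ _ h, compHom_neg _ _ _ h, smul_zero]

instance : Category.{u} (ASchur k) where
  Hom X Y := HomType X Y
  id X := idHom X
  comp f g := compHom f g
  id_comp f := idHom_comp f
  comp_id f := comp_idHom f
  assoc f g h := compHom_assoc f g h

instance instAddCommGroupHom (X Y : ASchur k) : AddCommGroup (X ⟶ Y) :=
  inferInstanceAs (AddCommGroup (∀ r : Deg X Y,
    IndMod k r.1 X.parts →ₗ[(DAHA k r.1)ᵐᵒᵖ] IndMod k r.1 Y.parts))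

instance (X Y : ASchur k) : Module k (X ⟶ Y) :=
  inferInstanceAs (Module k (∀ r : Deg X Y,
    IndMod k r.1 X.parts →ₗ[(DAHA k r.1)ᵐᵒᵖ] IndMod k r.1 Y.parts))

instance : Preadditive (ASchur k) where
  homGroup X Y := instAddCommGroupHom X Y
  add_comp _ _ _ f f' g := add_compHom f f' g
  comp_add _ _ _ f g g' := compHom_add f g g'

instance : Linear k (ASchur k) where
  smul_comp _ _ _ c f g := smul_compHom c f g
  comp_smul _ _ _ f c g := compHom_smul c f g

end ASchur

/-! ### Horizontal composition -/

theorem blockIdx_append_left {l l' : List ℕ} {i : ℕ} (hi : i < l.sum) :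
    blockIdx (l ++ l') i = blockIdx l i := by
  induction l generalizing i with
  | nil => simp at hi
  | cons a l ih =>
    simp only [List.cons_append, blockIdx]
    by_cases h : i < a
    · simp [h]
    · rw [List.sum_cons] at hi
      simp [h, ih (show i - a < l.sum by omega)]

theorem blockIdx_append_right {l l' : List ℕ} (i : ℕ) :
    blockIdx (l ++ l') (l.sum + i) = l.length + blockIdx l' i := by
  induction l with
  | nil => simp
  | cons a l ih =>
    simp only [List.cons_append, blockIdx, List.sum_cons, List.length_cons]
    rw [if_neg (by omega), show a + l.sum + i - a = l.sum + i by omega, ih]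
    omega

theorem blockIdx_lt {l : List ℕ} {i : ℕ} (hi : i < l.sum) : blockIdx l i < l.length := by
  induction l generalizing i with
  | nil => simp at hi
  | cons a l ih =>
    simp only [blockIdx, List.length_cons]
    by_cases h : i < a
    · simp [h]
    · rw [List.sum_cons] at hi
      rw [if_neg h]
      exact Nat.succ_lt_succ (ih (by omega))

theorem shiftPerm_mem_left {a b r : ℕ} (h : a + b = r) {l l' : List ℕ} (hl : l.sum = a)
    {w : Equiv.Perm (Fin a)} (hw : w ∈ young a l) :
    DAHA.shiftPerm 0 a r (by omega) w ∈ young r (l ++ l') := by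
  intro i
  by_cases hi : (i : ℕ) < a
  · have e := DAHA.shiftPerm_in 0 a r (by omega) w ⟨i, hi⟩
    simp only [zero_add] at e
    rw [e]
    simp only
    rw [blockIdx_append_left (by omega), blockIdx_append_left (by omega)]
    exact hw ⟨i, hi⟩
  · rw [DAHA.shiftPerm_out 0 a r (by omega) w i (Or.inr (by omega))]

theorem shiftPerm_mem_right {a b r : ℕ} (h : a + b = r) {l l' : List ℕ} (hl : l.sum = a)
    {w : Equiv.Perm (Fin b)} (hw : w ∈ young b l') :
    DAHA.shiftPerm a b r (by omega) w ∈ young r (l ++ l') := by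
  have hb : ∀ j, j < b → a + j < r := fun j hj => by omega
  intro i
  by_cases hi : (i : ℕ) < a
  · rw [DAHA.shiftPerm_out a b r (by omega) w i (Or.inl hi)]
  · obtain ⟨j, hj⟩ : ∃ j, (i : ℕ) = a + j := ⟨i - a, by omega⟩
    have hjb : j < b := by omega
    obtain rfl : i = ⟨a + j, hb j hjb⟩ := Fin.ext hj
    rw [DAHA.shiftPerm_in a b r (by omega) w ⟨j, hjb⟩]
    simp only
    subst hl
    rw [blockIdx_append_right, blockIdx_append_right]
    exact congrArg _ (hw ⟨j, hjb⟩)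

/-- `S_{l l'} = S_l × S_{l'}` for a concatenation of compositions. -/
theorem young_append {a b r : ℕ} (h : a + b = r) {l l' : List ℕ} (hl : l.sum = a)
    (hl' : l'.sum = b) {w : Equiv.Perm (Fin r)} (hw : w ∈ young r (l ++ l')) :
    ∃ w₁ ∈ young a l, ∃ w₂ ∈ young b l',
      w = DAHA.shiftPerm 0 a r (by omega) w₁ * DAHA.shiftPerm a b r (by omega) w₂ := by
  have hb : ∀ j, j < b → a + j < r := fun j hj => by omega
  have small : ∀ v ∈ young r (l ++ l'), ∀ i : Fin r, (i : ℕ) < a → (v i : ℕ) < a := by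
    intro v hv i hi
    by_contra hc
    have h1 := hv i
    have e1 := blockIdx_append_left (l := l) (l' := l') (i := i) (by omega)
    have e2 := blockIdx_append_right (l := l) (l' := l') (v i - a)
    have e3 : l.sum + ((v i : ℕ) - a) = v i := by omega
    rw [e3] at e2
    have := blockIdx_lt (l := l) (i := i) (by omega)
    omega
  have large : ∀ v ∈ young r (l ++ l'), ∀ i : Fin r, a ≤ (i : ℕ) → a ≤ (v i : ℕ) := by
    intro v hv i hi
    by_contra hc
    have := small v⁻¹ (inv_mem hv) (v i) (by omega)
    simp at this
    omega
  have hw' := inv_mem hw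
  let w₁ : Equiv.Perm (Fin a) :=
    { toFun := fun i => ⟨w ⟨i, by omega⟩, small w hw _ i.2⟩
      invFun := fun i => ⟨w⁻¹ ⟨i, by omega⟩, small w⁻¹ hw' _ i.2⟩
      left_inv := fun i => by simp
      right_inv := fun i => by simp }
  have lb : ∀ v ∈ young r (l ++ l'), ∀ (j : ℕ) (hj : j < b),
      a + ((v ⟨a + j, hb j hj⟩ : Fin r) - a : ℕ) = (v ⟨a + j, hb j hj⟩ : Fin r) := by
    intro v hv j hj
    have := large v hv ⟨a + j, hb j hj⟩ (by simp)
    omega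
  have lt : ∀ v ∈ young r (l ++ l'), ∀ (j : ℕ) (hj : j < b),
      ((v ⟨a + j, hb j hj⟩ : Fin r) - a : ℕ) < b := by
    intro v hv j hj
    have := lb v hv j hj
    omega
  let w₂ : Equiv.Perm (Fin b) :=
    { toFun := fun i => ⟨w ⟨a + i, hb i i.2⟩ - a, lt w hw i i.2⟩
      invFun := fun i => ⟨w⁻¹ ⟨a + i, hb i i.2⟩ - a, lt w⁻¹ hw' i i.2⟩
      left_inv := fun i => by
        ext
        simp [lb w hw i i.2]
      right_inv := fun i => by
        ext
        have := lb w⁻¹ hw' i i.2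
        simp only [this]
        simp }
  refine ⟨w₁, fun i => ?_, w₂, fun i => ?_, ?_⟩
  · have h1 := hw ⟨i, by omega⟩
    have h2 := small w hw ⟨i, by omega⟩ i.2
    rwa [blockIdx_append_left (by omega), blockIdx_append_left (by simp; omega)] at h1
  · have h1 := hw ⟨a + i, by omega⟩
    rw [← lb w hw i i.2] at h1
    subst hl
    rw [blockIdx_append_right, blockIdx_append_right] at h1
    exact Nat.add_left_cancel h1
  · ext i
    rw [Equiv.Perm.mul_apply]
    by_cases hi : (i : ℕ) < a
    · rw [DAHA.shiftPerm_out a b r (by omega) w₂ i (Or.inl hi)]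
      have e := DAHA.shiftPerm_in 0 a r (by omega) w₁ ⟨i, hi⟩
      simp only [zero_add] at e
      rw [e]
      rfl
    · obtain ⟨j, hj⟩ : ∃ j, (i : ℕ) = a + j := ⟨i - a, by omega⟩
      have hjb : j < b := by omega
      obtain rfl : i = ⟨a + j, hb j hjb⟩ := Fin.ext hj
      rw [DAHA.shiftPerm_in a b r (by omega) w₂ ⟨j, hjb⟩,
        DAHA.shiftPerm_out 0 a r (by omega) w₁ _ (Or.inr (by simp))]
      exact (lb w hw j hjb).symm

namespace IndMod

variable {k : Type u} [CommRing k]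

/-- The map `[q] ↦ m_{l l'} ⊗ (1 ⊗ q)`. -/
noncomputable def juxtRight {a b r : ℕ} (h : a + b = r) {l : List ℕ} (hl : l.sum = a)
    (l' : List ℕ) :
    IndMod k b l' →ₛₗ[(DAHA.shift k a b r (by omega)).toRingHom.op] IndMod k r (l ++ l') :=
  descAlong (DAHA.shift k a b r (by omega)) (gen k r (l ++ l'))
    (fun w hw => by rw [DAHA.shift_t]; exact gen_t (shiftPerm_mem_right h hl hw))

theorem juxtRight_inv {a b r : ℕ} (h : a + b = r) {l : List ℕ} (hl : l.sum = a)
    {l' : List ℕ} (v : IndMod k b l') (w : Equiv.Perm (Fin a)) (hw : w ∈ young a l) :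
    op (DAHA.shift k 0 a r (by omega) (DAHA.t k w)) • juxtRight h hl l' v =
      juxtRight h hl l' v := by
  obtain ⟨q, rfl⟩ := Submodule.Quotient.mk_surjective _ v
  change op (DAHA.shift k 0 a r (by omega) (DAHA.t k w)) •
    op (DAHA.shift k a b r (by omega) q) • gen k r (l ++ l') =
      op (DAHA.shift k a b r (by omega) q) • gen k r (l ++ l')
  rw [← mul_smul, ← op_mul, ← DAHA.shift_commute a b r h, op_mul, mul_smul, DAHA.shift_t,
    gen_t (shiftPerm_mem_left h hl hw)]

/-- The canonical map from `(M(l) ⊗ AH_a) ⊗ (M(l') ⊗ AH_b)` to its induction product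
`M(l l') ⊗ AH_{a+b}`, on pure tensors: `[p], [q] ↦ m_{l l'} ⊗ (p ⊗ q)`, where `p ⊗ q` stands for
the product in `AH_{a+b}` of the images of `p` and `q`. -/
noncomputable def juxt {a b r : ℕ} (h : a + b = r) {l l' : List ℕ} (hl : l.sum = a)
    (u : IndMod k a l) (v : IndMod k b l') : IndMod k r (l ++ l') :=
  descAlong (DAHA.shift k 0 a r (by omega)) (juxtRight h hl l' v) (juxtRight_inv h hl v) u

theorem juxt_smul_left {a b r : ℕ} (h : a + b = r) {l l' : List ℕ} (hl : l.sum = a)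
    (u : IndMod k a l) (v : IndMod k b l') (c : DAHA k a) :
    juxt h hl (op c • u) v = op (DAHA.shift k 0 a r (by omega) c) • juxt h hl u v :=
  LinearMap.map_smulₛₗ _ _ _

theorem juxt_smul_right {a b r : ℕ} (h : a + b = r) {l l' : List ℕ} (hl : l.sum = a)
    (u : IndMod k a l) (v : IndMod k b l') (c : DAHA k b) :
    juxt h hl u (op c • v) = op (DAHA.shift k a b r (by omega) c) • juxt h hl u v := by
  obtain ⟨p, rfl⟩ := Submodule.Quotient.mk_surjective _ u
  have e : juxtRight h hl l' (op c • v) =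
      op (DAHA.shift k a b r (by omega) c) • juxtRight h hl l' v := LinearMap.map_smulₛₗ _ _ _
  change op (DAHA.shift k 0 a r (by omega) p) • juxtRight h hl l' (op c • v) =
    op (DAHA.shift k a b r (by omega) c) •
      op (DAHA.shift k 0 a r (by omega) p) • juxtRight h hl l' v
  rw [e, ← mul_smul, ← mul_smul, ← op_mul, ← op_mul, DAHA.shift_commute a b r h]

/-- On representatives, `juxt` is `[p], [q] ↦ [p ⊗ q]`. -/
theorem juxt_mk {a b r : ℕ} (h : a + b = r) {l l' : List ℕ} (hl : l.sum = a)
    (p : DAHA k a) (q : DAHA k b) :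
    juxt h hl (op p • gen k a l) (op q • gen k b l') =
      op (DAHA.shift k 0 a r (by omega) p * DAHA.shift k a b r (by omega) q) •
        gen k r (l ++ l') := by
  have e : juxt h hl (gen k a l) (gen k b l') = gen k r (l ++ l') := by
    rw [juxt, descAlong_gen, juxtRight, descAlong_gen]
  rw [juxt_smul_left, juxt_smul_right, e, ← mul_smul, ← op_mul, DAHA.shift_commute a b r h]

theorem juxt_inv {a b r : ℕ} (h : a + b = r) {m m' l l' : List ℕ} (hm : m.sum = a)
    (hm' : m'.sum = b) (hl : l.sum = a) (u : IndMod k a l) (v : IndMod k b l')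
    (hu : ∀ w ∈ young a m, op (DAHA.t k w) • u = u)
    (hv : ∀ w ∈ young b m', op (DAHA.t k w) • v = v) (w : Equiv.Perm (Fin r))
    (hw : w ∈ young r (m ++ m')) :
    op (DAHA.t k w) • juxt h hl u v = juxt h hl u v := by
  obtain ⟨w₁, hw₁, w₂, hw₂, rfl⟩ := young_append h hm hm' hw
  rw [DAHA.t_mul, op_mul, mul_smul, ← DAHA.shift_t, ← DAHA.shift_t, ← juxt_smul_left, hu _ hw₁,
    ← juxt_smul_right, hv _ hw₂]

theorem map_inv {l l' : List ℕ} {r : ℕ} (f : IndMod k r l →ₗ[(DAHA k r)ᵐᵒᵖ] IndMod k r l')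
    (w : Equiv.Perm (Fin r)) (hw : w ∈ young r l) :
    op (DAHA.t k w) • f (gen k r l) = f (gen k r l) := by
  rw [← LinearMap.map_smul, gen_t hw]

end IndMod

namespace ASchur

variable {k : Type u} [CommRing k]

/-- The tensor product of objects: concatenation of compositions. -/
abbrev concat (X Y : ASchur k) : ASchur k := ⟨X.parts ++ Y.parts⟩

theorem deg_concat_left {X X' Y Y' : ASchur k} (r : Deg (X.concat X') (Y.concat Y')) :
    X.parts.sum + X'.parts.sum = r.1 :=
  List.sum_append.symm.trans r.2.1

theorem deg_concat_right {X X' Y Y' : ASchur k} (r : Deg (X.concat X') (Y.concat Y')) :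
    Y.parts.sum + Y'.parts.sum = r.1 :=
  List.sum_append.symm.trans r.2.2

/-- The tensor product (horizontal composition) `f * g` of morphisms `f : X → Y` and
`g : X' → Y'`: the homomorphism that corresponds to the induction product of `f` and `g`
under the canonical isomorphisms `(M(X) ⊗ AH_a) ⊛ (M(X') ⊗ AH_b) = M(X X') ⊗ AH_{a+b}`. On the
generator it is the juxtaposition of `f (m_X ⊗ 1)` and `g (m_{X'} ⊗ 1)`. -/
noncomputable def hcomp {X Y X' Y' : ASchur k} (f : X ⟶ Y) (g : X' ⟶ Y') :
    X.concat X' ⟶ Y.concat Y' := fun r =>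
  if h : Y.parts.sum = X.parts.sum then
    have hX := deg_concat_left r
    have h' : Y'.parts.sum = X'.parts.sum := by
      have := deg_concat_right r
      omega
    IndMod.desc
      (IndMod.juxt hX h (f ⟨X.parts.sum, rfl, h⟩ (IndMod.gen k _ _))
        (g ⟨X'.parts.sum, rfl, h'⟩ (IndMod.gen k _ _)))
      (IndMod.juxt_inv hX rfl rfl h _ _ (IndMod.map_inv _) (IndMod.map_inv _))
  else 0

/-! ### The generating morphisms -/

/-- The two-fold merge `(a, b) → (c)` for `c = a + b` (the zero morphism if `c ≠ a + b`):
`m_{(a,b)} ⊗ 1 ↦ m_{(c)} ⊗ 1`. -/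
def merge (k : Type u) [CommRing k] (a b c : ℕ) : obj k [a, b] ⟶ obj k [c] := fun r =>
  IndMod.desc (IndMod.gen k r.1 [c]) (fun w _ => IndMod.gen_t (fun i => by
    have hc : c = r.1 := by simpa using r.2.2
    have h1 : ((w i : Fin r.1) : ℕ) < c := by omega
    have h2 : (i : ℕ) < c := by omega
    simp [blockIdx, h1, h2]))

/-- The vector `m_l ⊗ y`, which depends only on the right coset `S_l y`. -/
def cosetVec (k : Type u) [CommRing k] (r : ℕ) (l : List ℕ) :
    Quotient (QuotientGroup.rightRel (young r l)) → IndMod k r l :=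
  Quotient.lift (fun y => op (DAHA.t k y) • IndMod.gen k r l) (fun y z hyz => by
    have h := QuotientGroup.rightRel_apply.1 hyz
    have : z = z * y⁻¹ * y := by group
    change op (DAHA.t k y) • IndMod.gen k r l = op (DAHA.t k z) • IndMod.gen k r l
    rw [this, DAHA.t_mul, op_mul, mul_smul, IndMod.gen_t h])

/-- The action of `S_r` on the right cosets of `S_l` by right multiplication. -/
def cosetMul (r : ℕ) (l : List ℕ) (w : Equiv.Perm (Fin r)) :
    Quotient (QuotientGroup.rightRel (young r l)) ≃
      Quotient (QuotientGroup.rightRel (young r l)) :=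
  Quotient.congr (Equiv.mulRight w) (fun y z => by
    change QuotientGroup.rightRel _ y z ↔ QuotientGroup.rightRel _ (y * w) (z * w)
    rw [QuotientGroup.rightRel_apply, QuotientGroup.rightRel_apply]
    simp [mul_assoc])

/-- The sum of the vectors `m_l ⊗ y` over the right cosets `S_l y` in `S_r`; one may take the
minimal length coset representatives for the `y`. -/
noncomputable def cosetSum (k : Type u) [CommRing k] (r : ℕ) (l : List ℕ) : IndMod k r l :=
  ∑ᶠ q, cosetVec k r l q

theorem cosetSum_inv (r : ℕ) (l : List ℕ) (w : Equiv.Perm (Fin r)) :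
    op (DAHA.t k w) • cosetSum k r l = cosetSum k r l := by
  rw [cosetSum, smul_finsum' _ (Set.toFinite _),
    ← finsum_comp_equiv (cosetMul r l w) (f := cosetVec k r l)]
  refine finsum_congr fun q => ?_
  induction q using Quotient.inductionOn with
  | h y =>
    change op (DAHA.t k w) • op (DAHA.t k y) • IndMod.gen k r l =
      op (DAHA.t k (y * w)) • IndMod.gen k r l
    rw [DAHA.t_mul, op_mul, mul_smul]

/-- The two-fold split `(c) → (a, b)` for `c = a + b` (the zero morphism if `c ≠ a + b`):
`m_{(c)} ⊗ 1 ↦ ∑ m_{(a,b)} ⊗ y`, summed over the cosets `(S_a × S_b) y` in `S_{a+b}`. -/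
noncomputable def split (k : Type u) [CommRing k] (c a b : ℕ) : obj k [c] ⟶ obj k [a, b] :=
  fun r => IndMod.desc (cosetSum k r.1 [a, b]) (fun w _ => cosetSum_inv r.1 [a, b] w)

/-- The permutation `i ↦ i + b` for `i < a`, `a + j ↦ j` for `j < b` (counting from `0`). -/
def crossPerm (a b r : ℕ) (h : a + b = r) : Equiv.Perm (Fin r) where
  toFun i := if hi : (i : ℕ) < a then ⟨i + b, by omega⟩ else ⟨i - a, by omega⟩
  invFun i := if hi : (i : ℕ) < b then ⟨i + a, by omega⟩ else ⟨i - b, by omega⟩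
  left_inv i := by
    by_cases hi : (i : ℕ) < a
    · simp [hi]
    · ext
      have : (i : ℕ) - a < b := by omega
      simp [hi, this]
      omega
  right_inv i := by
    by_cases hi : (i : ℕ) < b
    · simp [hi]
    · ext
      have : (i : ℕ) - b < a := by omega
      simp [hi, this]
      omega

theorem crossPerm_block (a b r : ℕ) (h : a + b = r) (i : Fin r) :
    blockIdx [b, a] (crossPerm a b r h i) + blockIdx [a, b] i = 1 := by
  by_cases hi : (i : ℕ) < a
  · have : (i : ℕ) + b - b < a := by omega
    simp [crossPerm, blockIdx, hi]
  · have h1 : (i : ℕ) - a < b := by omega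
    simp [crossPerm, blockIdx, hi, h1]

theorem cross_inv (a b r : ℕ) (h : a + b = r) (w : Equiv.Perm (Fin r))
    (hw : w ∈ young r [a, b]) :
    op (DAHA.t k w) • op (DAHA.t k (crossPerm a b r h)) • IndMod.gen k r [b, a] =
      op (DAHA.t k (crossPerm a b r h)) • IndMod.gen k r [b, a] := by
  have hd : crossPerm a b r h * w * (crossPerm a b r h)⁻¹ ∈ young r [b, a] := by
    intro i
    obtain ⟨j, rfl⟩ := (crossPerm a b r h).surjective i
    have h1 := crossPerm_block a b r h j
    have h2 := crossPerm_block a b r h (w j)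
    have h3 : blockIdx [a, b] (w j) = blockIdx [a, b] j := hw j
    have h4 : (crossPerm a b r h * w * (crossPerm a b r h)⁻¹) (crossPerm a b r h j) =
      crossPerm a b r h (w j) := by simp
    rw [h4]
    omega
  rw [← mul_smul, ← op_mul, ← DAHA.t_mul,
    show crossPerm a b r h * w =
      crossPerm a b r h * w * (crossPerm a b r h)⁻¹ * crossPerm a b r h by group,
    DAHA.t_mul, op_mul, mul_smul, IndMod.gen_t hd]

/-- The thick crossing `(a, b) → (b, a)`: `m_{(a,b)} ⊗ 1 ↦ m_{(b,a)} ⊗ d`, where `d` is the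
permutation moving the first `a` positions past the last `b` ones. -/
def cross (k : Type u) [CommRing k] (a b : ℕ) : obj k [a, b] ⟶ obj k [b, a] := fun r =>
  have h : a + b = r.1 := by simpa using r.2.1
  IndMod.desc (op (DAHA.t k (crossPerm a b r.1 h)) • IndMod.gen k r.1 [b, a])
    (cross_inv a b r.1 h)

theorem pin_inv {r d : ℕ} (h : r = d) (f : MvPolynomial (Fin r) k) (hf : f.IsSymmetric)
    (w : Equiv.Perm (Fin d)) (hw : w ∈ young d [r]) :
    op (DAHA.t k w) • op (DAHA.poly k d (MvPolynomial.rename (finCongr h) f)) •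
        IndMod.gen k d [r] =
      op (DAHA.poly k d (MvPolynomial.rename (finCongr h) f)) • IndMod.gen k d [r] := by
  have hs : (MvPolynomial.rename (finCongr h) f).IsSymmetric := hf.rename (finCongr h)
  rw [← mul_smul, ← op_mul, ← DAHA.t_poly_symm hs, op_mul, mul_smul, IndMod.gen_t hw]

/-- The pin labelled by a symmetric polynomial `f` on a string of thickness `r`:
`m_{(r)} ⊗ 1 ↦ m_{(r)} ⊗ f`. -/
noncomputable def pin {r : ℕ} (f : MvPolynomial (Fin r) k) (hf : f.IsSymmetric) :
    obj k [r] ⟶ obj k [r] := fun d =>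
  have h : r = d.1 := by simpa using d.2.1
  IndMod.desc
    (op (DAHA.poly k d.1 (MvPolynomial.rename (finCongr h) f)) • IndMod.gen k d.1 [r])
    (pin_inv h f hf)

end ASchur

/-! ### Polynomials over a preadditive category -/

/-- The objects of the category `C[u]` for a preadditive category `C`: they are those of `C`. -/
structure PolyCat (C : Type*) where
  /-- The underlying object. -/
  of : C

namespace PolyCat

section

variable {C : Type*} [Category C] [Preadditive C]

/-- Morphisms of `C[u]` are polynomials in `u` with coefficients in the morphism groups of `C`:
the finitely supported function `f` stands for `∑ n, (f n) u ^ n`. -/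
abbrev HomType (X Y : PolyCat C) := ℕ →₀ (X.of ⟶ Y.of)

/-- Composition of polynomials, `(φ u ^ m) ≫ (ψ u ^ n) = (φ ≫ ψ) u ^ (m + n)`. -/
noncomputable def compHom {X Y Z : PolyCat C} (f : HomType X Y) (g : HomType Y Z) :
    HomType X Z :=
  f.sum fun m φ => g.sum fun n ψ => Finsupp.single (m + n) (φ ≫ ψ)

theorem compHom_single {X Y Z : PolyCat C} (m n : ℕ) (φ : X.of ⟶ Y.of) (ψ : Y.of ⟶ Z.of) :
    compHom (X := X) (Y := Y) (Z := Z) (Finsupp.single m φ) (Finsupp.single n ψ) =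
      Finsupp.single (m + n) (φ ≫ ψ) := by
  simp [compHom]

theorem add_compHom {X Y Z : PolyCat C} (f f' : HomType X Y) (g : HomType Y Z) :
    compHom (f + f') g = compHom f g + compHom f' g :=
  Finsupp.sum_add_index' (by simp) fun m φ φ' => by
    simp only [Preadditive.add_comp, Finsupp.single_add, Finsupp.sum_add]

theorem compHom_add {X Y Z : PolyCat C} (f : HomType X Y) (g g' : HomType Y Z) :
    compHom f (g + g') = compHom f g + compHom f g' := by
  simp only [compHom, ← Finsupp.sum_add]
  refine Finsupp.sum_congr fun m _ => Finsupp.sum_add_index' (by simp) fun n ψ ψ' => by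
    simp only [Preadditive.comp_add, Finsupp.single_add]

theorem zero_compHom {X Y Z : PolyCat C} (g : HomType Y Z) :
    compHom (0 : HomType X Y) g = 0 := Finsupp.sum_zero_index

theorem compHom_zero {X Y Z : PolyCat C} (f : HomType X Y) :
    compHom f (0 : HomType Y Z) = 0 := by simp [compHom]

theorem compHom_assoc {W X Y Z : PolyCat C} (f : HomType W X) (g : HomType X Y)
    (h : HomType Y Z) : compHom (compHom f g) h = compHom f (compHom g h) := by
  induction f using Finsupp.induction_linear with
  | zero => simp only [zero_compHom]
  | add f f' hf hf' => simp only [add_compHom, hf, hf']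
  | single l φ =>
    induction g using Finsupp.induction_linear with
    | zero => simp only [zero_compHom, compHom_zero]
    | add g g' hg hg' => simp only [add_compHom, compHom_add, hg, hg']
    | single m ψ =>
      induction h using Finsupp.induction_linear with
      | zero => simp only [compHom_zero]
      | add h h' hh hh' => simp only [compHom_add, hh, hh']
      | single n χ => simp only [compHom_single, Category.assoc, add_assoc]

theorem id_compHom {X Y : PolyCat C} (f : HomType X Y) :
    compHom (Finsupp.single 0 (𝟙 X.of)) f = f := by
  simp [compHom]

theorem compHom_id {X Y : PolyCat C} (f : HomType X Y) :
    compHom f (Finsupp.single 0 (𝟙 Y.of)) = f := by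
  simp [compHom]

noncomputable instance : Category (PolyCat C) where
  Hom X Y := HomType X Y
  id X := Finsupp.single 0 (𝟙 X.of)
  comp f g := compHom f g
  id_comp f := id_compHom f
  comp_id f := compHom_id f
  assoc f g h := compHom_assoc f g h

noncomputable instance instAddCommGroupHom (X Y : PolyCat C) : AddCommGroup (X ⟶ Y) :=
  inferInstanceAs (AddCommGroup (ℕ →₀ (X.of ⟶ Y.of)))

noncomputable instance {k : Type*} [CommRing k] [Linear k C] (X Y : PolyCat C) :
    Module k (X ⟶ Y) :=
  inferInstanceAs (Module k (ℕ →₀ (X.of ⟶ Y.of)))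

noncomputable instance : Preadditive (PolyCat C) where
  homGroup X Y := instAddCommGroupHom X Y
  add_comp _ _ _ f f' g := add_compHom f f' g
  comp_add _ _ _ f g g' := compHom_add f g g'

/-- The monomial `φ u ^ n`. -/
noncomputable def monomial {X Y : C} (n : ℕ) (φ : X ⟶ Y) :
    (⟨X⟩ : PolyCat C) ⟶ (⟨Y⟩ : PolyCat C) :=
  (Finsupp.single n φ : ℕ →₀ (X ⟶ Y))

/-- A morphism of `C` as a constant polynomial. -/
noncomputable def const {X Y : C} (φ : X ⟶ Y) : (⟨X⟩ : PolyCat C) ⟶ (⟨Y⟩ : PolyCat C) :=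
  monomial 0 φ

end

end PolyCat

namespace ASchur

variable {k : Type u} [CommRing k]

/-- The category `ASchur[u]`, which is the category `ASchur` with coefficients extended from `k`
to `k[u]`. -/
abbrev Poly (k : Type u) [CommRing k] : Type := PolyCat (ASchur k)

/-- A composition as an object of `ASchur[u]`. -/
abbrev objU (k : Type u) [CommRing k] (l : List ℕ) : Poly k := ⟨obj k l⟩

/-- The tensor product of morphisms of `ASchur[u]`: the extension of the one of `ASchur` with
`(φ u ^ m) * (ψ u ^ n) = (φ * ψ) u ^ (m + n)`. -/
noncomputable def hcompU {X Y X' Y' : Poly k} (f : X ⟶ Y) (g : X' ⟶ Y') :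
    (⟨X.of.concat X'.of⟩ : Poly k) ⟶ (⟨Y.of.concat Y'.of⟩ : Poly k) :=
  Finsupp.sum (f : ℕ →₀ (X.of ⟶ Y.of)) fun m φ =>
    Finsupp.sum (g : ℕ →₀ (X'.of ⟶ Y'.of)) fun n ψ => PolyCat.monomial (m + n) (hcomp φ ψ)

/-- The polynomial `(u - x_1)(u - x_2) ⋯ (u - x_r)` in `k[x_1, …, x_r][u]`. -/
noncomputable def charPoly (k : Type u) [CommRing k] (r : ℕ) :
    Polynomial (MvPolynomial (Fin r) k) :=
  ∏ i : Fin r, (Polynomial.X - Polynomial.C (MvPolynomial.X i))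

theorem charPoly_coeff_symm (r n : ℕ) : ((charPoly k r).coeff n).IsSymmetric := by
  intro e
  have h : (charPoly k r).map (MvPolynomial.rename e : _ →ₐ[k] _).toRingHom = charPoly k r := by
    rw [charPoly, Polynomial.map_prod]
    refine Eq.trans (Finset.prod_congr rfl fun i _ => ?_)
      (Equiv.prod_comp e fun i => Polynomial.X - Polynomial.C (MvPolynomial.X (R := k) i))
    simp
  conv_rhs => rw [← h]
  rw [Polynomial.coeff_map]
  rfl

/-- The pin labelled by `(u - x_1) ⋯ (u - x_r)` on a string of thickness `r`, as a morphism
of `ASchur[u]`: the sum over `n` of `u ^ n` times the pin labelled by the coefficient of `u ^ n`. -/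
noncomputable def pinU (k : Type u) [CommRing k] (r : ℕ) : objU k [r] ⟶ objU k [r] :=
  ∑ n ∈ Finset.range (r + 1),
    PolyCat.monomial n (pin ((charPoly k r).coeff n) (charPoly_coeff_symm r n))

/-- The crossing `(a, b) → (b, a)` in `ASchur[u]`. -/
noncomputable def crossU (k : Type u) [CommRing k] (a b : ℕ) :
    objU k [a, b] ⟶ objU k [b, a] :=
  PolyCat.const (cross k a b)

/-- The identity of a string of thickness `r`, in `ASchur[u]`. -/
noncomputable def strand (k : Type u) [CommRing k] (r : ℕ) : objU k [r] ⟶ objU k [r] :=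
  𝟙 (objU k [r])

/-- The strings of thickness `a` and `b` both split, into `s, a - s` and `b - s, s`. -/
noncomputable def splitLayer (k : Type u) [CommRing k] (a b s : ℕ) :
    objU k [a, b] ⟶ objU k [s, a - s, b - s, s] :=
  PolyCat.const (hcomp (split k a s (a - s)) (split k b (b - s) s))

/-- The two middle strings of thickness `a - s` and `b - s` cross. -/
noncomputable def crossLayer (k : Type u) [CommRing k] (a b s : ℕ) :
    objU k [s, a - s, b - s, s] ⟶ objU k [s, b - s, a - s, s] :=
  PolyCat.const (hcomp (𝟙 (obj k [s])) (hcomp (cross k (a - s) (b - s)) (𝟙 (obj k [s]))))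

/-- The strings of thickness `s, b - s` merge to one of thickness `b`, those of thickness
`a - s, s` to one of thickness `a`. -/
noncomputable def mergeLayer (k : Type u) [CommRing k] (a b s : ℕ) :
    objU k [s, b - s, a - s, s] ⟶ objU k [b, a] :=
  PolyCat.const (hcomp (merge k s (b - s) b) (merge k (a - s) s a))

/-- The pin with `(u - x_1) ⋯ (u - x_m)` on the second of four strings `s, m, n, s`. -/
noncomputable def pinSecond (k : Type u) [CommRing k] (s m n : ℕ) :
    objU k [s, m, n, s] ⟶ objU k [s, m, n, s] :=
  hcompU (strand k s) (hcompU (pinU k m) (hcompU (strand k n) (strand k s)))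

/-- The pin with `(u - x_1) ⋯ (u - x_n)` on the third of four strings `s, m, n, s`. -/
noncomputable def pinThird (k : Type u) [CommRing k] (s m n : ℕ) :
    objU k [s, m, n, s] ⟶ objU k [s, m, n, s] :=
  hcompU (strand k s) (hcompU (strand k m) (hcompU (pinU k n) (strand k s)))

end ASchur

end AffineSchur

open AffineSchur.ASchur (hcompU pinU strand crossU splitLayer crossLayer mergeLayer pinSecond
  pinThird)

/-!
A morphism of `ASchur[u]` between compositions of `r` is determined by its value `m ⊗ p` at the
generator, where `p` is a polynomial in `u` over the degenerate affine Hecke algebra `AH_r`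
(`Represents`, `evalCoeff_inj`). Vertical composition multiplies these polynomials, and horizontal
composition juxtaposes them. Each of the four equations becomes an identity, in a module where `m`
absorbs the permutations in `S_b × S_a`, between a product of factors `u - x_i` next to the crossing
permutation and a sum over `s`. The splits contribute a sum over coset representatives, that is,
over the `s`-element subsets `X` of the first `a` and `Z` of the last `b` strings
(`represents_splitLayer`).

The identity is proved in `AH_r[u]` for the elements `Y_i = u - x_i`, which satisfy the same
relations up to a sign that is recorded as the parameter `c` in `HeckeData`. Moving `Y_i` past a
permutation `w` leaves a correction term for each inversion of `w` at `i` (`HeckeData.t_mul_y`). For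
the product of the `Y_i` below the crossing on the first `a` strings, the factors are moved through
one by one. A string on its way either passes with its `Y_i`, or it loses `Y_i` and is exchanged
with one of the `b` strings. The corrections from strings that have been exchanged before are
swallowed when the remaining `Y_i` are shifted to adjacent positions (`HeckeData.Inv.slide`). As the
exchanged strings of the second kind can be chosen in any order, the result is the sum over pairs
`(X, Z)` with `s` elements each and weight `(-c) ^ s * s!` (`HeckeData.t_cross_mul_prodY`,
`HeckeData.prodY_below_left`).

When the same product stands above the crossing, the remaining factors on the right hand side stand
below the smaller crossings. Moving them up by the first equation gives a double sum, which
collapses since the weights `c ^ s * s!` and `(-c) ^ s * s!` are inverse to each other under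
disjoint unions of pairs of subsets (`sum_exchange_inversion`, `HeckeData.prodY_above_right`).
Reversing the order of the strings changes the sign of `c` and gives the other two equations
(`HeckeData.rev`).
-/

namespace AffineSchur

/-! ### Commuting permutations past polynomial generators -/

/-- A representation of the degenerate affine Hecke relations in a ring `A`, with deformation
parameter `c`. The commuting elements are the images of elements `Y i` of a commutative ring `R`,
so that products over finite sets make sense. -/
structure HeckeData (R A : Type*) [CommRing R] [Ring A] (r : ℕ) where
  /-- The images of the permutations. -/
  t : Equiv.Perm (Fin r) →* A
  /-- The homomorphism from the commutative ring that contains the polynomial generators. -/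
  e : R →+* A
  /-- The polynomial generators. -/
  Y : Fin r → R
  /-- The deformation parameter. -/
  c : ℤ
  adj_y : ∀ (i : ℕ) (h : i + 1 < r), t (adj r i h) * e (Y ⟨i, Nat.lt_of_succ_lt h⟩) =
    e (Y ⟨i + 1, h⟩) * t (adj r i h) - (c : A)
  far : ∀ (i : ℕ) (h : i + 1 < r) (j : Fin r), (j : ℕ) ≠ i → (j : ℕ) ≠ i + 1 →
    t (adj r i h) * e (Y j) = e (Y j) * t (adj r i h)

theorem adj_mul_self (r i : ℕ) (h : i + 1 < r) : adj r i h * adj r i h = 1 :=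
  Equiv.swap_mul_self _ _

/-- The integer `[i < j] - [w i < w j]`: `1` or `-1` on the inversions of `w`, and `0` on other
pairs. -/
def invSign {r : ℕ} (w : Equiv.Perm (Fin r)) (i j : Fin r) : ℤ :=
  (if i < j then 1 else 0) - if w i < w j then 1 else 0

theorem invSign_mul {r : ℕ} (v w : Equiv.Perm (Fin r)) (i j : Fin r) :
    invSign (v * w) i j = invSign w i j + invSign v (w i) (w j) :=
  (sub_add_sub_cancel _ _ _).symm

theorem invSign_one {r : ℕ} (i j : Fin r) : invSign 1 i j = 0 := sub_self _

/-- The set of positions `i` with `p ≤ i < q`. -/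
def Iv {r : ℕ} (p q : ℕ) : Finset (Fin r) := Finset.univ.filter fun i => p ≤ (i : ℕ) ∧ (i : ℕ) < q

theorem mem_Iv {r p q : ℕ} {i : Fin r} : i ∈ Iv p q ↔ p ≤ (i : ℕ) ∧ (i : ℕ) < q := by
  simp [Iv]

namespace HeckeData

variable {R A : Type*} [CommRing R] [Ring A] {r : ℕ} (D : HeckeData R A r)

/-- The product of the polynomial generators over a set of positions. -/
def prodY (S : Finset (Fin r)) : A := D.e (∏ i ∈ S, D.Y i)

/-- The relation that is mirror to `adj_y`; it follows from it by conjugation with `s_i`. -/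
theorem y_adj (i : ℕ) (h : i + 1 < r) :
    D.t (adj r i h) * D.e (D.Y ⟨i + 1, h⟩) =
      D.e (D.Y ⟨i, Nat.lt_of_succ_lt h⟩) * D.t (adj r i h) + (D.c : A) := by
  have h1 : D.t (adj r i h) * D.t (adj r i h) = 1 := by
    rw [← map_mul, adj_mul_self, map_one]
  have h2 := congrArg (fun z => D.t (adj r i h) * z * D.t (adj r i h)) (D.adj_y i h)
  simp only [mul_sub, sub_mul] at h2
  have h3 : D.t (adj r i h) * (D.t (adj r i h) * D.e (D.Y ⟨i, Nat.lt_of_succ_lt h⟩)) *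
      D.t (adj r i h) = D.e (D.Y ⟨i, Nat.lt_of_succ_lt h⟩) * D.t (adj r i h) := by
    rw [← mul_assoc, h1, one_mul]
  have h4 : D.t (adj r i h) * (D.e (D.Y ⟨i + 1, h⟩) * D.t (adj r i h)) * D.t (adj r i h) =
      D.t (adj r i h) * D.e (D.Y ⟨i + 1, h⟩) := by
    rw [mul_assoc, mul_assoc, h1, mul_one]
  have h5 : D.t (adj r i h) * (D.c : A) * D.t (adj r i h) = (D.c : A) := by
    rw [← Int.cast_comm, mul_assoc, h1, mul_one]
  rw [h3, h4, h5] at h2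
  rw [h2, sub_add_cancel]

/-- The commutation of a permutation past a polynomial generator: the correction terms run
over the inversions of the permutation. -/
theorem t_mul_y (w : Equiv.Perm (Fin r)) (i : Fin r) :
    D.t w * D.e (D.Y i) = D.e (D.Y (w i)) * D.t w -
      ∑ j, (D.c * invSign w i j) • D.t (w * Equiv.swap i j) := by
  induction w using DAHA.perm_induction generalizing i with
  | h1 =>
    simp [invSign_one]
  | hmul v w hv hw =>
    have h1 : D.t v * D.e (D.Y (w i)) * D.t w = D.e (D.Y (v (w i))) * D.t v * D.t w -
        ∑ j, (D.c * invSign v (w i) (w j)) • D.t (v * w * Equiv.swap i j) := by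
      rw [hv, sub_mul, Finset.sum_mul]
      congr 1
      rw [← Equiv.sum_comp w]
      refine Finset.sum_congr rfl fun j _ => ?_
      rw [smul_mul_assoc, ← map_mul, mul_assoc v w, mul_assoc v, Equiv.swap_apply_apply,
        inv_mul_cancel_right]
    rw [map_mul, mul_assoc, hw, mul_sub, ← mul_assoc, h1, mul_assoc, Finset.mul_sum, sub_sub,
      ← Finset.sum_add_distrib]
    congr 1
    refine Finset.sum_congr rfl fun j _ => ?_
    rw [invSign_mul, mul_smul_comm, ← map_mul, mul_assoc v w, ← add_smul]
    congr 1
    ring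
  | hs s h =>
    have hz : ∀ j j' : Fin r, j' ≠ j →
        (∀ l, l ≠ j' → invSign (adj r s h) j l = 0) →
        ∑ l, (D.c * invSign (adj r s h) j l) • D.t (adj r s h * Equiv.swap j l) =
          (D.c * invSign (adj r s h) j j') • D.t (adj r s h * Equiv.swap j j') := by
      intro j j' _ hl
      refine Finset.sum_eq_single j' (fun l _ hlj => ?_) (by simp)
      rw [hl l hlj, mul_zero, zero_smul]
    by_cases h1 : (i : ℕ) = s
    · obtain rfl : i = ⟨s, Nat.lt_of_succ_lt h⟩ := Fin.ext h1
      have e : adj r s h ⟨s, Nat.lt_of_succ_lt h⟩ = ⟨s + 1, h⟩ := Equiv.swap_apply_left _ _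
      rw [hz _ ⟨s + 1, h⟩ (by simp) ?_, e, D.adj_y]
      · have e2 : adj r s h ⟨s + 1, h⟩ = ⟨s, Nat.lt_of_succ_lt h⟩ := Equiv.swap_apply_right _ _
        have e3 : adj r s h * Equiv.swap ⟨s, Nat.lt_of_succ_lt h⟩ ⟨s + 1, h⟩ = 1 :=
          adj_mul_self r s h
        rw [e3]
        simp [invSign, e, e2, Fin.lt_def]
      · intro l hl
        simp only [ne_eq, Fin.ext_iff] at hl
        simp only [invSign, adj, Equiv.swap_apply_def, Fin.ext_iff, Fin.lt_def]
        split_ifs <;> simp_all <;> omega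
    · by_cases h2 : (i : ℕ) = s + 1
      · obtain rfl : i = ⟨s + 1, h⟩ := Fin.ext h2
        have e : adj r s h ⟨s, Nat.lt_of_succ_lt h⟩ = ⟨s + 1, h⟩ := Equiv.swap_apply_left _ _
        have e2 : adj r s h ⟨s + 1, h⟩ = ⟨s, Nat.lt_of_succ_lt h⟩ := Equiv.swap_apply_right _ _
        rw [hz _ ⟨s, Nat.lt_of_succ_lt h⟩ (by simp) ?_, e2, D.y_adj]
        · have e3 : adj r s h * Equiv.swap ⟨s + 1, h⟩ ⟨s, Nat.lt_of_succ_lt h⟩ = 1 := by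
            rw [Equiv.swap_comm]
            exact adj_mul_self r s h
          rw [e3]
          simp [invSign, e, e2, Fin.lt_def]
        · intro l hl
          simp only [ne_eq, Fin.ext_iff] at hl
          simp only [invSign, adj, Equiv.swap_apply_def, Fin.ext_iff, Fin.lt_def]
          split_ifs <;> simp_all <;> omega
      · have e : adj r s h i = i :=
          Equiv.swap_apply_of_ne_of_ne (by simpa [Fin.ext_iff] using h1)
            (by simpa [Fin.ext_iff] using h2)
        rw [Finset.sum_eq_zero, sub_zero, e, D.far s h i h1 h2]
        intro l _
        have : invSign (adj r s h) i l = 0 := by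
          simp only [invSign, adj, Equiv.swap_apply_def, Fin.ext_iff, Fin.lt_def]
          split_ifs <;> simp_all <;> omega
        rw [this, mul_zero, zero_smul]

/-- A product of generators over a set that contains both or neither of the positions `i` and `i +
1` is symmetric in them, hence commutes with `s_i`. -/
theorem adj_prodY {S : Finset (Fin r)} (i : ℕ) (h : i + 1 < r)
    (hS : (⟨i, Nat.lt_of_succ_lt h⟩ : Fin r) ∈ S ↔ (⟨i + 1, h⟩ : Fin r) ∈ S) :
    Commute (D.t (adj r i h)) (D.prodY S) := by
  set a : Fin r := ⟨i, Nat.lt_of_succ_lt h⟩ with ha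
  set b : Fin r := ⟨i + 1, h⟩ with hb
  have hab : a ≠ b := by simp [ha, hb]
  have far : ∀ T : Finset (Fin r), a ∉ T → b ∉ T → Commute (D.t (adj r i h)) (D.prodY T) := by
    intro T haT hbT
    induction T using Finset.induction with
    | empty => simp [prodY, Commute.one_right]
    | insert j T hj ih =>
      rw [Finset.mem_insert, not_or] at haT hbT
      rw [prodY, Finset.prod_insert hj, map_mul]
      refine Commute.mul_right (D.far i h j ?_ ?_) (ih haT.2 hbT.2)
      · exact fun hc => haT.1 (Fin.ext hc.symm)
      · exact fun hc => hbT.1 (Fin.ext hc.symm)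
  by_cases haS : a ∈ S
  · have hbS := hS.1 haS
    have hab' : b ∈ S.erase a := Finset.mem_erase.2 ⟨hab.symm, hbS⟩
    rw [prodY, ← Finset.mul_prod_erase S D.Y haS, ← Finset.mul_prod_erase _ D.Y hab', ← mul_assoc,
      map_mul]
    refine Commute.mul_right ?_ (far _ (by simp) (by simp))
    have h1 := D.adj_y i h
    have h2 := D.y_adj i h
    have h3 : D.e (D.Y b) * D.e (D.Y a) = D.e (D.Y a) * D.e (D.Y b) := by
      rw [← map_mul, mul_comm, map_mul]
    rw [map_mul, Commute, SemiconjBy, ← mul_assoc, h1, sub_mul, mul_assoc, h2, mul_add,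
      ← mul_assoc, h3, Int.cast_comm, add_sub_cancel_right]
  · exact far S haS (fun hc => haS (hS.2 hc))

theorem shiftPerm_prodY {S : Finset (Fin r)} (p m : ℕ) (h : p + m ≤ r)
    (hS : ∀ i j : Fin r, p ≤ (i : ℕ) → (i : ℕ) < p + m → p ≤ (j : ℕ) → (j : ℕ) < p + m →
      i ∈ S → j ∈ S) (v : Equiv.Perm (Fin m)) :
    Commute (D.t (DAHA.shiftPerm p m r h v)) (D.prodY S) := by
  induction v using DAHA.perm_induction with
  | h1 => simp [Commute.one_left]
  | hmul v w hv hw => rw [map_mul, map_mul]; exact hv.mul_left hw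
  | hs i hi =>
    rw [DAHA.shiftPerm_adj]
    refine D.adj_prodY _ _ ⟨hS _ _ ?_ ?_ ?_ ?_, hS _ _ ?_ ?_ ?_ ?_⟩ <;> simp only <;> omega

/-- The product of the polynomial generators over an interval commutes with the permutations that
preserve the interval as well as the positions to its left and right. -/
theorem commute_prodY_Iv (p q : ℕ) (hpq : p ≤ q) (hq : q ≤ r) (g : Equiv.Perm (Fin r))
    (h1 : ∀ i : Fin r, (i : ℕ) < p → (g i : ℕ) < p)
    (h2 : ∀ i : Fin r, p ≤ (i : ℕ) → (i : ℕ) < q → p ≤ (g i : ℕ) ∧ (g i : ℕ) < q)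
    (h3 : ∀ i : Fin r, q ≤ (i : ℕ) → q ≤ (g i : ℕ)) :
    Commute (D.t g) (D.prodY (Iv p q)) := by
  have hg : g ∈ young r ([p, q - p] ++ [r - q]) := by
    intro i
    have := h1 i
    have := h2 i
    have := h3 i
    simp only [List.cons_append, List.nil_append, blockIdx]
    split_ifs <;> omega
  obtain ⟨g₁, hg₁, g₂, -, rfl⟩ := young_append (a := q) (b := r - q) (by omega) (by simp; omega)
    (by simp) hg
  obtain ⟨g₃, -, g₄, -, rfl⟩ := young_append (a := p) (b := q - p) (l := [p]) (l' := [q - p])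
    (by omega) (by simp) (by simp) hg₁
  have hs : ∀ (m n : ℕ) (h : m + n ≤ q) (v : Equiv.Perm (Fin n)),
      DAHA.shiftPerm 0 q r (by omega) (DAHA.shiftPerm m n q h v) =
        DAHA.shiftPerm m n r (by omega) v := by
    intro m n h v
    induction v using DAHA.perm_induction with
    | h1 => simp
    | hmul v w hv hw => simp only [map_mul, hv, hw]
    | hs i hi => simp only [DAHA.shiftPerm_adj, zero_add]
  rw [map_mul (DAHA.shiftPerm 0 q r _), hs, hs, map_mul, map_mul]
  refine ((D.shiftPerm_prodY _ _ _ ?_ _).mul_left (D.shiftPerm_prodY _ _ _ ?_ _)).mul_left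
    (D.shiftPerm_prodY _ _ _ ?_ _) <;> intro i j <;> simp only [mem_Iv] <;> omega

end HeckeData

/-! ### Moving a product of generators through a crossing -/

theorem card_Iv {r p q : ℕ} (h : q ≤ r) : (Iv p q : Finset (Fin r)).card = q - p := by
  rw [← Nat.card_Ico, ← Finset.card_map Fin.valEmbedding]
  congr 1
  ext i
  simp only [Finset.mem_map, mem_Iv, Finset.mem_Ico, Fin.valEmbedding_apply]
  exact ⟨fun ⟨j, hj, e⟩ => e ▸ hj, fun hi => ⟨⟨i, by omega⟩, hi, rfl⟩⟩

theorem Iv_succ {r p q : ℕ} (hpq : p ≤ q) (h : q < r) :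
    (Iv p (q + 1) : Finset (Fin r)) = insert ⟨q, h⟩ (Iv p q) := by
  ext i
  simp only [Finset.mem_insert, mem_Iv, Fin.ext_iff]
  omega

theorem Iv_self {r : ℕ} (p : ℕ) : (Iv p p : Finset (Fin r)) = ∅ := by
  ext i
  simp [mem_Iv]

/-- A permutation that preserves the intervals `[o, o+b)` and `[o+b, o+b+a)` and fixes all positions
outside of them. -/
def PresBlocks {r : ℕ} (o b a : ℕ) (g : Equiv.Perm (Fin r)) : Prop :=
  ∀ i : Fin r, ((i : ℕ) < o → (g i : ℕ) = i) ∧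
    (o ≤ (i : ℕ) → (i : ℕ) < o + b → o ≤ (g i : ℕ) ∧ (g i : ℕ) < o + b) ∧
    (o + b ≤ (i : ℕ) → (i : ℕ) < o + b + a → o + b ≤ (g i : ℕ) ∧ (g i : ℕ) < o + b + a) ∧
    (o + b + a ≤ (i : ℕ) → (g i : ℕ) = i)

/-- A permutation of the shape that occurs after `p` of the `a` strings in the positions
`[o, o+a)` have been moved past the `b` strings in the positions `[o+a, o+a+b)`. The strings in `X`
and `Z` have been exchanged, where `X` is a set of `s` of the first `p` strings of the first kind
and `Z` a set of `s` strings of the second kind. -/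
structure Exchange {r : ℕ} (o a b p s : ℕ) (X Z : Finset (Fin r)) (w : Equiv.Perm (Fin r)) :
    Prop where
  below : ∀ i : Fin r, (i : ℕ) < o → (w i : ℕ) = i
  above : ∀ i : Fin r, o + a + b ≤ (i : ℕ) → (w i : ℕ) = i
  mem_left : ∀ i ∈ X, o ≤ (w i : ℕ) ∧ (w i : ℕ) < o + b
  notMem_left : ∀ i : Fin r, o ≤ (i : ℕ) → (i : ℕ) < o + p → i ∉ X →
    o + b ≤ (w i : ℕ) ∧ (w i : ℕ) + s < o + b + p
  rest : ∀ i : Fin r, o + p ≤ (i : ℕ) → (i : ℕ) < o + a → (w i : ℕ) = i + b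
  mem_right : ∀ i ∈ Z, o + b + p ≤ (w i : ℕ) + s ∧ (w i : ℕ) < o + b + p
  notMem_right : ∀ i : Fin r, o + a ≤ (i : ℕ) → (i : ℕ) < o + a + b → i ∉ Z →
    o ≤ (w i : ℕ) ∧ (w i : ℕ) < o + b

theorem swap_apply_val {r : ℕ} (x y z : Fin r) : (Equiv.swap x y z : ℕ) =
    if (z : ℕ) = x then (y : ℕ) else if (z : ℕ) = y then (x : ℕ) else z := by
  simp only [Equiv.swap_apply_def, Fin.ext_iff]
  split_ifs <;> rfl

/-- The next string `x` of the first kind is exchanged with the string `j` of the second kind. -/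
theorem Exchange.insert {r o a b p s : ℕ} {X Z : Finset (Fin r)} {w : Equiv.Perm (Fin r)}
    (hw : Exchange o a b p s X Z w) (hp : p < a) (hX : X ⊆ Iv o (o + p))
    (hZ : Z ⊆ Iv (o + a) (o + a + b)) {x : Fin r} (hx : (x : ℕ) = o + p) {j : Fin r}
    (hj : j ∈ Iv (o + a) (o + a + b) \ Z) :
    Exchange o a b (p + 1) (s + 1) (insert x X) (insert j Z) (w * Equiv.swap x j) := by
  rw [Finset.mem_sdiff, mem_Iv] at hj
  have hxj : x ≠ j := fun h => by rw [← h] at hj; omega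
  have hout : ∀ i, i ≠ x → i ≠ j → (w * Equiv.swap x j) i = w i := fun i h1 h2 => by
    rw [Equiv.Perm.mul_apply, Equiv.swap_apply_of_ne_of_ne h1 h2]
  have hwx : (w * Equiv.swap x j) x = w j := by simp
  have hwj : (w * Equiv.swap x j) j = w x := by simp
  have h1 := hw.rest x (by omega) (by omega)
  have h2 := hw.notMem_right j hj.1.1 hj.1.2 hj.2
  refine ⟨fun i hi => ?_, fun i hi => ?_, fun i hi => ?_, fun i hi hi' hiX => ?_,
    fun i hi hi' => ?_, fun i hi => ?_, fun i hi hi' hiZ => ?_⟩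
  · rw [hout i (by rintro rfl; omega) (by rintro rfl; omega), hw.below i hi]
  · rw [hout i (by rintro rfl; omega) (by rintro rfl; omega), hw.above i hi]
  · rcases Finset.mem_insert.1 hi with rfl | hi
    · rw [hwx]; exact h2
    · have := mem_Iv.1 (hX hi)
      rw [hout i (by rintro rfl; omega) (by rintro rfl; omega)]
      exact hw.mem_left i hi
  · rw [Finset.mem_insert, not_or, Fin.ext_iff] at hiX
    have := hw.notMem_left i hi (by omega) hiX.2
    rw [hout i (by rintro rfl; omega) (by rintro rfl; omega)]
    omega
  · rw [hout i (by rintro rfl; omega) (by rintro rfl; omega), hw.rest i (by omega) hi']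
  · rcases Finset.mem_insert.1 hi with rfl | hi
    · rw [hwj]; omega
    · have h3 := mem_Iv.1 (hZ hi)
      have := hw.mem_right i hi
      rw [hout i (by rintro rfl; omega) (fun h => hj.2 (h ▸ hi))]
      omega
  · rw [Finset.mem_insert, not_or] at hiZ
    rw [hout i (by rintro rfl; omega) hiZ.1]
    exact hw.notMem_right i hi hi' hiZ.2

/-- The next string of the first kind stays out of the exchange: it moves to the left of the
`s` strings of the second kind that have been exchanged already. -/
theorem Exchange.skip {r o a b p s : ℕ} {X Z : Finset (Fin r)} {w : Equiv.Perm (Fin r)}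
    (hw : Exchange o a b p s X Z w) (hs : s ≤ p) {x y : Fin r}
    (hx : (x : ℕ) = o + b + p - s) (hy : (y : ℕ) = o + b + p) (hp : p < a) :
    Exchange o a b (p + 1) s X Z (Equiv.swap x y * w) := by
  refine ⟨fun i hi => ?_, fun i hi => ?_, fun i hi => ?_, fun i hi hi' hiX => ?_,
    fun i hi hi' => ?_, fun i hi => ?_, fun i hi hi' hiZ => ?_⟩ <;>
    rw [Equiv.Perm.mul_apply, swap_apply_val, hx, hy]
  · have := hw.below i hi
    split_ifs <;> omega
  · have := hw.above i hi
    split_ifs <;> omega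
  · have := hw.mem_left i hi
    split_ifs <;> omega
  · by_cases h : (i : ℕ) < o + p
    · have := hw.notMem_left i hi h hiX
      split_ifs <;> omega
    · have := hw.rest i (by omega) (by omega)
      split_ifs <;> omega
  · have := hw.rest i (by omega) hi'
    split_ifs <;> omega
  · have := hw.mem_right i hi
    split_ifs <;> omega
  · have := hw.notMem_right i hi hi' hiZ
    split_ifs <;> omega

section combinatorics

variable {ι V : Type*} [DecidableEq ι] [AddCommGroup V]

/-- Each `(n+1)`-element subset arises in `n+1` ways by adding a point to an `n`-element subset. -/
theorem sum_powersetCard_insert (T : Finset ι) (n : ℕ) (f : Finset ι → V) :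
    ∑ Z ∈ T.powersetCard n, ∑ j ∈ T \ Z, f (insert j Z) =
      (n + 1) • ∑ Z ∈ T.powersetCard (n + 1), f Z := by
  have h : (n + 1) • ∑ Z ∈ T.powersetCard (n + 1), f Z =
      ∑ Z ∈ T.powersetCard (n + 1), ∑ _j ∈ Z, f Z := by
    rw [Finset.smul_sum]
    refine Finset.sum_congr rfl fun Z hZ => ?_
    rw [Finset.sum_const, (Finset.mem_powersetCard.1 hZ).2]
  rw [h, Finset.sum_sigma', Finset.sum_sigma']
  refine Finset.sum_bij' (fun q _ => ⟨insert q.2 q.1, q.2⟩) (fun q _ => ⟨q.1.erase q.2, q.2⟩)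
    ?_ ?_ ?_ ?_ ?_
  · rintro ⟨Z, j⟩ hq
    simp only [Finset.mem_sigma, Finset.mem_powersetCard, Finset.mem_sdiff] at hq ⊢
    exact ⟨⟨Finset.insert_subset hq.2.1 hq.1.1,
        by rw [Finset.card_insert_of_notMem hq.2.2, hq.1.2]⟩,
      Finset.mem_insert_self _ _⟩
  · rintro ⟨Z, j⟩ hq
    simp only [Finset.mem_sigma, Finset.mem_powersetCard, Finset.mem_sdiff] at hq ⊢
    exact ⟨⟨(Finset.erase_subset _ _).trans hq.1.1, by
      rw [Finset.card_erase_of_mem hq.2, hq.1.2, Nat.add_sub_cancel]⟩,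
      hq.1.1 hq.2, Finset.notMem_erase _ _⟩
  · rintro ⟨Z, j⟩ hq
    simp only [Finset.mem_sigma, Finset.mem_powersetCard, Finset.mem_sdiff] at hq
    simp [Finset.erase_insert hq.2.2]
  · rintro ⟨Z, j⟩ hq
    simp only [Finset.mem_sigma, Finset.mem_powersetCard] at hq
    simp [Finset.insert_erase hq.2]
  · rintro ⟨Z, j⟩ _
    rfl

/-- The combinatorial step in the summation over pairs of equinumerous subsets: an additional
point `x` on the left stays out of the exchange or is exchanged with a point on the right. -/
theorem sum_exchange_insert {S T : Finset ι} {x : ι} (hx : x ∉ S) (c : ℤ)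
    (f : Finset ι → Finset ι → V) :
    ∑ X ∈ (insert x S).powerset, ∑ Z ∈ T.powersetCard X.card,
        (c ^ X.card * (X.card.factorial : ℤ)) • f X Z =
      ∑ X ∈ S.powerset, ∑ Z ∈ T.powersetCard X.card, (c ^ X.card * (X.card.factorial : ℤ)) •
        (f X Z + c • ∑ j ∈ T \ Z, f (insert x X) (insert j Z)) := by
  rw [Finset.sum_powerset_insert hx, ← Finset.sum_add_distrib]
  refine Finset.sum_congr rfl fun X hX => ?_
  have hxX : x ∉ X := fun h => hx (Finset.mem_powerset.1 hX h)
  simp only [smul_add, Finset.sum_add_distrib]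
  congr 1
  rw [Finset.card_insert_of_notMem hxX, ← Finset.smul_sum, ← Finset.smul_sum, ← Finset.smul_sum,
    sum_powersetCard_insert T X.card fun Z => f (insert x X) Z, ← natCast_zsmul, smul_smul,
    smul_smul]
  congr 1
  rw [Nat.factorial_succ]
  push_cast
  ring

end combinatorics

namespace HeckeData

variable {R A V : Type*} [CommRing R] [Ring A] [AddCommGroup V] {r : ℕ} (D : HeckeData R A r)

theorem e_mul_prodY {S : Finset (Fin r)} {i : Fin r} (hi : i ∉ S) :
    D.e (D.Y i) * D.prodY S = D.prodY (insert i S) := by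
  rw [prodY, prodY, Finset.prod_insert hi, map_mul]

theorem prodY_mul_e {S : Finset (Fin r)} {i : Fin r} (hi : i ∉ S) :
    D.prodY S * D.e (D.Y i) = D.prodY (insert i S) := by
  rw [prodY, prodY, Finset.prod_insert hi, mul_comm, map_mul]

theorem prodY_empty : D.prodY ∅ = 1 := by simp [prodY]

/-- The functional `φ` on `A` is invariant under left multiplication by the permutations of the
blocks `[o, o+b)` and `[o+b, o+b+a)`. -/
def Inv (o b a : ℕ) (φ : A →+ V) : Prop :=
  ∀ (g : Equiv.Perm (Fin r)) (x : A), PresBlocks o b a g → φ (D.t g * x) = φ x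

variable {D} {o a b : ℕ} {φ : A →+ V}

/-- An invariant functional, after multiplication with the product of the generators over the
interval `[o+b, q)`, is still invariant under the permutations that preserve `[o+b, q)` as well. -/
theorem Inv.absorb (hφ : D.Inv o b a φ) {p q : ℕ} (hr : o + b + a ≤ r) (h1 : o + b ≤ q)
    (h2 : q ≤ p) (h3 : p ≤ o + b + a) (g : Equiv.Perm (Fin r))
    (hg : ∀ i : Fin r, ((i : ℕ) < o → (g i : ℕ) = i) ∧
      (o ≤ (i : ℕ) → (i : ℕ) < o + b → o ≤ (g i : ℕ) ∧ (g i : ℕ) < o + b) ∧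
      (o + b ≤ (i : ℕ) → (i : ℕ) < q → o + b ≤ (g i : ℕ) ∧ (g i : ℕ) < q) ∧
      (q ≤ (i : ℕ) → (i : ℕ) < p → q ≤ (g i : ℕ) ∧ (g i : ℕ) < p) ∧
      (p ≤ (i : ℕ) → (g i : ℕ) = i)) (x : A) :
    φ (D.prodY (Iv (o + b) q) * (D.t g * x)) = φ (D.prodY (Iv (o + b) q) * x) := by
  have hc : Commute (D.t g) (D.prodY (Iv (o + b) q)) := by
    refine D.commute_prodY_Iv (o + b) q h1 (by omega) g ?_ ?_ ?_ <;> intro i <;>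
      have := hg i <;> omega
  rw [← mul_assoc, ← hc.eq, mul_assoc]
  refine hφ g _ fun i => ?_
  have := hg i
  omega

/-- The form of `Inv.absorb` for two permutations `w` and `w'` that send every string to the same
block. -/
theorem Inv.absorb_of_blocks (hφ : D.Inv o b a φ) {p q : ℕ} (hr : o + b + a ≤ r) (h1 : o + b ≤ q)
    (h2 : q ≤ p) (h3 : p ≤ o + b + a) (w w' : Equiv.Perm (Fin r))
    (hg : ∀ i : Fin r, ((w i : ℕ) < o → (w' i : ℕ) = w i) ∧
      (o ≤ (w i : ℕ) → (w i : ℕ) < o + b → o ≤ (w' i : ℕ) ∧ (w' i : ℕ) < o + b) ∧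
      (o + b ≤ (w i : ℕ) → (w i : ℕ) < q → o + b ≤ (w' i : ℕ) ∧ (w' i : ℕ) < q) ∧
      (q ≤ (w i : ℕ) → (w i : ℕ) < p → q ≤ (w' i : ℕ) ∧ (w' i : ℕ) < p) ∧
      (p ≤ (w i : ℕ) → (w' i : ℕ) = w i)) (x : A) :
    φ (D.prodY (Iv (o + b) q) * (D.t w' * x)) = φ (D.prodY (Iv (o + b) q) * (D.t w * x)) := by
  rw [← hφ.absorb hr h1 h2 h3 (w' * w⁻¹) (fun i => ?_) (D.t w * x), ← mul_assoc (D.t _), ← map_mul,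
    inv_mul_cancel_right]
  obtain ⟨j, rfl⟩ := w.surjective i
  have e : (w' * w⁻¹) (w j) = w' j := by simp
  rw [e]
  exact hg j

/-- In an exchange, the string in position `x` that is next to be moved has inversions exactly with
the strings of the second kind. -/
theorem invSign_exchange {p s : ℕ} {X Z : Finset (Fin r)} {w : Equiv.Perm (Fin r)}
    (hw : Exchange o a b p s X Z w) (hp : p < a) {x : Fin r} (hx : (x : ℕ) = o + p)
    (j : Fin r) : invSign w x j = if j ∈ Iv (o + a) (o + a + b) then 1 else 0 := by
  have h0 := hw.rest x (by omega) (by omega)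
  have h1 := hw.below j
  have h2 := hw.above j
  have h3 := hw.mem_left j
  have h4 := hw.notMem_left j
  have h5 := hw.rest j
  have h6 := hw.mem_right j
  have h7 := hw.notMem_right j
  simp only [invSign, Fin.lt_def, mem_Iv]
  by_cases hjX : j ∈ X <;> by_cases hjZ : j ∈ Z <;> simp only [hjX, hjZ, forall_const,
    not_true, not_false_eq_true, false_imp_iff, implies_true] at h3 h4 h6 h7 <;>
    split_ifs <;> first | rfl | omega

/-- Absorbing the cyclic permutations of `[q, q+s]` shows how the last factor of a product of
generators moves down by `s` positions. -/
theorem Inv.slide (hφ : D.Inv o b a φ) (hr : o + b + a ≤ r) {q s : ℕ} (h1 : o + b ≤ q)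
    (h2 : q + s < o + b + a) {x y : Fin r} (hx : (x : ℕ) = q) (hy : (y : ℕ) = q + s) (z : A) :
    φ (D.prodY (Iv (o + b) (q + 1)) * (D.t (Equiv.swap x y) * z)) =
      φ (D.prodY (Iv (o + b) q) * (D.e (D.Y y) * z)) -
        (D.c * s) • φ (D.prodY (Iv (o + b) q) * z) := by
  have hiv : (Iv (o + b) (q + 1) : Finset (Fin r)) = insert x (Iv (o + b) q) := by
    rw [Iv_succ h1 (by omega)]
    congr 1
    exact Fin.ext hx.symm
  have hxI : x ∉ (Iv (o + b) q : Finset (Fin r)) := by rw [mem_Iv]; omega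
  have hinv : ∀ j, invSign (Equiv.swap x y) y j = if j ∈ Iv q (q + s) then -1 else 0 := by
    intro j
    simp only [invSign, Fin.lt_def, mem_Iv, swap_apply_val]
    split_ifs <;> first | rfl | omega
  have hcl := D.t_mul_y (Equiv.swap x y) y
  rw [Equiv.swap_apply_right] at hcl
  have habs : ∀ g : Equiv.Perm (Fin r), (∀ i : Fin r, ((i : ℕ) < q → (g i : ℕ) = i) ∧
      (q ≤ (i : ℕ) → (i : ℕ) < q + s + 1 → q ≤ (g i : ℕ) ∧ (g i : ℕ) < q + s + 1) ∧
      (q + s + 1 ≤ (i : ℕ) → (g i : ℕ) = i)) → ∀ z,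
      φ (D.prodY (Iv (o + b) q) * (D.t g * z)) = φ (D.prodY (Iv (o + b) q) * z) := by
    intro g hg z
    refine hφ.absorb hr h1 (p := q + s + 1) (by omega) (by omega) g (fun i => ?_) z
    have := hg i
    omega
  have h3 : φ (D.prodY (Iv (o + b) q) * (D.t (Equiv.swap x y) * (D.e (D.Y y) * z))) =
      φ (D.prodY (Iv (o + b) q) * (D.e (D.Y y) * z)) := by
    refine habs _ (fun i => ?_) _
    rw [swap_apply_val]
    split_ifs <;> omega
  have h4 : ∀ j ∈ (Iv q (q + s) : Finset (Fin r)),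
      φ (D.prodY (Iv (o + b) q) * (D.t (Equiv.swap x y * Equiv.swap y j) * z)) =
        φ (D.prodY (Iv (o + b) q) * z) := by
    intro j hj
    rw [mem_Iv] at hj
    refine habs _ (fun i => ?_) _
    rw [Equiv.Perm.mul_apply, swap_apply_val, swap_apply_val]
    split_ifs <;> omega
  have h5 : ∑ j, (D.c * invSign (Equiv.swap x y) y j) • D.t (Equiv.swap x y * Equiv.swap y j) =
      -∑ j ∈ Iv q (q + s), D.c • D.t (Equiv.swap x y * Equiv.swap y j) := by
    rw [← Finset.sum_neg_distrib, ← Finset.sum_filter_add_sum_filter_not Finset.univ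
      (fun j => j ∈ (Iv q (q + s) : Finset (Fin r))), Finset.filter_univ_mem,
      Finset.sum_eq_zero (s := Finset.univ.filter fun j => j ∉ (Iv q (q + s) : Finset (Fin r))),
      add_zero]
    · refine Finset.sum_congr rfl fun j hj => ?_
      rw [hinv, if_pos hj, mul_neg_one, neg_smul]
    · intro j hj
      rw [hinv, if_neg (Finset.mem_filter.1 hj).2, mul_zero, zero_smul]
  rw [hiv, ← D.prodY_mul_e hxI, mul_assoc, ← mul_assoc (D.e _), ← h3, ← mul_assoc (D.t _), hcl, h5,
    sub_neg_eq_add, add_mul, mul_add, map_add, eq_sub_iff_add_eq, add_right_inj, Finset.sum_mul,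
    Finset.mul_sum, map_sum]
  refine Eq.trans ?_ (Finset.sum_congr rfl fun j hj => ?_ : ∑ j ∈ (Iv q (q + s) : Finset (Fin r)),
    D.c • φ (D.prodY (Iv (o + b) q) * z) = _)
  · rw [Finset.sum_const, card_Iv (by omega), Nat.add_sub_cancel_left, ← natCast_zsmul, smul_smul,
      mul_comm]
  · rw [smul_mul_assoc, mul_smul_comm, map_zsmul, h4 j hj]

/-- One step of the basic expansion. Moving the generator at the next string `P` through `w` leaves
a correction term for every string `j` of the second kind. The terms with `j ∈ Z` combine with the
main term by `Inv.slide` to the term where `P` stays out of the exchange; in those with `j ∉ Z` the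
strings `P` and `j` are exchanged. -/
theorem Inv.exchange_step (hφ : D.Inv o b a φ) (hr : o + b + a ≤ r) {p s : ℕ} (hp : p < a)
    (hs : s ≤ p) {X Z : Finset (Fin r)} (hX : X ⊆ Iv o (o + p)) (hZ : Z ⊆ Iv (o + a) (o + a + b))
    (hZs : Z.card = s) {w : Equiv.Perm (Fin r)} (hw : Exchange o a b p s X Z w)
    (x' : A) (f : Finset (Fin r) → Finset (Fin r) → V)
    (hf₀ : ∀ w', Exchange o a b (p + 1) s X Z w' →
      φ (D.prodY (Iv (o + b) (o + b + (p + 1) - s)) * (D.t w' * x')) = f X Z)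
    (hf₁ : ∀ j ∈ Iv (o + a) (o + a + b) \ Z, ∀ w',
      Exchange o a b (p + 1) (s + 1) (insert ⟨o + p, by omega⟩ X) (insert j Z) w' →
      φ (D.prodY (Iv (o + b) (o + b + (p + 1) - (s + 1))) * (D.t w' * x')) =
        f (insert ⟨o + p, by omega⟩ X) (insert j Z)) :
    φ (D.prodY (Iv (o + b) (o + b + p - s)) * (D.t w * (D.e (D.Y ⟨o + p, by omega⟩) * x'))) =
      f X Z + (-D.c) • ∑ j ∈ Iv (o + a) (o + a + b) \ Z,
        f (insert ⟨o + p, by omega⟩ X) (insert j Z) := by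
  set P : Fin r := ⟨o + p, by omega⟩ with hP
  set q := o + b + p - s with hq
  obtain ⟨x, hx⟩ : ∃ x : Fin r, (x : ℕ) = q := ⟨⟨q, by omega⟩, rfl⟩
  have hPv : (P : ℕ) = o + p := rfl
  have hy : (w P : ℕ) = q + s := by
    have := hw.rest P (by omega) (by omega)
    omega
  have hcl : D.t w * D.e (D.Y P) = D.e (D.Y (w P)) * D.t w -
      ((∑ j ∈ Z, D.c • D.t (w * Equiv.swap P j)) +
        ∑ j ∈ Iv (o + a) (o + a + b) \ Z, D.c • D.t (w * Equiv.swap P j)) := by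
    rw [D.t_mul_y, add_comm, Finset.sum_sdiff hZ]
    congr 1
    refine ((Finset.sum_congr rfl fun j hj => ?_).trans
      (Finset.sum_subset (Finset.subset_univ (Iv (o + a) (o + a + b))) fun j _ hj => ?_)).symm
    · rw [invSign_exchange hw hp hPv, if_pos hj, mul_one]
    · rw [invSign_exchange hw hp hPv, if_neg hj, mul_zero, zero_smul]
  have h1 : ∀ j ∈ Z, φ (D.prodY (Iv (o + b) q) * (D.t (w * Equiv.swap P j) * x')) =
      φ (D.prodY (Iv (o + b) q) * (D.t w * x')) := by
    intro j hj
    have hjw := hw.mem_right j hj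
    have e : w * Equiv.swap P j = Equiv.swap (w P) (w j) * w := by
      rw [Equiv.swap_apply_apply, inv_mul_cancel_right]
    rw [e, map_mul D.t, mul_assoc (D.t _)]
    refine hφ.absorb hr (by omega) (p := q + s + 1) (by omega) (by omega) _ (fun i => ?_) _
    rw [swap_apply_val]
    split_ifs <;> omega
  have h2 : ∀ j ∈ Iv (o + a) (o + a + b) \ Z,
      φ (D.prodY (Iv (o + b) q) * (D.t (w * Equiv.swap P j) * x')) =
        f (insert P X) (insert j Z) := by
    intro j hj
    rw [← hf₁ j hj _ (hw.insert hp hX hZ hPv hj)]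
    congr 4
    omega
  have h3 := hf₀ _ (hw.skip hs (x := x) (y := w P) (by omega) (by omega) hp)
  rw [show o + b + (p + 1) - s = q + 1 by omega, map_mul D.t, mul_assoc (D.t _),
    hφ.slide hr (by omega) (by omega) hx hy] at h3
  rw [← h3, ← mul_assoc (D.t w), hcl, sub_mul, add_mul, Finset.sum_mul, Finset.sum_mul, mul_sub,
    mul_add, Finset.mul_sum, Finset.mul_sum, map_sub, map_add, map_sum, map_sum,
    Finset.sum_congr rfl (fun j hj => by rw [smul_mul_assoc, mul_smul_comm, map_zsmul, h1 j hj]),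
    Finset.sum_congr (s₁ := Iv (o + a) (o + a + b) \ Z) rfl
      (fun j hj => by rw [smul_mul_assoc, mul_smul_comm, map_zsmul, h2 j hj]),
    Finset.sum_const, hZs, ← natCast_zsmul, smul_smul, mul_comm (s : ℤ), ← Finset.smul_sum,
    mul_assoc, neg_smul]
  abel

/-- The basic expansion: the product of the generators over the first `p` strings of the first kind
is moved through the crossing `d` of the strings of the first kind with those of the second kind,
one factor at a time from the left. The factorials count the orders in which the strings in `Z` can
be chosen. -/
theorem t_cross_mul_prodY (hφ : D.Inv o b a φ) (hr : o + b + a ≤ r) {d : Equiv.Perm (Fin r)}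
    (hd : Exchange o a b 0 0 ∅ ∅ d) {p : ℕ} (hp : p ≤ a) (x : A)
    (f : Finset (Fin r) → Finset (Fin r) → V)
    (hf : ∀ X ⊆ Iv o (o + p), ∀ Z ⊆ Iv (o + a) (o + a + b), Z.card = X.card → ∀ w,
      Exchange o a b p X.card X Z w →
      φ (D.prodY (Iv (o + b) (o + b + p - X.card)) * (D.t w * x)) = f X Z) :
    φ (D.t d * (D.prodY (Iv o (o + p)) * x)) =
      ∑ X ∈ (Iv o (o + p)).powerset, ∑ Z ∈ (Iv (o + a) (o + a + b)).powersetCard X.card,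
        ((-D.c) ^ X.card * (X.card.factorial : ℤ)) • f X Z := by
  induction p generalizing x f with
  | zero =>
    have := hf ∅ (by simp) ∅ (by simp) rfl d hd
    simp only [Finset.card_empty, add_zero, Nat.sub_zero, Iv_self, prodY_empty, one_mul] at this ⊢
    simp [this]
  | succ p ih =>
    have hP : (⟨o + p, by omega⟩ : Fin r) ∉ (Iv o (o + p) : Finset (Fin r)) := by simp [mem_Iv]
    rw [show o + (p + 1) = o + p + 1 by rfl, Iv_succ (by omega) (by omega : o + p < r),
      sum_exchange_insert hP, ← D.prodY_mul_e hP, mul_assoc]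
    refine ih (by omega) _ _ fun X hX Z hZ hc w hw => ?_
    have hXp : X.card ≤ p := by
      have := Finset.card_le_card hX
      rw [card_Iv (by omega)] at this
      omega
    have hPX : (⟨o + p, by omega⟩ : Fin r) ∉ X := fun h => hP (hX h)
    refine hφ.exchange_step hr (by omega) hXp hX hZ hc hw x f (fun w' hw' => ?_)
      (fun j hj w' hw' => ?_)
    · exact hf X (hX.trans fun i => by simp only [mem_Iv]; omega) Z hZ hc w' hw'
    · have hcard := Finset.card_insert_of_notMem hPX
      have := hf (insert _ X) ?_ (insert j Z) ?_ ?_ w' (by rwa [hcard])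
      · rwa [hcard] at this
      · refine Finset.insert_subset (by simp [mem_Iv]) (hX.trans fun i => ?_)
        simp only [mem_Iv]
        omega
      · exact Finset.insert_subset (Finset.mem_sdiff.1 hj).1 hZ
      · rw [hcard, Finset.card_insert_of_notMem (Finset.mem_sdiff.1 hj).2, hc]

end HeckeData

/-! ### Inversion of the expansion -/

section combinatorics

variable {ι V : Type*} [AddCommGroup V]

theorem sum_powerset_powersetCard (S T : Finset ι) (g : ℕ → Finset ι → Finset ι → V) :
    ∑ X ∈ S.powerset, ∑ Z ∈ T.powersetCard X.card, g X.card X Z =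
      ∑ s ∈ Finset.range (min S.card T.card + 1), ∑ X ∈ S.powersetCard s,
        ∑ Z ∈ T.powersetCard s, g s X Z := by
  rw [Finset.sum_powerset]
  refine Eq.trans ?_ (Finset.sum_subset (Finset.range_subset_range.2
    (Nat.succ_le_succ (min_le_left _ _))) fun s _ hs => ?_).symm
  · refine Finset.sum_congr rfl fun s _ => Finset.sum_congr rfl fun X hX => ?_
    rw [(Finset.mem_powersetCard.1 hX).2]
  · by_cases h : S.card < s
    · rw [Finset.powersetCard_eq_empty.2 h, Finset.sum_empty]
    · refine Finset.sum_eq_zero fun X _ => ?_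
      rw [Finset.powersetCard_eq_empty.2, Finset.sum_empty]
      rw [Finset.mem_range] at hs
      omega

theorem sum_exchange_map {κ : Type*} (e : ι ≃ κ) (S T : Finset ι)
    (g : Finset κ → Finset κ → V) :
    ∑ X ∈ S.powerset, ∑ Z ∈ T.powersetCard X.card, g (X.map e.toEmbedding) (Z.map e.toEmbedding) =
      ∑ X ∈ (S.map e.toEmbedding).powerset,
        ∑ Z ∈ (T.map e.toEmbedding).powersetCard X.card, g X Z := by
  refine Finset.sum_equiv e.finsetCongr (fun X => ?_) fun X _ => ?_
  · simp [Finset.map_subset_map]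
  · refine Finset.sum_equiv e.finsetCongr (fun Z => ?_) fun Z _ => rfl
    simp [Finset.mem_powersetCard, Finset.map_subset_map]

variable [DecidableEq ι]

theorem sum_powerset_sdiff (S : Finset ι) (g : Finset ι → Finset ι → V) :
    ∑ X ∈ S.powerset, ∑ X' ∈ (S \ X).powerset, g X X' =
      ∑ U ∈ S.powerset, ∑ X ∈ U.powerset, g X (U \ X) := by
  rw [Finset.sum_sigma', Finset.sum_sigma']
  refine Finset.sum_bij' (fun q _ => ⟨q.1 ∪ q.2, q.1⟩) (fun q _ => ⟨q.2, q.1 \ q.2⟩) ?_ ?_ ?_ ?_ ?_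
  · rintro ⟨X, X'⟩ hq
    simp only [Finset.mem_sigma, Finset.mem_powerset] at hq ⊢
    exact ⟨Finset.union_subset hq.1 (hq.2.trans Finset.sdiff_subset), Finset.subset_union_left⟩
  · rintro ⟨U, X⟩ hq
    simp only [Finset.mem_sigma, Finset.mem_powerset] at hq ⊢
    exact ⟨hq.2.trans hq.1, Finset.sdiff_subset_sdiff hq.1 subset_rfl⟩
  · rintro ⟨X, X'⟩ hq
    simp only [Finset.mem_sigma, Finset.mem_powerset] at hq
    rw [Finset.union_sdiff_cancel_left (Finset.disjoint_of_subset_right hq.2 Finset.disjoint_sdiff)]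
  · rintro ⟨U, X⟩ hq
    simp only [Finset.mem_sigma, Finset.mem_powerset] at hq
    simp only [Finset.union_sdiff_of_subset hq.2]
  · rintro ⟨X, X'⟩ hq
    simp only [Finset.mem_sigma, Finset.mem_powerset] at hq
    rw [Finset.union_sdiff_cancel_left (Finset.disjoint_of_subset_right hq.2 Finset.disjoint_sdiff)]

/-- An `(m+n)`-element set is in `(m+n).choose m` ways the disjoint union of an `m`-element and an
`n`-element subset. -/
theorem sum_powersetCard_sdiff (T : Finset ι) (m n : ℕ) (v : Finset ι → V) :
    ∑ Z ∈ T.powersetCard m, ∑ Z' ∈ (T \ Z).powersetCard n, v (Z ∪ Z') =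
      (m + n).choose m • ∑ U ∈ T.powersetCard (m + n), v U := by
  have h : (m + n).choose m • ∑ U ∈ T.powersetCard (m + n), v U =
      ∑ U ∈ T.powersetCard (m + n), ∑ _Z ∈ U.powersetCard m, v U := by
    rw [Finset.smul_sum]
    refine Finset.sum_congr rfl fun U hU => ?_
    rw [Finset.sum_const, Finset.card_powersetCard, (Finset.mem_powersetCard.1 hU).2]
  rw [h, Finset.sum_sigma', Finset.sum_sigma']
  refine Finset.sum_bij' (fun q _ => ⟨q.1 ∪ q.2, q.1⟩) (fun q _ => ⟨q.2, q.1 \ q.2⟩) ?_ ?_ ?_ ?_ ?_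
  · rintro ⟨X, X'⟩ hq
    simp only [Finset.mem_sigma, Finset.mem_powersetCard] at hq ⊢
    obtain ⟨⟨h1, h2⟩, h3, h4⟩ := hq
    refine ⟨⟨Finset.union_subset h1 (h3.trans Finset.sdiff_subset), ?_⟩,
      Finset.subset_union_left, h2⟩
    rw [Finset.card_union_of_disjoint (Finset.disjoint_of_subset_right h3 Finset.disjoint_sdiff),
      h2, h4]
  · rintro ⟨U, X⟩ hq
    simp only [Finset.mem_sigma, Finset.mem_powersetCard] at hq ⊢
    obtain ⟨⟨h1, h2⟩, h3, h4⟩ := hq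
    refine ⟨⟨h3.trans h1, h4⟩, Finset.sdiff_subset_sdiff h1 subset_rfl, ?_⟩
    rw [Finset.card_sdiff_of_subset h3, h2, h4, Nat.add_sub_cancel_left]
  · rintro ⟨X, X'⟩ hq
    simp only [Finset.mem_sigma, Finset.mem_powersetCard] at hq
    rw [Finset.union_sdiff_cancel_left
      (Finset.disjoint_of_subset_right hq.2.1 Finset.disjoint_sdiff)]
  · rintro ⟨U, X⟩ hq
    simp only [Finset.mem_sigma, Finset.mem_powersetCard] at hq
    simp only [Finset.union_sdiff_of_subset hq.2.1]
  · rintro ⟨X, X'⟩ _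
    rfl

/-- The inversion principle: the weights `c ^ s s!` and `(-c) ^ s s!` on pairs of equinumerous
subsets are inverse to each other with respect to disjoint unions. -/
theorem sum_exchange_inversion (S T : Finset ι) (c : ℤ) (v : Finset ι → Finset ι → V) :
    ∑ X ∈ S.powerset, ∑ Z ∈ T.powersetCard X.card, (c ^ X.card * (X.card.factorial : ℤ)) •
      ∑ X' ∈ (S \ X).powerset, ∑ Z' ∈ (T \ Z).powersetCard X'.card,
        ((-c) ^ X'.card * (X'.card.factorial : ℤ)) • v (X ∪ X') (Z ∪ Z') = v ∅ ∅ := by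
  have h1 : ∀ X ∈ S.powerset,
      ∑ Z ∈ T.powersetCard X.card, (c ^ X.card * (X.card.factorial : ℤ)) •
        ∑ X' ∈ (S \ X).powerset, ∑ Z' ∈ (T \ Z).powersetCard X'.card,
          ((-c) ^ X'.card * (X'.card.factorial : ℤ)) • v (X ∪ X') (Z ∪ Z') =
      ∑ X' ∈ (S \ X).powerset, (c ^ X.card * (X.card.factorial : ℤ) *
        ((-c) ^ X'.card * (X'.card.factorial : ℤ)) * ((X.card + X'.card).choose X.card : ℤ)) •
          ∑ U ∈ T.powersetCard (X.card + X'.card), v (X ∪ X') U := by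
    intro X _
    simp only [Finset.smul_sum (r := c ^ X.card * (X.card.factorial : ℤ))]
    rw [Finset.sum_comm]
    refine Finset.sum_congr rfl fun X' _ => ?_
    rw [mul_smul _ ((X.card + X'.card).choose X.card : ℤ), natCast_zsmul,
      ← sum_powersetCard_sdiff T _ _ fun U => v (X ∪ X') U, mul_smul]
    simp only [Finset.smul_sum]
  have h2 : ∀ U ∈ S.powerset, ∑ X ∈ U.powerset, (c ^ X.card * (X.card.factorial : ℤ) *
        ((-c) ^ (U \ X).card * ((U \ X).card.factorial : ℤ)) *
          ((X.card + (U \ X).card).choose X.card : ℤ)) •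
          ∑ Z ∈ T.powersetCard (X.card + (U \ X).card), v (X ∪ U \ X) Z =
      if U = ∅ then v ∅ ∅ else 0 := by
    intro U _
    have e : ∀ m ∈ Finset.range (U.card + 1), U.card.choose m • (c ^ m * (m.factorial : ℤ) *
        ((-c) ^ (U.card - m) * ((U.card - m).factorial : ℤ)) * (U.card.choose m : ℤ)) =
        (-c) ^ U.card * (U.card.factorial : ℤ) * ((-1) ^ m * (U.card.choose m : ℤ)) := by
      intro m hm
      have hm' : m ≤ U.card := Nat.lt_succ_iff.1 (Finset.mem_range.1 hm)
      have e1 : (U.card.choose m : ℤ) * (m.factorial : ℤ) * ((U.card - m).factorial : ℤ) =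
          (U.card.factorial : ℤ) := mod_cast Nat.choose_mul_factorial_mul_factorial hm'
      have e2 : c ^ m = (-1) ^ m * (-c) ^ m := by rw [← mul_pow]; simp
      have e3 : (-c) ^ U.card = (-c) ^ m * (-c) ^ (U.card - m) := by
        rw [← pow_add, Nat.add_sub_cancel' hm']
      rw [nsmul_eq_mul, ← e1, e2, e3]
      ring
    have e4 := Finset.sum_powerset_apply_card (fun m => c ^ m * (m.factorial : ℤ) *
        ((-c) ^ (U.card - m) * ((U.card - m).factorial : ℤ)) * (U.card.choose m : ℤ)) (x := U)
    rw [Finset.sum_congr rfl e, ← Finset.mul_sum, Int.alternating_sum_range_choose] at e4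
    refine Eq.trans (Finset.sum_congr rfl fun X hX => ?_ : _ = ∑ X ∈ U.powerset,
      (c ^ X.card * (X.card.factorial : ℤ) *
        ((-c) ^ (U.card - X.card) * ((U.card - X.card).factorial : ℤ)) *
          (U.card.choose X.card : ℤ)) • ∑ Z ∈ T.powersetCard U.card, v U Z) ?_
    · rw [Finset.mem_powerset] at hX
      have hc := Finset.card_le_card hX
      rw [Finset.card_sdiff_of_subset hX, Finset.union_sdiff_of_subset hX, Nat.add_sub_cancel' hc]
    · rw [← Finset.sum_smul, e4]
      by_cases hU : U = ∅
      · simp [hU]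
      · rw [if_neg hU, if_neg (Finset.card_ne_zero.2 (Finset.nonempty_iff_ne_empty.2 hU)), mul_zero,
          zero_smul]
  rw [Finset.sum_congr rfl h1, sum_powerset_sdiff S fun X X' =>
    (c ^ X.card * (X.card.factorial : ℤ) *
        ((-c) ^ X'.card * (X'.card.factorial : ℤ)) * ((X.card + X'.card).choose X.card : ℤ)) •
          ∑ U ∈ T.powersetCard (X.card + X'.card), v (X ∪ X') U, Finset.sum_congr rfl h2,
    Finset.sum_ite_eq' S.powerset ∅ fun _ => v ∅ ∅, if_pos (Finset.empty_mem_powerset S)]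

end combinatorics

/-- A permutation `z ∈ S_a × S_b` that moves the subset `X` of `[0, a)` to `[0, s)` and the subset
`Z` of `[a, a+b)` to `[a+b-s, a+b)`. -/
structure SplitsAt {r : ℕ} (a b s : ℕ) (X Z : Finset (Fin r)) (z : Equiv.Perm (Fin r)) : Prop where
  lt_iff : ∀ i, (z i : ℕ) < a ↔ (i : ℕ) < a
  mem_left : ∀ i, (z i : ℕ) < s ↔ i ∈ X
  mem_right : ∀ i, a + b ≤ (z i : ℕ) + s ↔ i ∈ Z

/-- The crossing of the `a` strings in the positions `[o, o+a)` with the `b` strings in the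
positions `[o+a, o+a+b)`. -/
def IsCrossing {r : ℕ} (o a b : ℕ) (d : Equiv.Perm (Fin r)) : Prop :=
  ∀ i : Fin r, ((i : ℕ) < o → (d i : ℕ) = i) ∧
    (o ≤ (i : ℕ) → (i : ℕ) < o + a → (d i : ℕ) = i + b) ∧
    (o + a ≤ (i : ℕ) → (i : ℕ) < o + a + b → (d i : ℕ) + a = i) ∧
    (o + a + b ≤ (i : ℕ) → (d i : ℕ) = i)

theorem IsCrossing.exchange {r o a b : ℕ} {d : Equiv.Perm (Fin r)} (hd : IsCrossing o a b d) :
    Exchange o a b 0 0 ∅ ∅ d := by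
  refine ⟨fun i hi => (hd i).1 hi, fun i hi => (hd i).2.2.2 hi, by simp, fun i h1 h2 _ => by omega,
    fun i h1 h2 => (hd i).2.1 h1 h2, by simp, fun i h1 h2 _ => ?_⟩
  have := hd i
  omega

theorem Exchange.of_cross {r o a b : ℕ} {d : Equiv.Perm (Fin r)} (hd : Exchange o a b 0 0 ∅ ∅ d) :
    Exchange o a b a 0 ∅ ∅ d := by
  refine ⟨hd.below, hd.above, by simp, fun i h1 h2 _ => ?_, fun i h1 h2 => by omega, by simp,
    hd.notMem_right⟩
  have := hd.rest i (by omega) (by omega)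
  omega

/-- An exchange of the middle strings after a splitting of both kinds of strings is an exchange. -/
theorem Exchange.mul_splitsAt {r a b s s' : ℕ} (hr : a + b = r) (ha : s ≤ a) (hb : s ≤ b)
    {X X' Z Z' : Finset (Fin r)} {w z : Equiv.Perm (Fin r)}
    (hw : Exchange s (a - s) (b - s) (a - s) s' X' Z' w) (hz : SplitsAt a b s X Z z) :
    Exchange 0 a b a (s + s') (X ∪ X'.map z.symm.toEmbedding) (Z ∪ Z'.map z.symm.toEmbedding)
      (w * z) := by
  have hX : ∀ i, i ∈ X ∪ X'.map z.symm.toEmbedding ↔ i ∈ X ∨ z i ∈ X' := by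
    simp [Finset.mem_map_equiv]
  have hZ : ∀ i, i ∈ Z ∪ Z'.map z.symm.toEmbedding ↔ i ∈ Z ∨ z i ∈ Z' := by
    simp [Finset.mem_map_equiv]
  refine ⟨fun i hi => by omega, fun i hi => by omega, fun i hi => ?_, fun i _ hi hiX => ?_,
    fun i hi hi' => by omega, fun i hi => ?_, fun i hi hi' hiZ => ?_⟩ <;>
    rw [Equiv.Perm.mul_apply]
  · rcases (hX i).1 hi with hi | hi
    · have h1 := (hz.mem_left i).2 hi
      have := hw.below (z i) h1
      omega
    · have := hw.mem_left (z i) hi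
      omega
  · rw [hX, not_or, ← hz.mem_left] at hiX
    have h1 := (hz.lt_iff i).2 (by omega)
    have := hw.notMem_left (z i) (by omega) (by omega) hiX.2
    omega
  · rcases (hZ i).1 hi with hi | hi
    · have h1 := (hz.mem_right i).2 hi
      have := hw.above (z i) (by omega)
      omega
    · have := hw.mem_right (z i) hi
      omega
  · rw [hZ, not_or, ← hz.mem_right] at hiZ
    have h1 := (hz.lt_iff i).not.2 (by omega)
    have := hw.notMem_right (z i) (by omega) (by omega) hiZ.2
    omega

theorem SplitsAt.map_left {r a b s : ℕ} {X Z : Finset (Fin r)} {z : Equiv.Perm (Fin r)}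
    (hz : SplitsAt a b s X Z z) :
    (Iv s a).map z.symm.toEmbedding = Iv 0 a \ X := by
  ext i
  simp only [Finset.mem_map_equiv, Equiv.symm_symm, mem_Iv, Finset.mem_sdiff, ← hz.mem_left,
    hz.lt_iff]
  omega

theorem SplitsAt.map_right {r a b s : ℕ} (hr : a + b = r) {X Z : Finset (Fin r)}
    {z : Equiv.Perm (Fin r)} (hz : SplitsAt a b s X Z z) :
    (Iv a (a + b - s)).map z.symm.toEmbedding = Iv a (a + b) \ Z := by
  ext i
  have := hz.lt_iff i
  simp only [Finset.mem_map_equiv, Equiv.symm_symm, mem_Iv, Finset.mem_sdiff, ← hz.mem_right]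
  omega

namespace HeckeData

variable {R A V : Type*} [CommRing R] [Ring A] [AddCommGroup V] {r : ℕ} {D : HeckeData R A r}
  {a b : ℕ} {φ : A →+ V}

/-- Two permutations that exchange the same sets of strings have the same value under an invariant
functional, after multiplication with the generators on the strings that were not exchanged. -/
theorem Inv.exchange_eq (hφ : D.Inv 0 b a φ) (hr : a + b = r) {s : ℕ} (hs : s ≤ a)
    {X Z : Finset (Fin r)} {w w' : Equiv.Perm (Fin r)} (hw : Exchange 0 a b a s X Z w)
    (hw' : Exchange 0 a b a s X Z w') :
    φ (D.prodY (Iv b (b + a - s)) * D.t w') = φ (D.prodY (Iv b (b + a - s)) * D.t w) := by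
  have := hφ.absorb_of_blocks (p := b + a) (q := b + a - s) (by omega) (by omega) (by omega)
    (by omega) w w' (fun i => ?_) 1
  · simpa only [zero_add, mul_one] using this
  · by_cases hi : (i : ℕ) < a
    · by_cases hX : i ∈ X
      · have := hw.mem_left i hX
        have := hw'.mem_left i hX
        omega
      · have := hw.notMem_left i (by omega) (by omega) hX
        have := hw'.notMem_left i (by omega) (by omega) hX
        omega
    · by_cases hZ : i ∈ Z
      · have := hw.mem_right i hZ
        have := hw'.mem_right i hZ
        omega
      · have := hw.notMem_right i (by omega) (by omega) hZ
        have := hw'.notMem_right i (by omega) (by omega) hZ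
        omega

theorem card_le_of_subset_Iv {a : ℕ} (ha : a ≤ r) {X : Finset (Fin r)} (hX : X ⊆ Iv 0 a) :
    X.card ≤ a := by
  have := Finset.card_le_card hX
  rwa [card_Iv ha] at this

/-- The product of the generators on the strings of the first kind, below the crossing. -/
theorem prodY_below_left (hφ : D.Inv 0 b a φ) (hr : a + b = r) (d : ℕ → Equiv.Perm (Fin r))
    (hd : ∀ s, s ≤ a → s ≤ b → IsCrossing s (a - s) (b - s) (d s))
    (z : Finset (Fin r) → Finset (Fin r) → Equiv.Perm (Fin r))
    (hz : ∀ X ⊆ Iv 0 a, ∀ Z ⊆ Iv a (a + b), Z.card = X.card → SplitsAt a b X.card X Z (z X Z)) :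
    φ (D.t (d 0) * D.prodY (Iv 0 a)) = ∑ s ∈ Finset.range (min a b + 1),
      ∑ X ∈ (Iv 0 a).powersetCard s, ∑ Z ∈ (Iv a (a + b)).powersetCard s,
        ((-D.c) ^ s * (s.factorial : ℤ)) •
          φ (D.prodY (Iv b (b + a - s)) * (D.t (d s) * D.t (z X Z))) := by
  have h := t_cross_mul_prodY hφ (by omega) (hd 0 (by omega) (by omega)).exchange (le_refl a) 1
    (fun X Z => φ (D.prodY (Iv b (b + a - X.card)) * (D.t (d X.card) * D.t (z X Z)))) ?_
  · simp only [zero_add, mul_one] at h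
    rw [h, sum_powerset_powersetCard _ _ fun s X Z => ((-D.c) ^ s * (s.factorial : ℤ)) •
      φ (D.prodY (Iv b (b + a - s)) * (D.t (d s) * D.t (z X Z))), card_Iv (by omega),
      card_Iv (by omega), Nat.add_sub_cancel_left, Nat.sub_zero]
  · intro X hX Z hZ hc w hw
    simp only [zero_add, mul_one] at hX hZ hw ⊢
    have ha := card_le_of_subset_Iv (by omega) hX
    have hb : X.card ≤ b := by
      have := Finset.card_le_card hZ
      rw [card_Iv (by omega)] at this
      omega
    rw [← map_mul D.t]
    refine hφ.exchange_eq hr ha ?_ hw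
    simpa using (hd X.card ha hb).exchange.of_cross.mul_splitsAt hr ha hb (hz X hX Z hZ hc)

/-- The product of the generators on the strings of the first kind, above the crossing. Every
summand on the right is expanded by moving the remaining generators through the smaller crossing;
the double sum over `X` and `X'` then collapses by `sum_exchange_inversion`. -/
theorem prodY_above_right (hφ : D.Inv 0 b a φ) (hr : a + b = r) (d : ℕ → Equiv.Perm (Fin r))
    (hd : ∀ s, s ≤ a → s ≤ b → IsCrossing s (a - s) (b - s) (d s))
    (z : Finset (Fin r) → Finset (Fin r) → Equiv.Perm (Fin r))
    (hz : ∀ X ⊆ Iv 0 a, ∀ Z ⊆ Iv a (a + b), Z.card = X.card → SplitsAt a b X.card X Z (z X Z)) :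
    φ (D.prodY (Iv b (b + a)) * D.t (d 0)) = ∑ s ∈ Finset.range (min a b + 1),
      ∑ X ∈ (Iv 0 a).powersetCard s, ∑ Z ∈ (Iv a (a + b)).powersetCard s,
        (D.c ^ s * (s.factorial : ℤ)) •
          φ (D.t (d s) * (D.prodY (Iv s a) * D.t (z X Z))) := by
  set v : Finset (Fin r) → Finset (Fin r) → V := fun X Z =>
    φ (D.prodY (Iv b (b + a - X.card)) * (D.t (d X.card * z X Z))) with hv
  have hcard : ∀ X : Finset (Fin r), X ⊆ Iv 0 a →
      ∀ Z : Finset (Fin r), Z ⊆ Iv a (a + b) → Z.card = X.card → X.card ≤ a ∧ X.card ≤ b := by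
    intro X hX Z hZ hc
    have := Finset.card_le_card hZ
    rw [card_Iv (by omega)] at this
    have := card_le_of_subset_Iv (by omega) hX
    omega
  have hex : ∀ X ⊆ Iv 0 a, ∀ Z ⊆ Iv a (a + b), Z.card = X.card →
      Exchange 0 a b a X.card X Z (d X.card * z X Z) := by
    intro X hX Z hZ hc
    obtain ⟨ha, hb⟩ := hcard X hX Z hZ hc
    simpa using (hd X.card ha hb).exchange.of_cross.mul_splitsAt hr ha hb (hz X hX Z hZ hc)
  have h0 : v ∅ ∅ = φ (D.prodY (Iv b (b + a)) * D.t (d 0)) := by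
    refine hφ.exchange_eq hr (Nat.zero_le a) (hd 0 (by omega) (by omega)).exchange.of_cross ?_
    exact hex ∅ (by simp) ∅ (by simp) rfl
  -- The remaining generators are moved up through the crossing of the middle strings.
  have hterm : ∀ X ⊆ Iv 0 a, ∀ Z ⊆ Iv a (a + b), Z.card = X.card →
      φ (D.t (d X.card) * (D.prodY (Iv X.card a) * D.t (z X Z))) =
      ∑ X' ∈ (Iv 0 a \ X).powerset, ∑ Z' ∈ (Iv a (a + b) \ Z).powersetCard X'.card,
        ((-D.c) ^ X'.card * (X'.card.factorial : ℤ)) • v (X ∪ X') (Z ∪ Z') := by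
    intro X hX Z hZ hc
    obtain ⟨ha, hb⟩ := hcard X hX Z hZ hc
    have hz' := hz X hX Z hZ hc
    have hφ' : D.Inv X.card (b - X.card) (a - X.card) φ := by
      intro g x hg
      refine hφ g x fun i => ?_
      have := hg i
      omega
    have h := t_cross_mul_prodY hφ' (by omega) (hd X.card ha hb).exchange (le_refl _) (D.t (z X Z))
      (fun X' Z' => v (X ∪ X'.map (z X Z).symm.toEmbedding)
        (Z ∪ Z'.map (z X Z).symm.toEmbedding)) ?_
    · have e1 : X.card + (a - X.card) = a := by omega
      have e2 : a + (b - X.card) = a + b - X.card := by omega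
      rw [e1, e2] at h
      rw [h, ← hz'.map_left, ← hz'.map_right hr, ← sum_exchange_map]
      simp only [Finset.card_map]
    · intro X' hX' Z' hZ' hc' w hw
      have e1 : X.card + (a - X.card) = a := by omega
      have e2 : a + (b - X.card) = a + b - X.card := by omega
      rw [e1] at hX'
      rw [e1, e2] at hZ'
      have hX'' := Finset.map_subset_map (f := (z X Z).symm.toEmbedding) |>.2 hX'
      have hZ'' := Finset.map_subset_map (f := (z X Z).symm.toEmbedding) |>.2 hZ'
      rw [hz'.map_left] at hX''
      rw [hz'.map_right hr] at hZ''
      have hXc : (X ∪ X'.map (z X Z).symm.toEmbedding).card = X.card + X'.card := by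
        rw [Finset.card_union_of_disjoint (Finset.disjoint_of_subset_right hX''
          Finset.disjoint_sdiff), Finset.card_map]
      have hZc : (Z ∪ Z'.map (z X Z).symm.toEmbedding).card = X.card + X'.card := by
        rw [Finset.card_union_of_disjoint (Finset.disjoint_of_subset_right hZ''
          Finset.disjoint_sdiff), Finset.card_map, hc, hc']
      have hXs := Finset.union_subset hX (hX''.trans Finset.sdiff_subset)
      have hZs := Finset.union_subset hZ (hZ''.trans Finset.sdiff_subset)
      have hle := card_le_of_subset_Iv (by omega) hXs
      have h1 := hex _ hXs _ hZs (by rw [hXc, hZc])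
      have h2 := hφ.exchange_eq hr hle h1
        (by rw [hXc]; exact hw.mul_splitsAt hr ha hb hz')
      simp only [hv]
      rw [← h2, hXc, map_mul D.t]
      congr 4 <;> omega
  rw [← h0, ← sum_exchange_inversion (Iv 0 a) (Iv a (a + b)) D.c v]
  have h := sum_powerset_powersetCard (Iv 0 a) (Iv a (a + b)) fun s X Z =>
    (D.c ^ s * (s.factorial : ℤ)) • φ (D.t (d s) * (D.prodY (Iv s a) * D.t (z X Z)))
  rw [card_Iv (by omega), card_Iv (by omega), Nat.add_sub_cancel_left, Nat.sub_zero] at h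
  rw [← h]
  refine Finset.sum_congr rfl fun X hX => Finset.sum_congr rfl fun Z hZ => ?_
  rw [Finset.mem_powerset] at hX
  rw [Finset.mem_powersetCard] at hZ
  rw [hterm X hX Z hZ.1 hZ.2]

end HeckeData

/-! ### Reversing the order of the strings -/

/-- Conjugation of permutations by the order reversing permutation. -/
def conjRev {r : ℕ} : Equiv.Perm (Fin r) →* Equiv.Perm (Fin r) :=
  (MulAut.conj Fin.revPerm).toMonoidHom

theorem conjRev_apply {r : ℕ} (w : Equiv.Perm (Fin r)) (i : Fin r) :
    conjRev w i = (w i.rev).rev := rfl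

theorem conjRev_conjRev {r : ℕ} (w : Equiv.Perm (Fin r)) : conjRev (conjRev w) = w := by
  ext i
  simp [conjRev_apply]

theorem conjRev_adj {r : ℕ} (i : ℕ) (h : i + 1 < r) :
    conjRev (adj r i h) = adj r (r - 2 - i) (by omega) := by
  ext j
  simp only [conjRev_apply, adj, swap_apply_val, Fin.val_rev]
  split_ifs <;> omega

theorem IsCrossing.conjRev {r a b s : ℕ} (hr : a + b = r) (ha : s ≤ a) (hb : s ≤ b)
    {d : Equiv.Perm (Fin r)} (hd : IsCrossing s (a - s) (b - s) d) :
    IsCrossing s (b - s) (a - s) (conjRev d) := by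
  intro i
  have h1 := hd i.rev
  rw [Fin.val_rev] at h1
  rw [conjRev_apply, Fin.val_rev]
  omega

theorem SplitsAt.conjRev {r a b s : ℕ} (hr : a + b = r) {X Z : Finset (Fin r)}
    {z : Equiv.Perm (Fin r)}
    (hz : SplitsAt a b s (Z.map Fin.revPerm.toEmbedding) (X.map Fin.revPerm.toEmbedding) z) :
    SplitsAt b a s X Z (conjRev z) := by
  refine ⟨fun i => ?_, fun i => ?_, fun i => ?_⟩
  · have := hz.lt_iff i.rev
    rw [Fin.val_rev] at this
    rw [conjRev_apply, Fin.val_rev]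
    omega
  · have := hz.mem_right i.rev
    rw [Finset.mem_map_equiv, Fin.revPerm_symm, Fin.revPerm_apply, Fin.rev_rev] at this
    rw [← this, conjRev_apply, Fin.val_rev]
    omega
  · have := hz.mem_left i.rev
    rw [Finset.mem_map_equiv, Fin.revPerm_symm, Fin.revPerm_apply, Fin.rev_rev] at this
    rw [← this, conjRev_apply, Fin.val_rev]
    omega

theorem map_rev_Iv {r p q : ℕ} (hq : q ≤ r) :
    (Iv p q : Finset (Fin r)).map Fin.revPerm.toEmbedding = Iv (r - q) (r - p) := by
  ext i
  rw [Finset.mem_map_equiv, Fin.revPerm_symm, Fin.revPerm_apply, mem_Iv, mem_Iv, Fin.val_rev]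
  omega

theorem sum_powersetCard_rev {r : ℕ} {V : Type*} [AddCommMonoid V] {p q : ℕ} (hq : q ≤ r) (s : ℕ)
    (f : Finset (Fin r) → V) :
    ∑ X ∈ (Iv p q).powersetCard s, f (X.map Fin.revPerm.toEmbedding) =
      ∑ X ∈ (Iv (r - q) (r - p)).powersetCard s, f X := by
  refine Finset.sum_equiv Fin.revPerm.finsetCongr (fun X => ?_) fun X _ => rfl
  rw [← map_rev_Iv hq]
  simp [Finset.mem_powersetCard, Finset.map_subset_map]

namespace HeckeData

variable {R A V : Type*} [CommRing R] [Ring A] [AddCommGroup V] {r : ℕ} (D : HeckeData R A r)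

/-- The symmetry of the degenerate affine Hecke relations that reverses the order of the strings
and changes the sign of the deformation parameter. -/
def rev : HeckeData R A r where
  t := D.t.comp conjRev
  e := D.e
  Y i := D.Y i.rev
  c := -D.c
  adj_y i h := by
    have := D.y_adj (r - 2 - i) (by omega)
    have e1 : (⟨i, Nat.lt_of_succ_lt h⟩ : Fin r).rev = ⟨r - 2 - i + 1, by omega⟩ :=
      Fin.ext (by rw [Fin.val_rev]; simp only; omega)
    have e2 : (⟨i + 1, h⟩ : Fin r).rev = ⟨r - 2 - i, by omega⟩ :=
      Fin.ext (by rw [Fin.val_rev]; simp only; omega)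
    rw [MonoidHom.comp_apply, conjRev_adj, e1, e2, this, Int.cast_neg, sub_neg_eq_add]
  far i h j h1 h2 := by
    rw [MonoidHom.comp_apply, conjRev_adj]
    refine D.far _ _ _ ?_ ?_ <;> rw [Fin.val_rev] <;> omega

theorem rev_t_conjRev (w : Equiv.Perm (Fin r)) : D.rev.t (conjRev w) = D.t w :=
  congrArg D.t (conjRev_conjRev w)

theorem rev_prodY {p q : ℕ} (hq : q ≤ r) : D.rev.prodY (Iv p q) = D.prodY (Iv (r - q) (r - p)) := by
  rw [← map_rev_Iv hq, prodY, prodY, Finset.prod_map]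
  rfl

variable {D} {a b : ℕ} {φ : A →+ V}

theorem Inv.rev (hr : a + b = r) (hφ : D.Inv 0 b a φ) : D.rev.Inv 0 a b φ := by
  intro g x hg
  refine hφ (conjRev g) x fun i => ?_
  have := hg i.rev
  rw [Fin.val_rev] at this
  rw [conjRev_apply, Fin.val_rev]
  omega

theorem splitsAt_rev {z : Finset (Fin r) → Finset (Fin r) → Equiv.Perm (Fin r)} (hr : a + b = r)
    (hz : ∀ X ⊆ Iv 0 a, ∀ Z ⊆ Iv a (a + b), Z.card = X.card → SplitsAt a b X.card X Z (z X Z))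
    {X Z : Finset (Fin r)} (hX : X ⊆ Iv 0 b) (hZ : Z ⊆ Iv b (b + a)) (hc : Z.card = X.card) :
    SplitsAt b a X.card X Z
      (conjRev (z (Z.map Fin.revPerm.toEmbedding) (X.map Fin.revPerm.toEmbedding))) := by
  refine SplitsAt.conjRev hr ?_
  have h1 := Finset.map_subset_map (f := (Fin.revPerm : Equiv.Perm (Fin r)).toEmbedding) |>.2 hX
  have h2 := Finset.map_subset_map (f := (Fin.revPerm : Equiv.Perm (Fin r)).toEmbedding) |>.2 hZ
  rw [map_rev_Iv (by omega), show r - b = a by omega, show r - 0 = a + b by omega] at h1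
  rw [map_rev_Iv (by omega), show r - (b + a) = 0 by omega, show r - b = a by omega] at h2
  have h3 := hz _ h2 _ h1 (by rw [Finset.card_map, Finset.card_map, hc])
  rwa [Finset.card_map, hc] at h3

/-- The product of the generators on the strings of the second kind, below the crossing. This is
`prodY_below_left` for the reversed data, in which the two kinds of strings are interchanged. -/
theorem prodY_below_right (hφ : D.Inv 0 b a φ) (hr : a + b = r) (d : ℕ → Equiv.Perm (Fin r))
    (hd : ∀ s, s ≤ a → s ≤ b → IsCrossing s (a - s) (b - s) (d s))
    (z : Finset (Fin r) → Finset (Fin r) → Equiv.Perm (Fin r))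
    (hz : ∀ X ⊆ Iv 0 a, ∀ Z ⊆ Iv a (a + b), Z.card = X.card → SplitsAt a b X.card X Z (z X Z)) :
    φ (D.t (d 0) * D.prodY (Iv a (a + b))) = ∑ s ∈ Finset.range (min a b + 1),
      ∑ X ∈ (Iv 0 a).powersetCard s, ∑ Z ∈ (Iv a (a + b)).powersetCard s,
        (D.c ^ s * (s.factorial : ℤ)) •
          φ (D.prodY (Iv s b) * (D.t (d s) * D.t (z X Z))) := by
  have h := prodY_below_left (hφ.rev hr) (by omega) (fun s => conjRev (d s))
    (fun s h1 h2 => (hd s h2 h1).conjRev hr h2 h1)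
    (fun X Z => conjRev (z (Z.map Fin.revPerm.toEmbedding) (X.map Fin.revPerm.toEmbedding))) ?_
  · rw [rev_prodY _ (by omega), rev_t_conjRev] at h
    rw [show r - b = a by omega, show r - 0 = a + b by omega] at h
    rw [h, min_comm]
    refine Finset.sum_congr rfl fun s hs => ?_
    rw [Finset.mem_range] at hs
    have hc : D.rev.c = -D.c := rfl
    rw [rev_prodY _ (by omega), show r - (a + b - s) = s by omega, show r - a = b by omega, hc,
      neg_neg]
    simp only [rev_t_conjRev]
    rw [sum_powersetCard_rev (p := 0) (q := b) (by omega) s fun X =>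
      ∑ Z ∈ (Iv b (b + a)).powersetCard s, (D.c ^ s * (s.factorial : ℤ)) •
        φ (D.prodY (Iv s b) * (D.t (d s) * D.t (z (Z.map Fin.revPerm.toEmbedding) X))),
      Finset.sum_comm, sum_powersetCard_rev (by omega) s fun Z =>
      ∑ X ∈ (Iv (r - b) (r - 0)).powersetCard s, (D.c ^ s * (s.factorial : ℤ)) •
        φ (D.prodY (Iv s b) * (D.t (d s) * D.t (z Z X)))]
    rw [show r - (b + a) = 0 by omega, show r - b = a by omega, show r - 0 = a + b by omega]
  · intro X hX Z hZ hc
    exact splitsAt_rev hr hz hX hZ hc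

/-- The product of the generators on the strings of the second kind, above the crossing. This is
`prodY_above_right` for the reversed data. -/
theorem prodY_above_left (hφ : D.Inv 0 b a φ) (hr : a + b = r) (d : ℕ → Equiv.Perm (Fin r))
    (hd : ∀ s, s ≤ a → s ≤ b → IsCrossing s (a - s) (b - s) (d s))
    (z : Finset (Fin r) → Finset (Fin r) → Equiv.Perm (Fin r))
    (hz : ∀ X ⊆ Iv 0 a, ∀ Z ⊆ Iv a (a + b), Z.card = X.card → SplitsAt a b X.card X Z (z X Z)) :
    φ (D.prodY (Iv 0 b) * D.t (d 0)) = ∑ s ∈ Finset.range (min a b + 1),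
      ∑ X ∈ (Iv 0 a).powersetCard s, ∑ Z ∈ (Iv a (a + b)).powersetCard s,
        ((-D.c) ^ s * (s.factorial : ℤ)) •
          φ (D.t (d s) * (D.prodY (Iv a (a + b - s)) * D.t (z X Z))) := by
  have h := prodY_above_right (hφ.rev hr) (by omega) (fun s => conjRev (d s))
    (fun s h1 h2 => (hd s h2 h1).conjRev hr h2 h1)
    (fun X Z => conjRev (z (Z.map Fin.revPerm.toEmbedding) (X.map Fin.revPerm.toEmbedding))) ?_
  · rw [rev_prodY _ (by omega), rev_t_conjRev] at h
    rw [show r - (a + b) = 0 by omega, show r - a = b by omega] at h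
    rw [h, min_comm]
    refine Finset.sum_congr rfl fun s hs => ?_
    rw [Finset.mem_range] at hs
    have hc : D.rev.c = -D.c := rfl
    rw [rev_prodY _ (by omega), show r - s = a + b - s by omega, show r - b = a by omega, hc]
    simp only [rev_t_conjRev]
    rw [sum_powersetCard_rev (p := 0) (q := b) (by omega) s fun X =>
      ∑ Z ∈ (Iv b (b + a)).powersetCard s, ((-D.c) ^ s * (s.factorial : ℤ)) •
        φ (D.t (d s) * (D.prodY (Iv a (a + b - s)) * D.t (z (Z.map Fin.revPerm.toEmbedding) X))),
      Finset.sum_comm, sum_powersetCard_rev (by omega) s fun Z =>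
      ∑ X ∈ (Iv (r - b) (r - 0)).powersetCard s, ((-D.c) ^ s * (s.factorial : ℤ)) •
        φ (D.t (d s) * (D.prodY (Iv a (a + b - s)) * D.t (z Z X)))]
    rw [show r - (b + a) = 0 by omega, show r - b = a by omega, show r - 0 = a + b by omega]
  · intro X hX Z hZ hc
    exact splitsAt_rev hr hz hX hZ hc

end HeckeData

open MulOpposite

/-! ### Morphisms in terms of polynomials over the Hecke algebra -/

namespace IndMod

variable {k : Type u} [CommRing k] {r : ℕ} {l l' : List ℕ}

theorem exists_smul_gen (v : IndMod k r l) : ∃ h : DAHA k r, v = op h • gen k r l := by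
  obtain ⟨h, rfl⟩ := Submodule.Quotient.mk_surjective _ v
  refine ⟨h, ?_⟩
  change _ = Submodule.Quotient.mk (p := indRel k r l) (op h • (1 : DAHA k r))
  rw [op_smul_eq_mul, one_mul]

theorem hom_ext {f g : IndMod k r l →ₗ[(DAHA k r)ᵐᵒᵖ] IndMod k r l'}
    (h : f (gen k r l) = g (gen k r l)) : f = g := by
  ext v
  obtain ⟨p, rfl⟩ := exists_smul_gen v
  rw [map_smul, map_smul, h]

theorem juxt_zero_left {a b r : ℕ} (h : a + b = r) {l l' : List ℕ} (hl : l.sum = a)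
    (v : IndMod k b l') : juxt h hl (0 : IndMod k a l) v = 0 := by
  have := juxt_smul_left h hl (0 : IndMod k a l) v 0
  simpa using this

theorem juxt_zero_right {a b r : ℕ} (h : a + b = r) {l l' : List ℕ} (hl : l.sum = a)
    (u : IndMod k a l) : juxt h hl u (0 : IndMod k b l') = 0 := by
  have := juxt_smul_right h hl u (0 : IndMod k b l') 0
  simpa using this

end IndMod

namespace PolyCat

theorem compHom_apply {C : Type*} [Category C] [Preadditive C] {X Y Z : PolyCat C}
    (f : HomType X Y) (g : HomType Y Z) (n : ℕ) :
    compHom f g n = ∑ x ∈ Finset.HasAntidiagonal.antidiagonal n, f x.1 ≫ g x.2 := by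
  induction f using Finsupp.induction_linear with
  | zero => simp [zero_compHom]
  | add f f' hf hf' =>
    simp only [add_compHom, Finsupp.add_apply, hf, hf', Preadditive.add_comp,
      Finset.sum_add_distrib]
  | single a φ =>
    induction g using Finsupp.induction_linear with
    | zero => simp [compHom_zero]
    | add g g' hg hg' =>
      simp only [compHom_add, Finsupp.add_apply, hg, hg', Preadditive.comp_add,
        Finset.sum_add_distrib]
    | single b ψ =>
      rw [compHom_single]
      by_cases hab : a + b = n
      · rw [Finset.sum_eq_single (a, b)]
        · simp [hab]
        · rintro ⟨x, y⟩ hxy hne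
          rw [Finset.HasAntidiagonal.mem_antidiagonal] at hxy
          by_cases hx : a = x
          · have : b ≠ y := by rintro rfl; exact hne (by rw [hx])
            simp [Finsupp.single_apply, this]
          · simp [Finsupp.single_apply, hx]
        · intro h
          exact absurd (Finset.HasAntidiagonal.mem_antidiagonal.2 hab) h
      · rw [Finset.sum_eq_zero]
        · simp [hab]
        · rintro ⟨x, y⟩ hxy
          rw [Finset.HasAntidiagonal.mem_antidiagonal] at hxy
          by_cases hx : a = x
          · have : b ≠ y := by rintro rfl; exact hab (by rw [hx]; exact hxy)
            simp [Finsupp.single_apply, this]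
          · simp [Finsupp.single_apply, hx]

end PolyCat

namespace ASchur

variable {k : Type u} [CommRing k]

/-- The value of a morphism of the affine Schur category at the generator `m_X ⊗ 1`. -/
def evalGen {X Y : ASchur k} {d : ℕ} (hX : X.parts.sum = d) (hY : Y.parts.sum = d) :
    (X ⟶ Y) →ₗ[k] IndMod k d Y.parts where
  toFun f := f ⟨d, hX, hY⟩ (IndMod.gen k d X.parts)
  map_add' _ _ := rfl
  map_smul' _ _ := rfl

theorem evalGen_inj {X Y : ASchur k} {d : ℕ} (hX : X.parts.sum = d) (hY : Y.parts.sum = d)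
    {f g : X ⟶ Y} (h : evalGen hX hY f = evalGen hX hY g) : f = g := by
  funext ⟨r, h1, h2⟩
  subst hX
  subst h1
  exact IndMod.hom_ext h

theorem evalGen_comp {X Y Z : ASchur k} {d : ℕ} (hX : X.parts.sum = d) (hY : Y.parts.sum = d)
    (hZ : Z.parts.sum = d) {f : X ⟶ Y} {g : Y ⟶ Z} {p q : DAHA k d}
    (hf : evalGen hX hY f = op p • IndMod.gen k d _)
    (hg : evalGen hY hZ g = op q • IndMod.gen k d _) :
    evalGen hX hZ (f ≫ g) = op (q * p) • IndMod.gen k d _ := by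
  change compHom f g ⟨d, hX, hZ⟩ (IndMod.gen k d X.parts) = _
  rw [compHom_pos f g _ hY, LinearMap.comp_apply]
  change g ⟨d, hY, hZ⟩ (evalGen hX hY f) = _
  rw [hf, map_smul]
  change op p • evalGen hY hZ g = _
  rw [hg, ← mul_smul, ← op_mul]

theorem evalGen_hcomp_eq {X Y X' Y' : ASchur k} {a b d : ℕ} (hX : X.parts.sum = a)
    (hY : Y.parts.sum = a) (hX' : X'.parts.sum = b) (hY' : Y'.parts.sum = b) (h : a + b = d)
    (hl : (X.concat X').parts.sum = d) (hr : (Y.concat Y').parts.sum = d)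
    (f : X ⟶ Y) (g : X' ⟶ Y') :
    evalGen hl hr (hcomp f g) = IndMod.juxt h hY (evalGen hX hY f) (evalGen hX' hY' g) := by
  subst hX
  subst hX'
  change hcomp f g ⟨d, hl, hr⟩ (IndMod.gen k d _) = _
  rw [hcomp, dif_pos hY, IndMod.desc_gen]
  rfl

theorem evalGen_hcomp {X Y X' Y' : ASchur k} {a b d : ℕ} (hX : X.parts.sum = a)
    (hY : Y.parts.sum = a) (hX' : X'.parts.sum = b) (hY' : Y'.parts.sum = b) (h : a + b = d)
    (hl : (X.concat X').parts.sum = d) (hr : (Y.concat Y').parts.sum = d)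
    {f : X ⟶ Y} {g : X' ⟶ Y'} {p : DAHA k a} {q : DAHA k b}
    (hf : evalGen hX hY f = op p • IndMod.gen k a _)
    (hg : evalGen hX' hY' g = op q • IndMod.gen k b _) :
    evalGen hl hr (hcomp f g) =
      op (DAHA.shift k 0 a d (by omega) p * DAHA.shift k a b d (by omega) q) •
        IndMod.gen k d _ := by
  rw [evalGen_hcomp_eq hX hY hX' hY' h, hf, hg, IndMod.juxt_mk]

theorem evalGen_id {X : ASchur k} {d : ℕ} (hX : X.parts.sum = d) :
    evalGen hX hX (𝟙 X) = op (1 : DAHA k d) • IndMod.gen k d _ := by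
  rw [op_one, one_smul]
  rfl

theorem evalGen_merge {a b c d : ℕ} (hX : (obj k [a, b]).parts.sum = d)
    (hY : (obj k [c]).parts.sum = d) :
    evalGen hX hY (merge k a b c) = op (1 : DAHA k d) • IndMod.gen k d _ := by
  rw [op_one, one_smul]
  change merge k a b c ⟨d, hX, hY⟩ (IndMod.gen k d _) = _
  rw [merge, IndMod.desc_gen]

theorem evalGen_split {a b c d : ℕ} (hX : (obj k [c]).parts.sum = d)
    (hY : (obj k [a, b]).parts.sum = d) :
    evalGen hX hY (split k c a b) = cosetSum k d [a, b] := by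
  change split k c a b ⟨d, hX, hY⟩ (IndMod.gen k d _) = _
  rw [split, IndMod.desc_gen]

theorem evalGen_cross {a b d : ℕ} (h : a + b = d) (hX : (obj k [a, b]).parts.sum = d)
    (hY : (obj k [b, a]).parts.sum = d) :
    evalGen hX hY (cross k a b) = op (DAHA.t k (crossPerm a b d h)) • IndMod.gen k d _ := by
  change cross k a b ⟨d, hX, hY⟩ (IndMod.gen k d _) = _
  rw [cross, IndMod.desc_gen]

theorem evalGen_pin {r : ℕ} (f : MvPolynomial (Fin r) k) (hf : f.IsSymmetric)
    (hX : (obj k [r]).parts.sum = r) :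
    evalGen hX hX (pin f hf) = op (DAHA.poly k r f) • IndMod.gen k r _ := by
  change pin f hf ⟨r, hX, hX⟩ (IndMod.gen k r _) = _
  rw [pin, IndMod.desc_gen]
  have : MvPolynomial.rename (finCongr (rfl : r = r)) f = f := by
    rw [finCongr_refl]
    exact MvPolynomial.rename_id_apply f
  simp only [this]

/-- The coefficient of `u ^ n` of a morphism of `ASchur[u]`. -/
def homCoeff {X Y : Poly k} (n : ℕ) : (X ⟶ Y) →ₗ[k] (X.of ⟶ Y.of) :=
  (Finsupp.lapply n : (ℕ →₀ (X.of ⟶ Y.of)) →ₗ[k] (X.of ⟶ Y.of))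

theorem homCoeff_monomial {X Y : ASchur k} (m n : ℕ) (φ : X ⟶ Y) :
    homCoeff n (PolyCat.monomial m φ) = if m = n then φ else 0 :=
  Finsupp.single_apply

/-- The coefficient of `u ^ n` of a morphism of `ASchur[u]`, evaluated at the generator. -/
noncomputable def evalCoeff {X Y : Poly k} {d : ℕ} (hX : X.of.parts.sum = d)
    (hY : Y.of.parts.sum = d) (n : ℕ) : (X ⟶ Y) →ₗ[k] IndMod k d Y.of.parts :=
  evalGen hX hY ∘ₗ homCoeff n

theorem evalCoeff_monomial {X Y : ASchur k} {d : ℕ} (hX : X.parts.sum = d)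
    (hY : Y.parts.sum = d) (m n : ℕ) (φ : X ⟶ Y) :
    evalCoeff hX hY n (PolyCat.monomial m φ) = if m = n then evalGen hX hY φ else 0 := by
  rw [evalCoeff, LinearMap.comp_apply, homCoeff_monomial]
  split_ifs
  · rfl
  · exact map_zero _

theorem evalCoeff_inj {X Y : Poly k} {d : ℕ} (hX : X.of.parts.sum = d)
    (hY : Y.of.parts.sum = d) {f g : X ⟶ Y}
    (h : ∀ n, evalCoeff hX hY n f = evalCoeff hX hY n g) : f = g :=
  Finsupp.ext fun n => evalGen_inj hX hY (h n)

/-- The morphism `f` of `ASchur[u]` sends the generator `m_X ⊗ 1` to `m_Y ⊗ p` with a polynomial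
`p` in `u` over the degenerate affine Hecke algebra. -/
def Represents {X Y : Poly k} {d : ℕ} (hX : X.of.parts.sum = d) (hY : Y.of.parts.sum = d)
    (f : X ⟶ Y) (p : Polynomial (DAHA k d)) : Prop :=
  ∀ n, evalCoeff hX hY n f = op (p.coeff n) • IndMod.gen k d _

theorem comp_coeff {X Y Z : Poly k} (f : X ⟶ Y) (g : Y ⟶ Z) (n : ℕ) :
    homCoeff n (f ≫ g) =
      ∑ x ∈ Finset.HasAntidiagonal.antidiagonal n, homCoeff x.1 f ≫ homCoeff x.2 g :=
  PolyCat.compHom_apply f g n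

/-- The order of the factors is reversed because the homomorphisms commute with the right action of
the Hecke algebra. -/
theorem Represents.comp {X Y Z : Poly k} {d : ℕ} {hX : X.of.parts.sum = d}
    {hY : Y.of.parts.sum = d} {hZ : Z.of.parts.sum = d} {f : X ⟶ Y} {g : Y ⟶ Z}
    {p q : Polynomial (DAHA k d)} (hf : Represents hX hY f p) (hg : Represents hY hZ g q) :
    Represents hX hZ (f ≫ g) (q * p) := by
  intro n
  change evalGen hX hZ (homCoeff n (f ≫ g)) = _
  rw [comp_coeff, map_sum, Polynomial.coeff_mul, ← Finset.Nat.sum_antidiagonal_swap, Finset.op_sum,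
    Finset.sum_smul]
  exact Finset.sum_congr rfl fun x _ => evalGen_comp hX hY hZ (hf x.2) (hg x.1)

theorem Represents.hcompU {X Y X' Y' : Poly k} {a b d : ℕ} {hX : X.of.parts.sum = a}
    {hY : Y.of.parts.sum = a} {hX' : X'.of.parts.sum = b} {hY' : Y'.of.parts.sum = b}
    {f : X ⟶ Y} {g : X' ⟶ Y'} {p : Polynomial (DAHA k a)} {q : Polynomial (DAHA k b)}
    (hf : Represents hX hY f p) (hg : Represents hX' hY' g q)
    (h : a + b = d) (hl : (X.of.concat X'.of).parts.sum = d)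
    (hr : (Y.of.concat Y'.of).parts.sum = d) :
    Represents hl hr (hcompU f g)
      (p.map (DAHA.shift k 0 a d (by omega) : DAHA k a →+* DAHA k d) *
        q.map (DAHA.shift k a b d (by omega) : DAHA k b →+* DAHA k d)) := by
  intro n
  have key : ∀ i j, evalGen hl hr (hcomp (homCoeff i f)
      (homCoeff j g)) =
      op (DAHA.shift k 0 a d (by omega) (p.coeff i) * DAHA.shift k a b d (by omega) (q.coeff j)) •
        IndMod.gen k d _ := fun i j =>
    evalGen_hcomp hX hY hX' hY' h hl hr (hf i) (hg j)
  -- The sums in `hcompU` run over the supports of `f` and `g`, which may be smaller than those of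
  -- `p` and `q`, since `p` and `q` are not determined by `f` and `g`.
  have hz1 : ∀ i j, homCoeff i f = 0 →
      op (DAHA.shift k 0 a d (by omega) (p.coeff i) * DAHA.shift k a b d (by omega) (q.coeff j)) •
        IndMod.gen k d (Y.of.parts ++ Y'.of.parts) = 0 := by
    intro i j hi
    have := hf i
    rw [← IndMod.juxt_mk h hY, ← this]
    change IndMod.juxt h hY (evalGen hX hY (homCoeff i f)) _ = 0
    rw [hi, map_zero, IndMod.juxt_zero_left]
  have hz2 : ∀ i j, homCoeff j g = 0 →
      op (DAHA.shift k 0 a d (by omega) (p.coeff i) * DAHA.shift k a b d (by omega) (q.coeff j)) •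
        IndMod.gen k d (Y.of.parts ++ Y'.of.parts) = 0 := by
    intro i j hj
    have := hg j
    rw [← IndMod.juxt_mk h hY, ← this]
    change IndMod.juxt h hY _ (evalGen hX' hY' (homCoeff j g)) = 0
    rw [hj, map_zero, IndMod.juxt_zero_right]
  rw [Polynomial.coeff_mul, Finset.op_sum, Finset.sum_smul, ASchur.hcompU, Finsupp.sum, map_sum]
  simp only [Finsupp.sum, map_sum, Polynomial.coeff_map]
  rw [← Finset.sum_product', Finset.sum_congr rfl fun x _ =>
    (evalCoeff_monomial hl hr (x.1 + x.2) n _).trans (if_congr Iff.rfl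
      (key x.1 x.2) rfl), ← Finset.sum_filter]
  refine Finset.sum_subset_zero_on_sdiff ?_ ?_ fun _ _ => rfl
  · intro x hx
    exact Finset.HasAntidiagonal.mem_antidiagonal.2 (Finset.mem_filter.1 hx).2
  · intro x hx
    rw [Finset.mem_sdiff, Finset.mem_filter, Finset.mem_product,
      Finset.HasAntidiagonal.mem_antidiagonal] at hx
    by_cases h1 : homCoeff x.1 f = 0
    · exact hz1 _ _ h1
    · refine hz2 _ _ ?_
      by_contra h2
      exact hx.2 ⟨⟨Finsupp.mem_support_iff.2 h1, Finsupp.mem_support_iff.2 h2⟩, hx.1⟩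

theorem represents_const {X Y : ASchur k} {d : ℕ} {hX : X.parts.sum = d} {hY : Y.parts.sum = d}
    {φ : X ⟶ Y} {p : DAHA k d} (h : evalGen hX hY φ = op p • IndMod.gen k d _) :
    Represents (X := ⟨X⟩) (Y := ⟨Y⟩) hX hY (PolyCat.const φ) (Polynomial.C p) := by
  intro n
  rw [PolyCat.const, evalCoeff_monomial, Polynomial.coeff_C]
  by_cases hn : n = 0
  · rw [if_pos hn.symm, if_pos hn, h]
  · rw [if_neg (Ne.symm hn), if_neg hn, op_zero, zero_smul]

theorem represents_strand (r : ℕ) (h : (obj k [r]).parts.sum = r) :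
    Represents (X := objU k [r]) (Y := objU k [r]) h h (strand k r) 1 :=
  represents_const (evalGen_id h)

theorem represents_pinU (r : ℕ) (h : (obj k [r]).parts.sum = r) :
    Represents (X := objU k [r]) (Y := objU k [r]) h h (pinU k r)
      ((charPoly k r).map (DAHA.poly k r : _ →+* DAHA k r)) := by
  intro n
  have hdeg : (charPoly k r).natDegree ≤ r := by
    refine (Polynomial.natDegree_prod_le _ _).trans ?_
    refine (Finset.sum_le_sum fun i _ => Polynomial.natDegree_X_sub_C_le _).trans ?_
    simp
  rw [pinU, map_sum, Polynomial.coeff_map]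
  rw [Finset.sum_congr rfl fun m _ => evalCoeff_monomial h h m n _,
    Finset.sum_ite_eq' (Finset.range (r + 1)) n]
  by_cases hn : n < r + 1
  · rw [if_pos (Finset.mem_range.2 hn)]
    exact evalGen_pin _ _ h
  · rw [if_neg (fun hc => hn (Finset.mem_range.1 hc)),
      Polynomial.coeff_eq_zero_of_natDegree_lt (by omega)]
    simp

end ASchur

/-! ### Coset sums as sums over subsets -/

/-- A permutation that moves a subset `S` to a subset `T` of the same cardinality. -/
noncomputable def moveTo {n : ℕ} (T S : Finset (Fin n)) : Equiv.Perm (Fin n) :=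
  if h : S.card = T.card then (Finset.equivOfCardEq h).extendSubtype else 1

theorem moveTo_mem {n : ℕ} {T S : Finset (Fin n)} (h : S.card = T.card) (i : Fin n) :
    moveTo T S i ∈ T ↔ i ∈ S := by
  rw [moveTo, dif_pos h]
  by_cases hi : i ∈ S
  · exact iff_of_true (Equiv.extendSubtype_mem _ i hi) hi
  · exact iff_of_false (Equiv.extendSubtype_not_mem _ i hi) hi

namespace ASchur

variable {k : Type u} [CommRing k]

/-- The right cosets of the stabilizer of a subset `T` in the symmetric group correspond to the
subsets that are moved to `T`. -/
theorem cosetSum_eq {n : ℕ} {l : List ℕ} (T : Finset (Fin n))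
    (hl : ∀ w : Equiv.Perm (Fin n), w ∈ young n l ↔ ∀ i, w i ∈ T ↔ i ∈ T) :
    cosetSum k n l = op (∑ S ∈ (Finset.univ : Finset (Fin n)).powersetCard T.card,
      DAHA.t k (moveTo T S)) • IndMod.gen k n l := by
  classical
  have hrel : ∀ y z : Equiv.Perm (Fin n),
      (Quotient.mk (QuotientGroup.rightRel (young n l)) y = Quotient.mk _ z) ↔
        ∀ i, z i ∈ T ↔ y i ∈ T := by
    intro y z
    rw [Quotient.eq, QuotientGroup.rightRel_apply, hl]
    constructor
    · intro h i
      simpa using h (y i)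
    · intro h i
      simpa using h (y⁻¹ i)
  rw [cosetSum, finsum_eq_sum_of_fintype, Finset.op_sum, Finset.sum_smul]
  symm
  refine Finset.sum_bij (fun S _ => Quotient.mk _ (moveTo T S)) (fun _ _ => Finset.mem_univ _)
    (fun S hS S' hS' h => ?_) (fun q _ => ?_) fun S _ => rfl
  · rw [Finset.mem_powersetCard] at hS hS'
    ext i
    rw [← moveTo_mem hS.2, ← moveTo_mem hS'.2]
    exact ((hrel _ _).1 h i).symm
  · induction q using Quotient.inductionOn with
    | h w =>
      have hc : (T.map w.symm.toEmbedding).card = T.card := Finset.card_map _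
      refine ⟨T.map w.symm.toEmbedding, Finset.mem_powersetCard.2 ⟨Finset.subset_univ _, hc⟩, ?_⟩
      refine (hrel _ _).2 fun i => ?_
      rw [moveTo_mem hc, Finset.mem_map_equiv, Equiv.symm_symm]

theorem mem_young_iff_left {n a b : ℕ} (h : a + b = n) (w : Equiv.Perm (Fin n)) :
    w ∈ young n [a, b] ↔ ∀ i, w i ∈ (Iv 0 a : Finset (Fin n)) ↔ i ∈ (Iv 0 a : Finset (Fin n)) := by
  refine forall_congr' fun i => ?_
  have := (w i).2
  have := i.2
  simp only [blockIdx, mem_Iv]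
  have e : ∀ m, m < n → ¬ m < a → m - a < b := fun m _ _ => by omega
  by_cases h1 : (w i : ℕ) < a <;> by_cases h2 : (i : ℕ) < a <;> simp [h1, h2, e]

theorem mem_young_iff_right {n a b : ℕ} (h : a + b = n) (w : Equiv.Perm (Fin n)) :
    w ∈ young n [a, b] ↔ ∀ i, w i ∈ (Iv a n : Finset (Fin n)) ↔ i ∈ (Iv a n : Finset (Fin n)) := by
  refine forall_congr' fun i => ?_
  have := (w i).2
  have := i.2
  simp only [blockIdx, mem_Iv]
  have e : ∀ m, m < n → ¬ m < a → m - a < b := fun m _ _ => by omega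
  by_cases h1 : (w i : ℕ) < a <;> by_cases h2 : (i : ℕ) < a <;> simp [h1, h2, e] <;> omega

end ASchur

/-- The trace of a set of positions on the interval `[p, p+n)`, as a set of positions in that
interval. -/
def pull {r : ℕ} (p n : ℕ) (h : p + n ≤ r) (X : Finset (Fin r)) : Finset (Fin n) :=
  Finset.univ.filter fun i => DAHA.shiftEmb p n r h i ∈ X

theorem mem_pull {r p n : ℕ} (h : p + n ≤ r) {X : Finset (Fin r)} {i : Fin n} :
    i ∈ pull p n h X ↔ DAHA.shiftEmb p n r h i ∈ X := by
  simp [pull]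

theorem pull_map {r p n : ℕ} (h : p + n ≤ r) (S : Finset (Fin n)) :
    pull p n h (S.map (DAHA.shiftEmb p n r h)) = S := by
  ext i
  simp [pull]

theorem map_shiftEmb_univ {r p n : ℕ} (h : p + n ≤ r) :
    (Finset.univ : Finset (Fin n)).map (DAHA.shiftEmb p n r h) = Iv p (p + n) := by
  ext i
  simp only [Finset.mem_map, Finset.mem_univ, true_and, mem_Iv]
  constructor
  · rintro ⟨j, rfl⟩
    change p ≤ p + (j : ℕ) ∧ p + (j : ℕ) < p + n
    omega
  · intro hi
    exact ⟨⟨i - p, by omega⟩, Fin.ext (Nat.add_sub_cancel' hi.1)⟩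

theorem sum_powersetCard_pull {V : Type*} [AddCommMonoid V] {r p n : ℕ} (h : p + n ≤ r) (s : ℕ)
    (g : Finset (Fin n) → V) :
    ∑ S ∈ (Finset.univ : Finset (Fin n)).powersetCard s, g S =
      ∑ X ∈ (Iv p (p + n) : Finset (Fin r)).powersetCard s, g (pull p n h X) := by
  rw [← map_shiftEmb_univ h, Finset.powersetCard_map, Finset.sum_map]
  exact Finset.sum_congr rfl fun S _ => congrArg g (pull_map h S).symm

theorem card_pull {r p n : ℕ} (h : p + n ≤ r) {X : Finset (Fin r)} (hX : X ⊆ Iv p (p + n)) :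
    (pull p n h X).card = X.card := by
  rw [← map_shiftEmb_univ h, Finset.subset_map_iff] at hX
  obtain ⟨S, -, rfl⟩ := hX
  rw [pull_map, Finset.card_map]

/-- A permutation in `S_a × S_b` that moves `X ⊆ [0, a)` to the bottom and `Z ⊆ [a, a+b)` to the
top. -/
noncomputable def splitPerm {r : ℕ} (a b : ℕ) (h : a + b = r) (s : ℕ) (X Z : Finset (Fin r)) :
    Equiv.Perm (Fin r) :=
  DAHA.shiftPerm 0 a r (by omega) (moveTo (Iv 0 s) (pull 0 a (by omega) X)) *
    DAHA.shiftPerm a b r (by omega) (moveTo (Iv (b - s) b) (pull a b (by omega) Z))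

theorem splitsAt_splitPerm {r a b s : ℕ} (h : a + b = r) (ha : s ≤ a) (hb : s ≤ b)
    {X Z : Finset (Fin r)} (hX : X ⊆ Iv 0 a) (hZ : Z ⊆ Iv a (a + b)) (hXs : X.card = s)
    (hZs : Z.card = s) : SplitsAt a b s X Z (splitPerm a b h s X Z) := by
  have h1 := moveTo_mem (T := Iv 0 s) (S := pull 0 a (r := r) (by omega) X)
    (by rw [card_pull _ (by rwa [zero_add]), card_Iv ha, hXs, Nat.sub_zero])
  have h2 := moveTo_mem (T := Iv (b - s) b) (S := pull a b (r := r) (by omega) Z)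
    (by rw [card_pull _ hZ, card_Iv le_rfl, hZs]; omega)
  have hleft : ∀ i : Fin r, (i : ℕ) < a → ((splitPerm a b h s X Z i : ℕ) < a ∧
      ((splitPerm a b h s X Z i : ℕ) < s ↔ i ∈ X)) := by
    intro i hi
    have e := DAHA.shiftPerm_in 0 a r (by omega)
      (moveTo (Iv 0 s) (pull 0 a (by omega) X)) ⟨i, hi⟩
    have e2 : (⟨0 + i, by omega⟩ : Fin r) = i := Fin.ext (Nat.zero_add _)
    simp only [e2] at e
    have h3 := h1 ⟨i, hi⟩
    have e3 : DAHA.shiftEmb 0 a r (by omega) ⟨i, hi⟩ = i := e2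
    rw [mem_Iv, mem_pull, e3] at h3
    rw [splitPerm, Equiv.Perm.mul_apply, DAHA.shiftPerm_out a b r _ _ _ (Or.inl hi), e, ← h3]
    simp only [zero_add]
    have := (moveTo (Iv 0 s) (pull 0 a (r := r) (by omega) X) ⟨i, hi⟩).2
    omega
  have hright : ∀ i : Fin r, a ≤ (i : ℕ) → (a ≤ (splitPerm a b h s X Z i : ℕ) ∧
      (a + b ≤ (splitPerm a b h s X Z i : ℕ) + s ↔ i ∈ Z)) := by
    intro i hi
    obtain ⟨j, hj⟩ : ∃ j : Fin b, (i : ℕ) = a + j := ⟨⟨i - a, by omega⟩, by simp; omega⟩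
    have e := DAHA.shiftPerm_in a b r (by omega)
      (moveTo (Iv (b - s) b) (pull a b (by omega) Z)) j
    have e2 : (⟨a + j, by omega⟩ : Fin r) = i := Fin.ext hj.symm
    simp only [e2] at e
    have h3 := h2 j
    have e3 : DAHA.shiftEmb a b r (by omega) j = i := e2
    rw [mem_Iv, mem_pull, e3] at h3
    rw [splitPerm, Equiv.Perm.mul_apply, e, DAHA.shiftPerm_out 0 a r _ _ _ (Or.inr (by simp)),
      ← h3]
    simp only
    have := (moveTo (Iv (b - s) b) (pull a b (r := r) (by omega) Z) j).2
    omega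
  refine ⟨fun i => ?_, fun i => ?_, fun i => ?_⟩
  · by_cases hi : (i : ℕ) < a
    · have := hleft i hi
      omega
    · have := hright i (by omega)
      omega
  · by_cases hi : (i : ℕ) < a
    · exact (hleft i hi).2
    · have h3 := hright i (by omega)
      refine iff_of_false (by omega) fun hc => ?_
      have := mem_Iv.1 (hX hc)
      omega
  · by_cases hi : (i : ℕ) < a
    · have h3 := hleft i hi
      refine iff_of_false (by omega) fun hc => ?_
      have := mem_Iv.1 (hZ hc)
      omega
    · exact (hright i (by omega)).2

/-! ### The Hecke data of the affine Schur category -/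

theorem C_mul_X_sub_C_of_adj {B : Type*} [Ring B] {s x x' : B} (h : s * x = x' * s + 1) :
    Polynomial.C s * (Polynomial.X - Polynomial.C x) =
      (Polynomial.X - Polynomial.C x') * Polynomial.C s - 1 := by
  rw [mul_sub, sub_mul, ← Polynomial.C_mul, ← Polynomial.C_mul, h, Polynomial.C_add,
    Polynomial.X_mul_C, Polynomial.C_1, sub_sub]

theorem C_mul_X_sub_C_of_comm {B : Type*} [Ring B] {s x : B} (h : s * x = x * s) :
    Polynomial.C s * (Polynomial.X - Polynomial.C x) =
      (Polynomial.X - Polynomial.C x) * Polynomial.C s := by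
  rw [mul_sub, sub_mul, ← Polynomial.C_mul, ← Polynomial.C_mul, h, Polynomial.X_mul_C]

/-- The degenerate affine Hecke algebra with coefficients extended to `k[u]`; the polynomial
generators are the elements `u - x_i`. -/
noncomputable def dahaData (k : Type u) [CommRing k] (r : ℕ) :
    HeckeData (Polynomial (MvPolynomial (Fin r) k)) (Polynomial (DAHA k r)) r where
  t :=
    { toFun := fun w => Polynomial.C (DAHA.t k w)
      map_one' := by rw [DAHA.t_one, Polynomial.C_1]
      map_mul' := fun v w => by rw [DAHA.t_mul, Polynomial.C_mul] }
  e := Polynomial.mapRingHom (DAHA.poly k r : _ →+* DAHA k r)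
  Y i := Polynomial.X - Polynomial.C (MvPolynomial.X i)
  c := 1
  adj_y i h := by
    simp only [Polynomial.coe_mapRingHom, Polynomial.map_sub, Polynomial.map_X, Polynomial.map_C,
      AlgHom.coe_toRingHom, DAHA.poly_X, Int.cast_one]
    exact C_mul_X_sub_C_of_adj (DAHA.adj_x i h)
  far i h j h1 h2 := by
    simp only [Polynomial.coe_mapRingHom, Polynomial.map_sub, Polynomial.map_X, Polynomial.map_C,
      AlgHom.coe_toRingHom, DAHA.poly_X]
    exact C_mul_X_sub_C_of_comm (DAHA.far i h j h1 h2).symm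

variable {k : Type u} [CommRing k]

/-! ### The polynomials of the layers -/

theorem map_shift_prodY {m r p : ℕ} (h : p + m ≤ r) (S : Finset (Fin m)) :
    ((dahaData k m).prodY S).map (DAHA.shift k p m r h : DAHA k m →+* DAHA k r) =
      (dahaData k r).prodY (S.map (DAHA.shiftEmb p m r h)) := by
  induction S using Finset.induction with
  | empty => simp [HeckeData.prodY_empty]
  | insert i S hi ih =>
    have hi' : DAHA.shiftEmb p m r h i ∉ S.map (DAHA.shiftEmb p m r h) := by simpa using hi
    rw [Finset.map_insert, ← HeckeData.e_mul_prodY _ hi, ← HeckeData.e_mul_prodY _ hi',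
      Polynomial.map_mul, ih]
    congr 1
    simp only [dahaData, Polynomial.coe_mapRingHom, Polynomial.map_sub, Polynomial.map_X,
      Polynomial.map_C, AlgHom.coe_toRingHom, DAHA.poly_X, DAHA.shift_x]
    rfl

theorem map_shiftEmb_Iv {m r p x y : ℕ} (h : p + m ≤ r) (hy : y ≤ m) :
    (Iv x y : Finset (Fin m)).map (DAHA.shiftEmb p m r h) = Iv (p + x) (p + y) := by
  ext i
  simp only [Finset.mem_map, mem_Iv]
  constructor
  · rintro ⟨j, hj, rfl⟩
    change p + x ≤ p + (j : ℕ) ∧ p + (j : ℕ) < p + y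
    omega
  · intro hi
    refine ⟨⟨i - p, by omega⟩, ?_, Fin.ext (Nat.add_sub_cancel' (by omega))⟩
    simp only
    omega

theorem map_shift_prodY_Iv {m r p x y : ℕ} (h : p + m ≤ r) (hy : y ≤ m) :
    ((dahaData k m).prodY (Iv x y)).map (DAHA.shift k p m r h : DAHA k m →+* DAHA k r) =
      (dahaData k r).prodY (Iv (p + x) (p + y)) := by
  rw [map_shift_prodY, map_shiftEmb_Iv h hy]

/-- The crossing of the middle strings after `s` strings have been split off on both sides. -/
noncomputable def midCross (r a b s : ℕ) : Equiv.Perm (Fin r) :=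
  if h : a + b = r ∧ s ≤ a ∧ s ≤ b then
    DAHA.shiftPerm s (a - s + (b - s) + s) r (by omega)
      (DAHA.shiftPerm 0 (a - s + (b - s)) _ (by omega) (ASchur.crossPerm (a - s) (b - s) _ rfl))
  else 1

theorem isCrossing_crossPerm {r a b : ℕ} (h : a + b = r) :
    IsCrossing 0 a b (ASchur.crossPerm a b r h) := by
  intro i
  simp only [ASchur.crossPerm, Equiv.coe_fn_mk]
  by_cases hi : (i : ℕ) < a
  · simp [hi]
    omega
  · simp [hi]
    omega

theorem IsCrossing.shiftPerm {m r p o a b : ℕ} (h : p + m ≤ r) (hm : o + a + b ≤ m)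
    {d : Equiv.Perm (Fin m)} (hd : IsCrossing o a b d) :
    IsCrossing (p + o) a b (DAHA.shiftPerm p m r h d) := by
  intro i
  by_cases hi : (i : ℕ) < p ∨ p + m ≤ i
  · rw [DAHA.shiftPerm_out p m r h d i hi]
    omega
  · obtain ⟨j, hj⟩ : ∃ j : Fin m, (i : ℕ) = p + j := ⟨⟨i - p, by omega⟩, by simp; omega⟩
    have e := DAHA.shiftPerm_in p m r h d j
    have e2 : (⟨p + j, by omega⟩ : Fin r) = i := Fin.ext hj.symm
    rw [e2] at e
    rw [e]
    have := hd j
    simp only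
    omega

theorem isCrossing_midCross {r a b s : ℕ} (h : a + b = r) (ha : s ≤ a) (hb : s ≤ b) :
    IsCrossing s (a - s) (b - s) (midCross r a b s) := by
  rw [midCross, dif_pos ⟨h, ha, hb⟩]
  have h1 : IsCrossing 0 (a - s) (b - s)
      (DAHA.shiftPerm 0 (a - s + (b - s)) (a - s + (b - s) + s) (by omega)
        (ASchur.crossPerm (a - s) (b - s) _ rfl)) :=
    IsCrossing.shiftPerm _ (by omega) (isCrossing_crossPerm rfl)
  exact IsCrossing.shiftPerm _ (by omega) h1

theorem IsCrossing.unique {r o a b : ℕ} {d d' : Equiv.Perm (Fin r)} (hd : IsCrossing o a b d)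
    (hd' : IsCrossing o a b d') : d = d' := by
  ext i
  have := hd i
  have := hd' i
  omega

namespace ASchur

theorem map_charPoly (r : ℕ) : (charPoly k r).map (DAHA.poly k r : _ →+* DAHA k r) =
    (dahaData k r).prodY (Iv 0 r) := by
  have : (Iv 0 r : Finset (Fin r)) = Finset.univ := by
    ext i
    simp [mem_Iv]
  rw [this]
  rfl

variable {r a b s : ℕ}

theorem sum_pair (h : a + b = r) : (obj k [a, b]).parts.sum = r := by simpa using h

theorem sum_quadruple {m n : ℕ} (h : s + (m + (n + s)) = r) :
    (obj k [s, m, n, s]).parts.sum = r := by simpa using h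

theorem represents_pinU_prodY (r : ℕ) :
    Represents (X := objU k [r]) (Y := objU k [r]) (List.sum_singleton) (List.sum_singleton)
      (pinU k r) ((dahaData k r).prodY (Iv 0 r)) := by
  rw [← map_charPoly]
  exact represents_pinU r _

theorem represents_pin_left (h : a + b = r) :
    Represents (X := objU k [a, b]) (Y := objU k [a, b]) (sum_pair h) (sum_pair h)
      (ASchur.hcompU (pinU k a) (strand k b)) ((dahaData k r).prodY (Iv 0 a)) := by
  have := (represents_pinU_prodY (k := k) a).hcompU
    (represents_strand (k := k) b List.sum_singleton) h (sum_pair h) (sum_pair h)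
  rw [Polynomial.map_one, mul_one, map_shift_prodY_Iv _ le_rfl, zero_add, zero_add] at this
  exact this

theorem represents_pin_right (h : a + b = r) :
    Represents (X := objU k [a, b]) (Y := objU k [a, b]) (sum_pair h) (sum_pair h)
      (ASchur.hcompU (strand k a) (pinU k b)) ((dahaData k r).prodY (Iv a (a + b))) := by
  have := (represents_strand (k := k) a List.sum_singleton).hcompU
    (represents_pinU_prodY (k := k) b) h (sum_pair h) (sum_pair h)
  rw [Polynomial.map_one, one_mul, map_shift_prodY_Iv _ le_rfl, add_zero] at this
  exact this

theorem represents_pinSecond {m n : ℕ} (h : s + (m + (n + s)) = r) :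
    Represents (X := objU k [s, m, n, s]) (Y := objU k [s, m, n, s]) (sum_quadruple h)
      (sum_quadruple h) (pinSecond k s m n) ((dahaData k r).prodY (Iv s (s + m))) := by
  have h1 := (represents_strand (k := k) n List.sum_singleton).hcompU
    (represents_strand (k := k) s List.sum_singleton) rfl (sum_pair rfl) (sum_pair rfl)
  have e1 : (obj k [m, n, s]).parts.sum = m + (n + s) := by simp
  have h2 := (represents_pinU_prodY (k := k) m).hcompU h1 rfl e1 e1
  have h3 := (represents_strand (k := k) s List.sum_singleton).hcompU h2 h (sum_quadruple h)
    (sum_quadruple h)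
  simp only [Polynomial.map_one, one_mul, mul_one] at h3
  rw [map_shift_prodY_Iv _ le_rfl, map_shift_prodY_Iv _ (by omega), zero_add, zero_add,
    add_zero] at h3
  exact h3

theorem represents_pinThird {m n : ℕ} (h : s + (m + (n + s)) = r) :
    Represents (X := objU k [s, m, n, s]) (Y := objU k [s, m, n, s]) (sum_quadruple h)
      (sum_quadruple h) (pinThird k s m n) ((dahaData k r).prodY (Iv (s + m) (s + m + n))) := by
  have h1 := (represents_pinU_prodY (k := k) n).hcompU
    (represents_strand (k := k) s List.sum_singleton) rfl (sum_pair rfl) (sum_pair rfl)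
  have e1 : (obj k [m, n, s]).parts.sum = m + (n + s) := by simp
  have h2 := (represents_strand (k := k) m List.sum_singleton).hcompU h1 rfl e1 e1
  have h3 := (represents_strand (k := k) s List.sum_singleton).hcompU h2 h (sum_quadruple h)
    (sum_quadruple h)
  simp only [Polynomial.map_one, one_mul, mul_one] at h3
  rw [map_shift_prodY_Iv _ le_rfl, map_shift_prodY_Iv _ (by omega), map_shift_prodY_Iv _ (by omega),
    zero_add, zero_add, add_zero, ← add_assoc] at h3
  exact h3

theorem represents_crossU (h : a + b = r) :
    Represents (X := objU k [a, b]) (Y := objU k [b, a]) (sum_pair h)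
      (sum_pair ((add_comm b a).trans h)) (crossU k a b)
      ((dahaData k r).t (midCross r a b 0)) := by
  rw [(isCrossing_midCross h (Nat.zero_le a) (Nat.zero_le b)).unique (isCrossing_crossPerm h)]
  exact represents_const (evalGen_cross h _ _)

theorem represents_crossLayer (h : a + b = r) (ha : s ≤ a) (hb : s ≤ b) :
    Represents (X := objU k [s, a - s, b - s, s]) (Y := objU k [s, b - s, a - s, s])
      (sum_quadruple (by omega)) (sum_quadruple (by omega)) (crossLayer k a b s)
      ((dahaData k r).t (midCross r a b s)) := by
  have h1 := evalGen_hcomp (X := obj k [a - s, b - s]) (Y := obj k [b - s, a - s])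
    (X' := obj k [s]) (Y' := obj k [s]) (sum_pair rfl) (sum_pair (add_comm _ _)) List.sum_singleton
    List.sum_singleton rfl (by simp; omega) (by simp; omega)
    (evalGen_cross rfl _ _) (evalGen_id (k := k) List.sum_singleton)
  have h2 := evalGen_hcomp (X := obj k [s]) (Y := obj k [s]) (d := r) List.sum_singleton
    List.sum_singleton _ _ (by omega) (sum_quadruple (by omega)) (sum_quadruple (by omega))
    (evalGen_id (k := k) List.sum_singleton) h1
  rw [map_one, map_one, mul_one, one_mul, DAHA.shift_t, DAHA.shift_t] at h2
  rw [midCross, dif_pos ⟨h, ha, hb⟩]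
  exact represents_const h2

theorem represents_mergeLayer (h : a + b = r) (ha : s ≤ a) (hb : s ≤ b) :
    Represents (X := objU k [s, b - s, a - s, s]) (Y := objU k [b, a])
      (sum_quadruple (by omega)) (sum_pair (by omega)) (mergeLayer k a b s)
      (1 : Polynomial (DAHA k r)) := by
  have h1 := evalGen_hcomp (k := k) (d := r) (X := obj k [s, b - s]) (Y := obj k [b])
    (X' := obj k [a - s, s]) (Y' := obj k [a]) (sum_pair (by omega)) List.sum_singleton
    (sum_pair (by omega)) List.sum_singleton (by omega) (by simp; omega) (by simp; omega)
    (evalGen_merge _ _) (evalGen_merge _ _)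
  rw [map_one, map_one, mul_one] at h1
  exact represents_const h1

/-- The coset representatives for the two splits are indexed by the sets `X` and `Z` of the strings
that are moved to the outer sides. -/
theorem represents_splitLayer (h : a + b = r) (ha : s ≤ a) (hb : s ≤ b) :
    Represents (X := objU k [a, b]) (Y := objU k [s, a - s, b - s, s])
      (sum_pair h) (sum_quadruple (by omega)) (splitLayer k a b s)
      (∑ X ∈ (Iv 0 a).powersetCard s, ∑ Z ∈ (Iv a (a + b)).powersetCard s,
        (dahaData k r).t (splitPerm a b h s X Z)) := by
  have e1 : evalGen (X := obj k [a]) (Y := obj k [s, a - s]) (List.sum_singleton)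
      (sum_pair (by omega)) (split k a s (a - s)) = _ :=
    (evalGen_split _ _).trans (cosetSum_eq (Iv 0 s) (mem_young_iff_left (by omega)))
  have e2 : evalGen (X := obj k [b]) (Y := obj k [b - s, s]) (List.sum_singleton)
      (sum_pair (by omega)) (split k b (b - s) s) = _ :=
    (evalGen_split _ _).trans (cosetSum_eq (Iv (b - s) b) (mem_young_iff_right (by omega)))
  have h1 := evalGen_hcomp (k := k) (d := r) (X := obj k [a]) (Y := obj k [s, a - s])
    (X' := obj k [b]) (Y' := obj k [b - s, s]) List.sum_singleton (sum_pair (by omega))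
    List.sum_singleton (sum_pair (by omega)) (by omega) (by simp; omega) (by simp; omega)
    e1 e2
  rw [map_sum, map_sum, card_Iv ha, card_Iv le_rfl, Nat.sub_zero, Nat.sub_sub_self hb,
    sum_powersetCard_pull (r := r) (p := 0) (by omega),
    sum_powersetCard_pull (r := r) (p := a) (by omega), Finset.sum_mul_sum] at h1
  simp only [zero_add, DAHA.shift_t, ← DAHA.t_mul] at h1
  have h2 := represents_const h1
  simp only [map_sum] at h2
  exact h2

/-- The functional that sends a polynomial in `u` over the degenerate affine Hecke algebra to the
coefficient of `u ^ n` of its product with the generator `m_l ⊗ 1`. -/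
noncomputable def genCoeff (k : Type u) [CommRing k] (r : ℕ) (l : List ℕ) (n : ℕ) :
    Polynomial (DAHA k r) →+ IndMod k r l where
  toFun p := op (p.coeff n) • IndMod.gen k r l
  map_zero' := by simp
  map_add' p q := by rw [Polynomial.coeff_add, MulOpposite.op_add, add_smul]

/-- The generator `m_{(b,a)} ⊗ 1` absorbs the permutations in `S_b × S_a`. -/
theorem genCoeff_inv (h : a + b = r) (n : ℕ) :
    (dahaData k r).Inv 0 b a (genCoeff k r [b, a] n) := by
  intro g x hg
  change op ((Polynomial.C (DAHA.t k g) * x).coeff n) • IndMod.gen k r [b, a] =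
    op (x.coeff n) • IndMod.gen k r [b, a]
  rw [Polynomial.coeff_C_mul, op_mul, mul_smul, IndMod.gen_t]
  refine (mem_young_iff_left (by omega) g).2 fun i => ?_
  have := hg i
  simp only [mem_Iv]
  omega

theorem splitsAt_splitPerm_card (h : a + b = r) (X : Finset (Fin r)) (hX : X ⊆ Iv 0 a)
    (Z : Finset (Fin r)) (hZ : Z ⊆ Iv a (a + b)) (hc : Z.card = X.card) :
    SplitsAt a b X.card X Z (splitPerm a b h X.card X Z) := by
  refine splitsAt_splitPerm h ?_ ?_ hX hZ rfl hc
  · exact HeckeData.card_le_of_subset_Iv (by omega) hX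
  · have := Finset.card_le_card hZ
    rw [card_Iv (by omega)] at this
    omega

end ASchur

/-! ### Moving a pin through the crossing -/

namespace ASchur

variable {r a b s : ℕ}

theorem Represents.evalCoeff_layers (h : a + b = r) (ha : s ≤ a) (hb : s ≤ b)
    {g : objU k [s, a - s, b - s, s] ⟶ objU k [s, b - s, a - s, s]} {p : Polynomial (DAHA k r)}
    (hg : Represents (sum_quadruple (by omega)) (sum_quadruple (by omega)) g p) (n : ℕ) :
    evalCoeff (X := objU k [a, b]) (Y := objU k [b, a]) (sum_pair h) (sum_pair (by omega)) n
        (splitLayer k a b s ≫ g ≫ mergeLayer k a b s) =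
      ∑ X ∈ (Iv 0 a).powersetCard s, ∑ Z ∈ (Iv a (a + b)).powersetCard s,
        genCoeff k r [b, a] n (p * (dahaData k r).t (splitPerm a b h s X Z)) := by
  refine ((represents_splitLayer h ha hb).comp (hg.comp (represents_mergeLayer h ha hb)) n).trans ?_
  rw [one_mul, Finset.mul_sum]
  simp only [Finset.mul_sum, ← map_sum]
  rfl

/-- A morphism `(a, b) → (b, a)` of `ASchur[u]` is a combination of morphisms that factor through
the split and merge layers if this holds for the values at the generator. -/
theorem Represents.eq_sum_layers (h : a + b = r) {f : objU k [a, b] ⟶ objU k [b, a]}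
    {P : Polynomial (DAHA k r)} (hf : Represents (sum_pair h) (sum_pair (by omega)) f P)
    {g : ∀ s, objU k [s, a - s, b - s, s] ⟶ objU k [s, b - s, a - s, s]}
    {p : ℕ → Polynomial (DAHA k r)}
    (hg : ∀ s (ha : s ≤ a) (hb : s ≤ b),
      Represents (sum_quadruple (by omega)) (sum_quadruple (by omega)) (g s) (p s))
    {c : ℕ → ℤ} {c' : ℕ → k} (hc : ∀ s, (c s : k) = c' s)
    (hP : ∀ n, genCoeff k r [b, a] n P = ∑ s ∈ Finset.range (min a b + 1),
      ∑ X ∈ (Iv 0 a).powersetCard s, ∑ Z ∈ (Iv a (a + b)).powersetCard s,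
        c s • genCoeff k r [b, a] n (p s * (dahaData k r).t (splitPerm a b h X.card X Z))) :
    f = ∑ s ∈ Finset.range (min a b + 1),
      c' s • (splitLayer k a b s ≫ g s ≫ mergeLayer k a b s) := by
  refine evalCoeff_inj (sum_pair h) (sum_pair (by omega)) fun n => ?_
  rw [map_sum]
  refine ((hf n).trans (hP n)).trans (Finset.sum_congr rfl fun s hs => ?_)
  have hs' := Finset.mem_range.1 hs
  rw [map_smul, Represents.evalCoeff_layers h (by omega) (by omega) (hg s (by omega) (by omega)),
    ← hc, Int.cast_smul_eq_zsmul, Finset.smul_sum]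
  refine Finset.sum_congr rfl fun X hX => ?_
  rw [Finset.smul_sum, (Finset.mem_powersetCard.1 hX).2]

theorem pinLeft_comp_cross (k : Type u) [CommRing k] (a b : ℕ) :
    hcompU (pinU k a) (strand k b) ≫ crossU k a b =
      ∑ s ∈ Finset.range (min a b + 1), ((-1) ^ s * (s.factorial : k)) •
        (splitLayer k a b s ≫ crossLayer k a b s ≫ pinThird k s (b - s) (a - s) ≫
          mergeLayer k a b s) := by
  have hX := represents_crossU (k := k) (r := a + b) (a := a) (b := b) rfl
  have hcross : ∀ s (ha : s ≤ a) (hb : s ≤ b), _ := fun s ha hb =>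
    represents_crossLayer (k := k) (r := a + b) rfl ha hb
  refine (((represents_pin_left rfl).comp hX).eq_sum_layers rfl
    (fun s ha hb => (hcross s ha hb).comp (represents_pinThird (by omega)))
    (c := fun s => (-1) ^ s * (s.factorial : ℤ)) (fun s => by push_cast; rfl) fun n => ?_).trans ?_
  · refine (HeckeData.prodY_below_left (genCoeff_inv rfl n) rfl _
      (fun s ha hb => isCrossing_midCross rfl ha hb) _ (splitsAt_splitPerm_card rfl)).trans ?_
    refine Finset.sum_congr rfl fun s hs => ?_
    have hs' := Finset.mem_range.1 hs
    rw [show s + (b - s) = b by omega, show b + (a - s) = b + a - s by omega]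
    simp only [mul_assoc]
    rfl
  · simp only [Category.assoc]

theorem cross_comp_pinLeft (k : Type u) [CommRing k] (a b : ℕ) :
    crossU k a b ≫ hcompU (pinU k b) (strand k a) =
      ∑ s ∈ Finset.range (min a b + 1), ((-1) ^ s * (s.factorial : k)) •
        (splitLayer k a b s ≫ pinThird k s (a - s) (b - s) ≫ crossLayer k a b s ≫
          mergeLayer k a b s) := by
  have hX := represents_crossU (k := k) (r := a + b) (a := a) (b := b) rfl
  have hcross : ∀ s (ha : s ≤ a) (hb : s ≤ b), _ := fun s ha hb =>
    represents_crossLayer (k := k) (r := a + b) rfl ha hb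
  refine ((hX.comp (represents_pin_left (add_comm b a))).eq_sum_layers rfl
    (fun s ha hb => (represents_pinThird (by omega)).comp (hcross s ha hb))
    (c := fun s => (-1) ^ s * (s.factorial : ℤ)) (fun s => by push_cast; rfl) fun n => ?_).trans ?_
  · refine (HeckeData.prodY_above_left (genCoeff_inv rfl n) rfl _
      (fun s ha hb => isCrossing_midCross rfl ha hb) _ (splitsAt_splitPerm_card rfl)).trans ?_
    refine Finset.sum_congr rfl fun s hs => ?_
    have hs' := Finset.mem_range.1 hs
    rw [show s + (a - s) = a by omega, show a + (b - s) = a + b - s by omega]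
    simp only [mul_assoc]
    rfl
  · simp only [Category.assoc]

theorem pinRight_comp_cross (k : Type u) [CommRing k] (a b : ℕ) :
    hcompU (strand k a) (pinU k b) ≫ crossU k a b =
      ∑ s ∈ Finset.range (min a b + 1), (s.factorial : k) •
        (splitLayer k a b s ≫ crossLayer k a b s ≫ pinSecond k s (b - s) (a - s) ≫
          mergeLayer k a b s) := by
  have hX := represents_crossU (k := k) (r := a + b) (a := a) (b := b) rfl
  have hcross : ∀ s (ha : s ≤ a) (hb : s ≤ b), _ := fun s ha hb =>
    represents_crossLayer (k := k) (r := a + b) rfl ha hb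
  refine (((represents_pin_right rfl).comp hX).eq_sum_layers rfl
    (fun s ha hb => (hcross s ha hb).comp (represents_pinSecond (by omega)))
    (c := fun s => (s.factorial : ℤ)) (fun s => by push_cast; rfl) fun n => ?_).trans ?_
  · refine (HeckeData.prodY_below_right (genCoeff_inv rfl n) rfl _
      (fun s ha hb => isCrossing_midCross rfl ha hb) _ (splitsAt_splitPerm_card rfl)).trans ?_
    refine Finset.sum_congr rfl fun s hs => ?_
    have hs' := Finset.mem_range.1 hs
    rw [show s + (b - s) = b by omega, show (dahaData k (a + b)).c = 1 from rfl, one_pow, one_mul]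
    simp only [mul_assoc]
  · simp only [Category.assoc]

theorem cross_comp_pinRight (k : Type u) [CommRing k] (a b : ℕ) :
    crossU k a b ≫ hcompU (strand k b) (pinU k a) =
      ∑ s ∈ Finset.range (min a b + 1), (s.factorial : k) •
        (splitLayer k a b s ≫ pinSecond k s (a - s) (b - s) ≫ crossLayer k a b s ≫
          mergeLayer k a b s) := by
  have hX := represents_crossU (k := k) (r := a + b) (a := a) (b := b) rfl
  have hcross : ∀ s (ha : s ≤ a) (hb : s ≤ b), _ := fun s ha hb =>
    represents_crossLayer (k := k) (r := a + b) rfl ha hb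
  refine ((hX.comp (represents_pin_right (add_comm b a))).eq_sum_layers rfl
    (fun s ha hb => (represents_pinSecond (by omega)).comp (hcross s ha hb))
    (c := fun s => (s.factorial : ℤ)) (fun s => by push_cast; rfl) fun n => ?_).trans ?_
  · refine (HeckeData.prodY_above_right (genCoeff_inv rfl n) rfl _
      (fun s ha hb => isCrossing_midCross rfl ha hb) _ (splitsAt_splitPerm_card rfl)).trans ?_
    refine Finset.sum_congr rfl fun s hs => ?_
    have hs' := Finset.mem_range.1 hs
    rw [show s + (a - s) = a by omega, show (dahaData k (a + b)).c = 1 from rfl, one_pow, one_mul]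
    simp only [mul_assoc]
  · simp only [Category.assoc]

end ASchur

end AffineSchur

/-- In `ASchur[u]`, over an arbitrary commutative ring `k` and for all `a, b ≥ 0`, the pin labelled
by the generating function `∏ (u - x_i)` on one leg of the thick crossing of strings of
thickness `a` and `b` moves to the other side of the crossing along its string. The four parts
treat the pins on the bottom left, top left, bottom right and top right leg. Diagrams are read
from bottom to top: `f ≫ g` is the diagram `g` stacked on top of `f`. -/
theorem theorem5p1 {k : Type u} [CommRing k] (a b : ℕ) :
    (hcompU (pinU k a) (strand k b) ≫ crossU k a b =
      ∑ s ∈ Finset.range (min a b + 1), ((-1) ^ s * (s.factorial : k)) •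
        (splitLayer k a b s ≫ crossLayer k a b s ≫ pinThird k s (b - s) (a - s) ≫
          mergeLayer k a b s)) ∧
    (crossU k a b ≫ hcompU (pinU k b) (strand k a) =
      ∑ s ∈ Finset.range (min a b + 1), ((-1) ^ s * (s.factorial : k)) •
        (splitLayer k a b s ≫ pinThird k s (a - s) (b - s) ≫ crossLayer k a b s ≫
          mergeLayer k a b s)) ∧
    (hcompU (strand k a) (pinU k b) ≫ crossU k a b =
      ∑ s ∈ Finset.range (min a b + 1), (s.factorial : k) •
        (splitLayer k a b s ≫ crossLayer k a b s ≫ pinSecond k s (b - s) (a - s) ≫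
          mergeLayer k a b s)) ∧
    (crossU k a b ≫ hcompU (strand k b) (pinU k a) =
      ∑ s ∈ Finset.range (min a b + 1), (s.factorial : k) •
        (splitLayer k a b s ≫ pinSecond k s (a - s) (b - s) ≫ crossLayer k a b s ≫
          mergeLayer k a b s)) :=
  ⟨AffineSchur.ASchur.pinLeft_comp_cross k a b, AffineSchur.ASchur.cross_comp_pinLeft k a b,
    AffineSchur.ASchur.pinRight_comp_cross k a b, AffineSchur.ASchur.cross_comp_pinRight k a b⟩
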